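/- **Setting.** An *EER schema* $\mathcal C$ (without attributes) consists of finitely many entities and relationships. Each relationship $R$ is declared among entities $E_1,\dots,E_n$, $n\ge 2$. There may be is-a declarations between entities, is-a declarations $R \text{ isa } R'[j_1,\dots,j_n]$ between relationships of the same arity $n$ (with $(j_1,\dots,j_n)$ a permutation of $(1,\dots,n)$), and declarations that the entity at component $c$ of $R$ participates at least once, or at most once, in $R$ as $c$-th component. The associated relational schema $\mathcal R$ has a unary predicate $e$ per entity and an $n$-ary predicate $r$ per $n$-ary relationship. The set $\Sigma=\Sigma_I\cup\Sigma_K$ of *conceptual dependencies* (CDs) of $\mathcal C$ consists of the inclusion dependencies (IDs) $e[1]\subseteq e'[1]$ (entity is-a), $r[i]\subseteq e_i[1]$ (all $r$, $i$), $r[1,\dots,n]\subseteq r'[j_1,\dots,j_n]$ (relationship is-a), $e_c[1]\subseteq r[c]$ (mandatory participation), and of the key dependencies (KDs) $\mathrm{key}(r)=\{c\}$ (participation at most once). Values are non-fresh constants from an infinite set $\Gamma$ and fresh constants $\alpha_0,\alpha_1,\dots$. Let $q$ be a conjunctive query over $\mathcal R$ with constants in $\Gamma$, distinct head variables, and all head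 variables occurring in its body. For a finite database $D$ with constants in $\Gamma$, $\mathrm{ans}(q,\Sigma,D)$ is the set of tuples $t$ over $\Gamma$ such that $t\in q(B)$ for every (possibly infinite) database $B\supseteq D$ with values in $\Gamma\cup\{\alpha_0,\alpha_1,\dots\}$ that satisfies $\Sigma$. **Chase.** The chase of $D$ starts from $D$, all of whose facts have level $0$. While the KD rule is applicable (two distinct facts $r(t),r(t')$ agree on the key), it is applied to the pair with the least minimum level: at each non-key position in turn, the two values are replaced everywhere by a non-fresh constant if one of them is non-fresh, and by the earlier one if both are fresh. If they are distinct non-fresh constants, the construction *fails*. Merged facts keep the minimum level. Otherwise the ID rule is applied once: if $r[\bar X]\subseteq s[\bar Y]$ is violated by $r(t)$, a fact for $s$ is added that has $t[\bar X]$ in the positions $\bar Y$ and new fresh constants elsewhere, at the level of $r(t)$ plus one. Full-width IDs have priority, then facts of lowest level. Ties are broken by arbitrary fixed linear orders on facts, pairs of facts and dependencies. The chase *exists* if this (possibly infinite) construction never fails. **Program.** For every unary ID $\sigma$ and every position $j$ of its right-hand predicate, let $f_{\sigma,j}$ be a unary function symbol. An *annotation element* is a term $f_1(\cdots f_m(\bullet)\cdots)$,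 $m\ge 0$, over these symbols; $p^{\bar\eta}$ denotes a copy of the predicate $p$ annotated with one annotation element per argument. For $N\in\mathbb N$, the function-free program $\Pi^{\mathrm{fin}}_N(q,\Sigma)$ consists of the following rules. 1. *Dummy chase rules.* Chase, under $\Sigma_I$ alone, the database with one fact per predicate of $\mathcal R$, all its constants being distinct. Identify the fresh constant put in position $j$ by applying a unary ID $\sigma$ to the value represented by the term $\tau$ with $f_{\sigma,j}(\tau)$. For every application of the ID rule that creates an atom $A_2$ of level at most $N$ from an atom $A_1$, take the rule $A_2'\leftarrow A_1'$, where every argument $f_1(\cdots f_m(c)\cdots)$ is replaced by a variable for $c$ and $f_1(\cdots f_m(\bullet)\cdots)$ is made the corresponding element of the annotation of the predicate. 2. *Base annotation rules.* $p^{\bullet,\dots,\bullet}(X_1,\dots,X_n)\leftarrow p(X_1,\dots,X_n)$ for every $p$ in $\mathcal R\cup\{\mathrm{eq}\}$. 3. *Annotated rules.* All rules obtained from a rule among (a)–(c) below by annotating its predicates so that every annotation element is $\bullet$ or occurs in a dummy chase rule, equal terms receive equal annotation elements, and constants receive $\bullet$. (a) KD rules: $\mathrm{eq}(X_i,Y_i)\leftarrow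 r(\bar X),r(\bar Y),\mathrm{eq}(X_k,Y_k)$ for $\mathrm{key}(r)=\{k\}$ in $\Sigma_K$ and $i\ne k$. (b) Equality rules: $\mathrm{eq}(X_i,X_i)\leftarrow r(\bar X)$ for every predicate $r$ of $\mathcal R$ and every $i$; $\mathrm{eq}(Y,X)\leftarrow\mathrm{eq}(X,Y)$; $\mathrm{eq}(X,Z)\leftarrow\mathrm{eq}(X,Y),\mathrm{eq}(Y,Z)$. (c) The query $q_{\mathrm{eq}}$, obtained from $q$ by replacing every occurrence of a term $u$ in the body by a new variable $X$ and adding $\mathrm{eq}(X,u)$ to the body. **Theorem.** For every EER schema $\mathcal C$ as above, with set of CDs $\Sigma$, and every conjunctive query $q$ over $\mathcal R$, there is a function $\delta:\mathbb N\to\mathbb N$ (depending only on $\mathcal R$, $\Sigma$ and $q$) such that the following holds for every finite database $D$ over $\Gamma$ whose chase under $\Sigma$ exists. Let $k$ be the number of facts in the largest connected component of the graph on $D$ that joins two facts when they share a constant. Then for every $N\ge\delta(k)$, the set of tuples of the predicate $q_{\mathrm{eq}}^{\bullet,\dots,\bullet}$ in the least Herbrand model of $\Pi^{\mathrm{fin}}_N(q,\Sigma)\cup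 D$ is exactly $\mathrm{ans}(q,\Sigma,D)$. -/

import Mathlib

open Relation

noncomputable section

/-! ## Relational schemata, atoms, facts, dependencies -/

/-- A relational schema: predicate symbols with arities. -/
structure RelSchema where
  Pred : Type*
  arity : Pred → ℕ

/-- An atom `p(t₁,…,tₙ)` over the schema `S` with arguments in `T`.  A fact is an atom whose
arguments are constants, and a database is a set of facts. -/
structure Atom (S : RelSchema) (T : Type*) where
  pred : S.Pred
  args : Fin (S.arity pred) → T

/-- Apply a map to all the arguments of an atom. -/
def Atom.map {S : RelSchema} {T T' : Type*} (f : T → T') (A : Atom S T) : Atom S T' :=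
  ⟨A.pred, fun i => f (A.args i)⟩

/-- The values that may occur in a database: non-fresh constants (from the alphabet `K`, with the
unique name assumption) and fresh constants, which are numbered by their order. -/
inductive Val (K : Type*) where
  | dom (c : K) : Val K
  | fresh (n : ℕ) : Val K

/-- An inclusion dependency `lhs[X] ⊆ rhs[Y]`, with `X`, `Y` sequences of length `width`. -/
structure IncDep (S : RelSchema) where
  lhs : S.Pred
  rhs : S.Pred
  width : ℕ
  X : Fin width → Fin (S.arity lhs)
  Y : Fin width → Fin (S.arity rhs)

/-- Every attribute of either side occurs exactly once. -/
def IncDep.FullWidth {S : RelSchema} (σ : IncDep S) : Prop :=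
  Function.Bijective σ.X ∧ Function.Bijective σ.Y

def IncDep.Sat {S : RelSchema} {T : Type*} (σ : IncDep S) (B : Set (Atom S T)) : Prop :=
  ∀ t, (⟨σ.lhs, t⟩ : Atom S T) ∈ B →
    ∃ t', (⟨σ.rhs, t'⟩ : Atom S T) ∈ B ∧ ∀ i, t (σ.X i) = t' (σ.Y i)

/-- A key dependency `key(pred) = key`. -/
structure KeyDep (S : RelSchema) where
  pred : S.Pred
  key : Set (Fin (S.arity pred))

def KeyDep.Sat {S : RelSchema} {T : Type*} (κ : KeyDep S) (B : Set (Atom S T)) : Prop :=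
  ∀ t t', (⟨κ.pred, t⟩ : Atom S T) ∈ B → (⟨κ.pred, t'⟩ : Atom S T) ∈ B → t ≠ t' →
    ∃ i ∈ κ.key, t i ≠ t' i

/-! ## Conjunctive queries and certain answers -/

/-- Function-free terms: variables and constants. -/
inductive DTerm (V K : Type*) where
  | var (x : V) : DTerm V K
  | const (c : K) : DTerm V K

def DTerm.eval {V K : Type*} (θ : V → K) : DTerm V K → K
  | .var x => θ x
  | .const c => c

/-- A conjunctive query `q(X₁,…,Xₙ) ← body` with distinct head variables, all of which occur in
the body. -/
structure CQ (S : RelSchema) (V K : Type*) (n : ℕ) where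
  head : Fin n → V
  head_injective : Function.Injective head
  body : List (Atom S (DTerm V K))
  safe : ∀ i, ∃ A ∈ body, ∃ j, A.args j = DTerm.var (head i)

/-- The image of a query term under an assignment of values to the variables. -/
def DTerm.value {V K : Type*} (h : V → Val K) : DTerm V K → Val K
  | .var x => h x
  | .const c => .dom c

/-- The answers `q(B)` of a conjunctive query over a database with values in `Val K`. -/
def CQ.answers {S : RelSchema} {V K : Type*} {n : ℕ} (q : CQ S V K n)
    (B : Set (Atom S (Val K))) : Set (Fin n → Val K) :=
  {t | ∃ h : V → Val K, (∀ A ∈ q.body, A.map (DTerm.value h) ∈ B) ∧ t = fun i => h (q.head i)}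

/-- A database over non-fresh constants, as a database over all values. -/
def embedDB {S : RelSchema} {K : Type*} (D : Set (Atom S K)) : Set (Atom S (Val K)) :=
  Atom.map Val.dom '' D

/-- The certain answers `ans(q, Σ, D)`, with `Σ` given by its inclusion dependencies `I` and its
key dependencies `J`.  The models `B` may be infinite. -/
def certainAnswers {S : RelSchema} {V K : Type*} {n : ℕ} (I : Set (IncDep S)) (J : Set (KeyDep S))
    (q : CQ S V K n) (D : Set (Atom S K)) : Set (Fin n → K) :=
  {t | ∀ B : Set (Atom S (Val K)), (∀ σ ∈ I, σ.Sat B) → (∀ κ ∈ J, κ.Sat B) → embedDB D ⊆ B →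
    (fun i => Val.dom (t i)) ∈ q.answers B}

/-! ## EER schemata and conceptual dependencies -/

/-- An EER schema (without attributes) with entity symbols `Ent` and relationship symbols `Rel`. -/
structure EERSchema (Ent Rel : Type*) where
  /-- `E' ∈ isaEnt E`: the definition of `E` has the clause `isa: E'`. -/
  isaEnt : Ent → Set Ent
  arity : Rel → ℕ
  two_le_arity : ∀ R, 2 ≤ arity R
  /-- `among R i` is the entity of the `i`-th component of `R`. -/
  among : (R : Rel) → Fin (arity R) → Ent
  /-- `j ∈ isaRel R R'`: the definition of `R` has the clause `isa: R'[j₁,…,jₙ]`. -/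
  isaRel : (R R' : Rel) → Set (Fin (arity R) ≃ Fin (arity R'))
  /-- `c ∈ mandatory R`: the entity `among R c` has the clause `participates(≥ 1): R : c`. -/
  mandatory : (R : Rel) → Set (Fin (arity R))
  /-- `c ∈ functional R`: the entity `among R c` has the clause `participates(≤ 1): R : c`. -/
  functional : (R : Rel) → Set (Fin (arity R))

/-- The associated relational schema: a unary predicate per entity and an `n`-ary predicate per
`n`-ary relationship. -/
def EERSchema.schema {Ent Rel : Type*} (C : EERSchema Ent Rel) : RelSchema where
  Pred := Ent ⊕ Rel
  arity := Sum.elim (fun _ => 1) C.arity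

/-- The inclusion dependencies among the conceptual dependencies of `C`. -/
inductive EERSchema.IsID {Ent Rel : Type*} (C : EERSchema Ent Rel) : IncDep C.schema → Prop where
  /-- `e[1] ⊆ e'[1]` -/
  | isaEnt (E E' : Ent) : E' ∈ C.isaEnt E →
      C.IsID ⟨Sum.inl E, Sum.inl E', 1, fun _ => (0 : Fin 1), fun _ => (0 : Fin 1)⟩
  /-- `r[i] ⊆ eᵢ[1]` -/
  | component (R : Rel) (i : Fin (C.arity R)) :
      C.IsID ⟨Sum.inr R, Sum.inl (C.among R i), 1, fun _ => i, fun _ => (0 : Fin 1)⟩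
  /-- `r[1,…,n] ⊆ r'[j₁,…,jₙ]` -/
  | isaRel (R R' : Rel) (j : Fin (C.arity R) ≃ Fin (C.arity R')) : j ∈ C.isaRel R R' →
      C.IsID ⟨Sum.inr R, Sum.inr R', C.arity R, fun i => i, fun i => j i⟩
  /-- `e[1] ⊆ r[c]` -/
  | mandatory (R : Rel) (c : Fin (C.arity R)) : c ∈ C.mandatory R →
      C.IsID ⟨Sum.inl (C.among R c), Sum.inr R, 1, fun _ => (0 : Fin 1), fun _ => c⟩

/-- The key dependencies among the conceptual dependencies of `C`. -/
inductive EERSchema.IsKD {Ent Rel : Type*} (C : EERSchema Ent Rel) : KeyDep C.schema → Prop where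
  /-- `key(r) = {c}` -/
  | functional (R : Rel) (c : Fin (C.arity R)) : c ∈ C.functional R →
      C.IsKD ⟨Sum.inr R, ({c} : Set (Fin (C.arity R)))⟩

def EERSchema.ids {Ent Rel : Type*} (C : EERSchema Ent Rel) : Set (IncDep C.schema) :=
  {σ | C.IsID σ}

def EERSchema.kds {Ent Rel : Type*} (C : EERSchema Ent Rel) : Set (KeyDep C.schema) :=
  {κ | C.IsKD κ}

/-! ## The chase -/

/-- The orders that break ties in the construction of the chase (for instance, the lexicographic
orders of some encoding by strings). -/
structure ChaseOrder (S : RelSchema) (K : Type*) where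
  fact : LinearOrder (Atom S (Val K))
  pair : LinearOrder (Atom S (Val K) × Atom S (Val K))
  kd : LinearOrder (KeyDep S)
  id : LinearOrder (IncDep S)

/-- A stage of the chase: the facts, their levels (the level of a non-fact is irrelevant), and the
first fresh constant that follows all the fresh constants used so far. -/
structure ChaseState (S : RelSchema) (K : Type*) where
  facts : Set (Atom S (Val K))
  level : Atom S (Val K) → ℕ
  next : ℕ

def ChaseState.init {S : RelSchema} {K : Type*} (D : Set (Atom S K)) : ChaseState S K :=
  ⟨embedDB D, fun _ => 0, 0⟩

open Classical in
/-- The combined symbol of two values; `none` when they are distinct non-fresh constants. -/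
def Val.combine {K : Type*} : Val K → Val K → Option (Val K)
  | .dom c, .dom d => if c = d then some (.dom c) else none
  | .dom c, .fresh _ => some (.dom c)
  | .fresh _, .dom d => some (.dom d)
  | .fresh m, .fresh n => some (.fresh (min m n))

open Classical in
/-- Replace both `a` and `b` by `z`. -/
def Val.replace {K : Type*} (a b z : Val K) (x : Val K) : Val K :=
  if x = a ∨ x = b then z else x

/-- Merge `t` and `t'` at the listed positions, one after the other; the result is the replacement
to be carried out in all the facts, or `none` when the merging fails. -/
def unify {K : Type*} {m : ℕ} : List (Fin m) → (Fin m → Val K) → (Fin m → Val K) →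
    Option (Val K → Val K)
  | [], _, _ => some id
  | i :: l, t, t' =>
    match Val.combine (t i) (t' i) with
    | none => none
    | some z =>
      let ρ := Val.replace (t i) (t' i) z
      (unify l (fun j => ρ (t j)) (fun j => ρ (t' j))).map fun θ => θ ∘ ρ

section Chase

variable {S : RelSchema} {K : Type*} (ord : ChaseOrder S K) (I : Set (IncDep S))
  (J : Set (KeyDep S)) (st : ChaseState S K)

/-- The key dependency chase rule for `κ` is applicable on the tuples `t`, `t'`. -/
def KDApplicable (κ : KeyDep S) (t t' : Fin (S.arity κ.pred) → Val K) : Prop :=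
  κ ∈ J ∧ (⟨κ.pred, t⟩ : Atom S (Val K)) ∈ st.facts ∧ (⟨κ.pred, t'⟩ : Atom S (Val K)) ∈ st.facts ∧
    t ≠ t' ∧ ∀ i ∈ κ.key, t i = t' i

/-- The rule application that the chase has to perform next, among those of the key dependency
chase rule: least `min (level t) (level t')`, then first pair, then first dependency. -/
def KDSelected (κ : KeyDep S) (t t' : Fin (S.arity κ.pred) → Val K) : Prop :=
  KDApplicable J st κ t t' ∧
  ∀ κ' s s', KDApplicable J st κ' s s' →
    min (st.level ⟨κ.pred, t⟩) (st.level ⟨κ.pred, t'⟩) ≤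
      min (st.level ⟨κ'.pred, s⟩) (st.level ⟨κ'.pred, s'⟩) ∧
    (min (st.level ⟨κ.pred, t⟩) (st.level ⟨κ.pred, t'⟩) =
        min (st.level ⟨κ'.pred, s⟩) (st.level ⟨κ'.pred, s'⟩) →
      ord.pair.le (⟨κ.pred, t⟩, ⟨κ.pred, t'⟩) (⟨κ'.pred, s⟩, ⟨κ'.pred, s'⟩) ∧
      (((⟨κ.pred, t⟩, ⟨κ.pred, t'⟩) : Atom S (Val K) × Atom S (Val K)) =
          (⟨κ'.pred, s⟩, ⟨κ'.pred, s'⟩) →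
        ord.kd.le κ κ'))

open Classical in
/-- The result of the key dependency chase rule; `none` when the rule fails.  A fact that results
from several facts gets the least of their levels. -/
def kdApply (κ : KeyDep S) (t t' : Fin (S.arity κ.pred) → Val K) : Option (ChaseState S K) :=
  (unify ((List.finRange (S.arity κ.pred)).filter fun i => i ∉ κ.key) t t').map fun θ =>
    { facts := Atom.map θ '' st.facts
      level := fun A => sInf (st.level '' {A' | A' ∈ st.facts ∧ A'.map θ = A})
      next := st.next }

/-- The inclusion dependency chase rule for `σ` is applicable on the tuple `t`. -/
def IDApplicable (σ : IncDep S) (t : Fin (S.arity σ.lhs) → Val K) : Prop :=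
  σ ∈ I ∧ (⟨σ.lhs, t⟩ : Atom S (Val K)) ∈ st.facts ∧
    ¬ ∃ t', (⟨σ.rhs, t'⟩ : Atom S (Val K)) ∈ st.facts ∧ ∀ i, t' (σ.Y i) = t (σ.X i)

/-- Applicable, and full-width if some full-width inclusion dependency is applicable. -/
def IDCandidate (σ : IncDep S) (t : Fin (S.arity σ.lhs) → Val K) : Prop :=
  IDApplicable I st σ t ∧ ((∃ σ' t', IDApplicable I st σ' t' ∧ σ'.FullWidth) → σ.FullWidth)

/-- The rule application that the chase has to perform next, among those of the inclusion
dependency chase rule: least level, then first fact, then first dependency. -/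
def IDSelected (σ : IncDep S) (t : Fin (S.arity σ.lhs) → Val K) : Prop :=
  IDCandidate I st σ t ∧
  ∀ σ' s, IDCandidate I st σ' s →
    st.level ⟨σ.lhs, t⟩ ≤ st.level ⟨σ'.lhs, s⟩ ∧
    (st.level ⟨σ.lhs, t⟩ = st.level ⟨σ'.lhs, s⟩ →
      ord.fact.le ⟨σ.lhs, t⟩ ⟨σ'.lhs, s⟩ ∧
      ((⟨σ.lhs, t⟩ : Atom S (Val K)) = ⟨σ'.lhs, s⟩ → ord.id.le σ σ'))

open Classical in
/-- The tuple added by the inclusion dependency chase rule. -/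
def newTuple (σ : IncDep S) (t : Fin (S.arity σ.lhs) → Val K) (j : Fin (S.arity σ.rhs)) : Val K :=
  if h : ∃ i, σ.Y i = j then t (σ.X h.choose) else .fresh (st.next + j)

open Classical in
/-- The result of the inclusion dependency chase rule. -/
def idApply (σ : IncDep S) (t : Fin (S.arity σ.lhs) → Val K) : ChaseState S K where
  facts := insert ⟨σ.rhs, newTuple st σ t⟩ st.facts
  level := Function.update st.level ⟨σ.rhs, newTuple st σ t⟩ (st.level ⟨σ.lhs, t⟩ + 1)
  next := st.next + S.arity σ.rhs

/-- One step of the chase: key dependencies come first. -/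
inductive ChaseStep : ChaseState S K → ChaseState S K → Prop where
  | kd (st st' : ChaseState S K) (κ : KeyDep S) (t t' : Fin (S.arity κ.pred) → Val K) :
      KDSelected ord J st κ t t' → kdApply st κ t t' = some st' → ChaseStep st st'
  | id (st : ChaseState S K) (σ : IncDep S) (t : Fin (S.arity σ.lhs) → Val K) :
      (∀ κ s s', ¬ KDApplicable J st κ s s') → IDSelected ord I st σ t →
        ChaseStep st (idApply st σ t)

/-- The chase of `D` exists: its construction, which may go on forever, never fails. -/
def ChaseExists (D : Set (Atom S K)) : Prop :=
  ∀ st, ReflTransGen (ChaseStep ord I J) (ChaseState.init D) st →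
    ∀ κ t t', KDSelected ord J st κ t t' → kdApply st κ t t' ≠ none

end Chase

/-! ## The join graph -/

/-- The facts of `D`, joined when they share a constant. -/
def joinGraph {S : RelSchema} {K : Type*} (D : Set (Atom S K)) : SimpleGraph D where
  Adj A B := A ≠ B ∧ ∃ i j, A.1.args i = B.1.args j
  symm := ⟨fun _ _ ⟨hne, i, j, h⟩ => ⟨hne.symm, j, i, h.symm⟩⟩
  loopless := ⟨fun _ h => h.1 rfl⟩

/-- The number of facts in the largest connected part of the join graph of a finite `D`. -/
def largestConnectedSize {S : RelSchema} {K : Type*} (D : Set (Atom S K)) : ℕ :=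
  ⨆ c : (joinGraph D).ConnectedComponent, c.supp.ncard

/-! ## Datalog programs -/

/-- A function-free rule `head ← body`. -/
structure Rule (S : RelSchema) (V K : Type*) where
  head : Atom S (DTerm V K)
  body : List (Atom S (DTerm V K))

/-- The least Herbrand model of the program `P ∪ D`. -/
inductive LeastModel {S : RelSchema} {V K : Type*} (P : Set (Rule S V K)) (D : Set (Atom S K)) :
    Atom S K → Prop where
  | fact (A : Atom S K) : A ∈ D → LeastModel P D A
  | rule (ρ : Rule S V K) (θ : V → K) : ρ ∈ P →
      (∀ A ∈ ρ.body, LeastModel P D (A.map (DTerm.eval θ))) →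
      LeastModel P D (ρ.head.map (DTerm.eval θ))

/-! ## Skolem terms, annotations and annotated predicates -/

/-- Terms `f₁(f₂(…f_m(c)…))`, where every `fᵢ` is one of the unary Skolem functions `f_{σ,j}`, for
a dependency `σ` and an attribute `j` of its right-hand side. -/
inductive SkTerm (S : RelSchema) (K : Type*) where
  | base (c : K) : SkTerm S K
  | fn (σ : IncDep S) (j : Fin (S.arity σ.rhs)) (τ : SkTerm S K) : SkTerm S K

/-- Annotation elements `f₁(f₂(…f_m(•)…))`. -/
abbrev Ann (S : RelSchema) := SkTerm S Unit

/-- The annotation element `•`. -/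
def Ann.bullet {S : RelSchema} : Ann S := .base ()

/-- The annotation element of a term. -/
def SkTerm.ann {S : RelSchema} {K : Type*} : SkTerm S K → Ann S
  | .base _ => Ann.bullet
  | .fn σ j τ => .fn σ j τ.ann

/-- The innermost constant of a term. -/
def SkTerm.root {S : RelSchema} {K : Type*} : SkTerm S K → K
  | .base c => c
  | .fn _ _ τ => τ.root

/-- The predicates of `S`, the equality predicate, and the `n`-ary query predicate. -/
inductive BasePred (S : RelSchema) where
  | rel (p : S.Pred) : BasePred S
  | eq : BasePred S
  | query : BasePred S

def baseSchema (S : RelSchema) (n : ℕ) : RelSchema where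
  Pred := BasePred S
  arity
    | .rel p => S.arity p
    | .eq => 2
    | .query => n

/-- A predicate, either as it is or annotated. -/
inductive AnnPred (S : RelSchema) (n : ℕ) where
  | plain (b : BasePred S) : AnnPred S n
  | ann (b : BasePred S) (η : Fin ((baseSchema S n).arity b) → Ann S) : AnnPred S n

def annSchema (S : RelSchema) (n : ℕ) : RelSchema where
  Pred := AnnPred S n
  arity
    | .plain b => (baseSchema S n).arity b
    | .ann b _ => (baseSchema S n).arity b

/-- The constants of the dummy database: one for every attribute of every predicate. -/
abbrev DummyConst (S : RelSchema) := Σ p : S.Pred, Fin (S.arity p)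

/-- The variables of the rewriting: the variables of the query, new variables, and a variable for
every constant of the dummy database. -/
inductive RVar (S : RelSchema) (V : Type*) where
  | orig (x : V) : RVar S V
  | new (k i : ℕ) : RVar S V
  | dummy (c : DummyConst S) : RVar S V

section Rewriting

variable {S : RelSchema} {V K : Type*} {n : ℕ}

def relAtom {T : Type*} (n : ℕ) (p : S.Pred) (t : Fin (S.arity p) → T) : Atom (baseSchema S n) T :=
  ⟨BasePred.rel p, t⟩

def eqAtom {T : Type*} (S : RelSchema) (n : ℕ) (a b : T) : Atom (baseSchema S n) T :=
  ⟨BasePred.eq, (![a, b] : Fin 2 → T)⟩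

def queryAtom {T : Type*} (S : RelSchema) (t : Fin n → T) : Atom (baseSchema S n) T :=
  ⟨BasePred.query, t⟩

/-- The variables `X_{k,1}, X_{k,2}, …` -/
def nv (S : RelSchema) (V K : Type*) (k i : ℕ) : DTerm (RVar S V) K := .var (.new k i)

/-- Reflexivity, symmetry and transitivity of the equality predicate. -/
inductive IsEqRule : Rule (baseSchema S n) (RVar S V) K → Prop where
  | refl (p : S.Pred) (i : Fin (S.arity p)) :
      IsEqRule ⟨eqAtom S n (nv S V K 0 i) (nv S V K 0 i), [relAtom n p fun j => nv S V K 0 j]⟩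
  | symm : IsEqRule ⟨eqAtom S n (nv S V K 0 1) (nv S V K 0 0),
      [eqAtom S n (nv S V K 0 0) (nv S V K 0 1)]⟩
  | trans : IsEqRule ⟨eqAtom S n (nv S V K 0 0) (nv S V K 0 2),
      [eqAtom S n (nv S V K 0 0) (nv S V K 0 1), eqAtom S n (nv S V K 0 1) (nv S V K 0 2)]⟩

/-- For a unary key `key(r) = {k}` and `i ≠ k`, the rule
`eq(Xᵢ,Yᵢ) ← r(X₁,…,X_m), r(Y₁,…,Y_m), eq(X_k,Y_k)`. -/
inductive IsKDRule (J : Set (KeyDep S)) : Rule (baseSchema S n) (RVar S V) K → Prop where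
  | mk (κ : KeyDep S) (k i : Fin (S.arity κ.pred)) : κ ∈ J → κ.key = {k} → i ≠ k →
      IsKDRule J ⟨eqAtom S n (nv S V K 0 i) (nv S V K 1 i),
        [relAtom n κ.pred fun j => nv S V K 0 j, relAtom n κ.pred fun j => nv S V K 1 j,
          eqAtom S n (nv S V K 0 k) (nv S V K 1 k)]⟩

/-- A query term, in the variables of the rewriting. -/
def DTerm.orig : DTerm V K → DTerm (RVar S V) K
  | .var x => .var (.orig x)
  | .const c => .const c

/-- The query after the equality maquillage: the `i`-th term `u` of the `a`-th body atom is
replaced by a new variable `X`, and `eq(X,u)` is added to the body. -/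
def CQ.maquillage (q : CQ S V K n) : Rule (baseSchema S n) (RVar S V) K where
  head := queryAtom S fun i => .var (.orig (q.head i))
  body := q.body.zipIdx.flatMap fun Aa =>
    (relAtom n Aa.1.pred fun i => nv S V K Aa.2 i) ::
      (List.finRange (S.arity Aa.1.pred)).map fun i : Fin (S.arity Aa.1.pred) =>
        eqAtom S n (nv S V K Aa.2 i) (DTerm.orig (Aa.1.args i))

/-- The dummy database: one fact per predicate, all the constants being distinct. -/
def dummyDB (S : RelSchema) : Set (Atom S (DummyConst S)) :=
  Set.range fun p => ⟨p, fun i => ⟨p, i⟩⟩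

/-- In the chase of the dummy database under the inclusion dependencies alone, the inclusion
dependency chase rule for `σ` is applied on the tuple `t` at stage `st`. -/
def DummyApplied (ord : ChaseOrder S (DummyConst S)) (I : Set (IncDep S))
    (st : ChaseState S (DummyConst S)) (σ : IncDep S)
    (t : Fin (S.arity σ.lhs) → Val (DummyConst S)) : Prop :=
  ReflTransGen (ChaseStep ord I ∅) (ChaseState.init (dummyDB S)) st ∧ IDSelected ord I st σ t

/-- The Skolem term that corresponds to a value of the chase of the dummy database.  A fresh
constant put in position `j` by a unary `σ` applied on a tuple whose `X`-value corresponds to `τ`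
corresponds to `f_{σ,j}(τ)`.  (The conceptual dependencies that are not unary are full-width and
create no fresh constants.) -/
inductive SkolemOf (ord : ChaseOrder S (DummyConst S)) (I : Set (IncDep S)) :
    Val (DummyConst S) → SkTerm S (DummyConst S) → Prop where
  | base (c : DummyConst S) : SkolemOf ord I (.dom c) (.base c)
  | fn (st : ChaseState S (DummyConst S)) (σ : IncDep S)
      (t : Fin (S.arity σ.lhs) → Val (DummyConst S)) (i : Fin σ.width)
      (j : Fin (S.arity σ.rhs)) (τ : SkTerm S (DummyConst S)) :
      DummyApplied ord I st σ t → σ.width = 1 → (∀ i', σ.Y i' ≠ j) →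
      SkolemOf ord I (t (σ.X i)) τ → SkolemOf ord I (newTuple st σ t j) (.fn σ j τ)

/-- The annotated version of an atom `p(a₁,…,a_m)` of the dummy chase in Skolem terms, with the
constants replaced by variables. -/
def annotatedVersion (V K : Type*) (n : ℕ) (p : S.Pred)
    (a : Fin (S.arity p) → SkTerm S (DummyConst S)) : Atom (annSchema S n) (DTerm (RVar S V) K) :=
  ⟨AnnPred.ann (BasePred.rel p) fun i => (a i).ann, fun i => .var (.dummy (a i).root)⟩

/-- The dummy chase rules, obtained from the arcs of the first `N` levels of the chase of the dummy
database under the inclusion dependencies. -/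
inductive IsDummyRule (ord : ChaseOrder S (DummyConst S)) (I : Set (IncDep S)) (N : ℕ) :
    Rule (annSchema S n) (RVar S V) K → Prop where
  | mk (st : ChaseState S (DummyConst S)) (σ : IncDep S)
      (t : Fin (S.arity σ.lhs) → Val (DummyConst S))
      (a₁ : Fin (S.arity σ.lhs) → SkTerm S (DummyConst S))
      (a₂ : Fin (S.arity σ.rhs) → SkTerm S (DummyConst S)) :
      DummyApplied ord I st σ t → st.level ⟨σ.lhs, t⟩ + 1 ≤ N →
      (∀ i, SkolemOf ord I (t i) (a₁ i)) → (∀ j, SkolemOf ord I (newTuple st σ t j) (a₂ j)) →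
      IsDummyRule ord I N ⟨annotatedVersion V K n σ.rhs a₂, [annotatedVersion V K n σ.lhs a₁]⟩

/-- The annotation of an annotated atom has the element `η`. -/
def Atom.HasAnn {T : Type*} (A : Atom (annSchema S n) T) (η : Ann S) : Prop :=
  ∃ b ηs, A.pred = AnnPred.ann b ηs ∧ ∃ i, ηs i = η

/-- The annotation elements available for the rewriting: `•`, and those that occur in the dummy
chase rules. -/
def AnnAvailable (V K : Type*) (n : ℕ) (ord : ChaseOrder S (DummyConst S)) (I : Set (IncDep S))
    (N : ℕ) (η : Ann S) : Prop :=
  η = Ann.bullet ∨ ∃ ρ : Rule (annSchema S n) (RVar S V) K, IsDummyRule ord I N ρ ∧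
    (ρ.head.HasAnn η ∨ ∃ A ∈ ρ.body, A.HasAnn η)

/-- The annotation of a term, given the annotations of the variables; constants get `•`. -/
def DTerm.annBy {W : Type*} (α : W → Ann S) : DTerm W K → Ann S
  | .var x => α x
  | .const _ => Ann.bullet

/-- Annotate an atom, so that equal terms are annotated equally. -/
def Atom.annotate {W : Type*} (α : W → Ann S) (A : Atom (baseSchema S n) (DTerm W K)) :
    Atom (annSchema S n) (DTerm W K) :=
  ⟨AnnPred.ann A.pred fun i => (A.args i).annBy α, A.args⟩

def Rule.annotate {W : Type*} (α : W → Ann S) (ρ : Rule (baseSchema S n) W K) :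
    Rule (annSchema S n) W K :=
  ⟨ρ.head.annotate α, ρ.body.map (Atom.annotate α)⟩

/-- The base annotation rules `b^{•,…,•}(X₁,…,X_m) ← b(X₁,…,X_m)`, for `b` a predicate of `S` or
the equality predicate. -/
inductive IsBaseRule : Rule (annSchema S n) (RVar S V) K → Prop where
  | mk (b : BasePred S) : b ≠ BasePred.query →
      IsBaseRule ⟨⟨AnnPred.ann b fun _ => Ann.bullet, fun i => nv S V K 0 i⟩,
        [⟨AnnPred.plain b, fun i => nv S V K 0 i⟩]⟩

/-- The function-free rewriting of `q`, with the dummy chase cut at level `N`. -/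
def finProgram (ord : ChaseOrder S (DummyConst S)) (I : Set (IncDep S)) (J : Set (KeyDep S))
    (q : CQ S V K n) (N : ℕ) : Set (Rule (annSchema S n) (RVar S V) K) :=
  {ρ | IsDummyRule ord I N ρ} ∪ {ρ | IsBaseRule ρ} ∪
  {ρ | ∃ (ρ₀ : Rule (baseSchema S n) (RVar S V) K) (α : RVar S V → Ann S),
    (IsKDRule J ρ₀ ∨ IsEqRule ρ₀ ∨ ρ₀ = q.maquillage) ∧
    (∀ x, AnnAvailable V K n ord I N (α x)) ∧
    ρ = ρ₀.annotate α}

/-- A database, as a set of facts over the unannotated predicates. -/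
def plainFacts (n : ℕ) (D : Set (Atom S K)) : Set (Atom (annSchema S n) K) :=
  (fun A : Atom S K =>
    (⟨AnnPred.plain (BasePred.rel A.pred), A.args⟩ : Atom (annSchema S n) K)) '' D

/-- The evaluation over `D` of a program with query predicate `q_eq^{•,…,•}`. -/
def evalProgram {W : Type*} (P : Set (Rule (annSchema S n) W K)) (D : Set (Atom S K)) :
    Set (Fin n → K) :=
  {t | LeastModel P (plainFacts n D) ⟨AnnPred.ann BasePred.query fun _ => Ann.bullet, t⟩}

end Rewriting

end

/-! Soundness holds for every `N`. In a model `B ⊇ D` of the dependencies, read `f_{σ,j}(v)` as the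
`j`-th entry of one chosen fact that witnesses the unary dependency `σ` at the value `v`
(`skolemFun`). An annotation element together with a constant then denotes a value of `B`. With `eq`
read as equality, all rules preserve truth in `B` (`annHolds_dummyRule`, `baseHolds_rule`), so a
derived query fact with annotation `•` is an answer over `B`.

Completeness for a fixed `D`: the limit of the chase is a model (`exists_chase_model`), so a certain
answer is a match in some finite stage `m`. The instances over `D` of the facts of the dummy chase,
taken with derived equality, nearly form a model: a witness for a fact of level at most `l` is found
by level `l + tupleBound S + 1` (`exists_witness_level_le`, `gradedModel_dummyInstances`). A
homomorphism up to derived equality follows each step of the chase at the cost of that many levels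
(`GradedModel.exists_hom_step`). Hence the answer is derived once `N ≥ m * (tupleBound S + 1)`, a
bound that still depends on `D` and on the answer.

Uniformity: a certain answer is already certain over a union of at most `q.body.length` connected
parts of `D` (`exists_classRestrict`). To see this, map the chase of `D` to a product of all models
of all such unions, in which each fact carries the connected part it stems from as a label. The
union has at most `k * q.body.length` facts, and a permutation that fixes the constants of `q` moves
it and the answer into one finite set of constants (`exists_finset_absorbing`). So for each `k` only
finitely many pairs of a database and a tuple matter, and `δ k` is the maximum of their bounds
(`exists_level_for_size`). -/

/-! ## Merging values -/

section Merging

variable {K : Type*}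

/-- The position of a value in the order in which merging prefers values. -/
def Val.rank : Val K → ℕ
  | .dom _ => 0
  | .fresh n => n + 1

theorem Val.combine_left {a b z : Val K} (h : Val.combine a b = some z) :
    z = a ∨ z.rank < a.rank := by
  cases a <;> cases b <;> simp only [Val.combine] at h
  · split_ifs at h with hc
    simp_all
  · simp_all
  · simp only [Option.some.injEq] at h; subst h; right; simp [Val.rank]
  · simp only [Option.some.injEq] at h; subst h
    rename_i m n
    rcases le_or_gt m n with hmn | hmn
    · left; simp [hmn]
    · right; simp only [Val.rank]; omega

theorem Val.combine_right {a b z : Val K} (h : Val.combine a b = some z) :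
    z = b ∨ z.rank < b.rank := by
  cases a <;> cases b <;> simp only [Val.combine] at h
  · split_ifs at h with hc
    simp_all
  · simp only [Option.some.injEq] at h; subst h; right; simp [Val.rank]
  · simp_all
  · simp only [Option.some.injEq] at h; subst h
    rename_i m n
    rcases le_or_gt n m with hmn | hmn
    · left; simp [hmn]
    · right; simp only [Val.rank]; omega

theorem Val.combine_eq_or {a b z : Val K} (h : Val.combine a b = some z) : z = a ∨ z = b := by
  cases a <;> cases b <;> simp only [Val.combine] at h
  · split_ifs at h with hc
    simp_all
  · simp_all
  · simp_all
  · simp only [Option.some.injEq] at h; subst h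
    rename_i m n
    rcases le_total m n with hmn | hmn <;> simp [hmn]

theorem Val.combine_eq_none {a b : Val K} (h : Val.combine a b = none) :
    ∃ c d, c ≠ d ∧ a = .dom c ∧ b = .dom d := by
  cases a <;> cases b <;> simp only [Val.combine] at h
  · split_ifs at h with hc
    exact ⟨_, _, hc, rfl, rfl⟩
  all_goals simp at h

theorem unify_cons {m : ℕ} {i : Fin m} {l : List (Fin m)} {t t' : Fin m → Val K}
    {θ : Val K → Val K} (h : unify (i :: l) t t' = some θ) :
    ∃ z θ', Val.combine (t i) (t' i) = some z ∧
      unify l (fun j => Val.replace (t i) (t' i) z (t j))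
        (fun j => Val.replace (t i) (t' i) z (t' j)) = some θ' ∧
      θ = θ' ∘ Val.replace (t i) (t' i) z := by
  simp only [unify] at h
  split at h
  · simp at h
  · rename_i z hz
    simp only [Option.map_eq_some_iff] at h
    obtain ⟨θ', h1, h2⟩ := h
    exact ⟨z, θ', hz, h1, h2.symm⟩

/-- Merging only moves values down in rank. A value is therefore replaced finitely often along the
chase, and non-fresh constants, which have rank 0, are never replaced. -/
theorem unify_rank {m : ℕ} {l : List (Fin m)} {t t' : Fin m → Val K} {θ : Val K → Val K}
    (h : unify l t t' = some θ) (v : Val K) : θ v = v ∨ (θ v).rank < v.rank := by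
  induction l generalizing t t' θ v with
  | nil => simp only [unify, Option.some.injEq] at h; subst h; simp
  | cons i l ih =>
    obtain ⟨z, θ', hz, h', rfl⟩ := unify_cons h
    have hρ : Val.replace (t i) (t' i) z v = v ∨
        (Val.replace (t i) (t' i) z v).rank < v.rank := by
      unfold Val.replace
      split_ifs with hv
      · rcases hv with rfl | rfl
        · exact Val.combine_left hz
        · exact Val.combine_right hz
      · simp
    have h2 := ih h' (Val.replace (t i) (t' i) z v)
    simp only [Function.comp_apply]
    rcases hρ with hρ | hρ <;> rcases h2 with h2 | h2
    · left; rw [h2, hρ]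
    · right; rwa [hρ] at h2 ⊢
    · right; rwa [h2]
    · right; omega

theorem unify_agree {m : ℕ} {l : List (Fin m)} {t t' : Fin m → Val K} {θ : Val K → Val K}
    (h : unify l t t' = some θ) {i : Fin m} (hi : i ∈ l) : θ (t i) = θ (t' i) := by
  induction l generalizing t t' θ with
  | nil => simp at hi
  | cons k l ih =>
    obtain ⟨z, θ', hz, h', rfl⟩ := unify_cons h
    simp only [List.mem_cons] at hi
    by_cases hik : i = k
    · subst hik; simp [Val.replace]
    · have := ih (t := fun j => Val.replace (t k) (t' k) z (t j)) h' (hi.resolve_left hik)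
      exact this

theorem replace_rel {R : Val K → Val K → Prop} (hs : ∀ a b, R a b → R b a)
    (ht : ∀ a b c, R a b → R b c → R a c) {a b z : Val K} (hab : R a b) (hz : z = a ∨ z = b)
    (v : Val K) : Val.replace a b z v = v ∨ R v (Val.replace a b z v) := by
  unfold Val.replace
  split_ifs with hv
  · right
    have haa : R a a := ht _ _ _ hab (hs _ _ hab)
    have hbb : R b b := ht _ _ _ (hs _ _ hab) hab
    rcases hv with rfl | rfl <;> rcases hz with rfl | rfl <;> first | assumption | exact hs _ _ hab
  · simp

theorem replace_rel_pair {R : Val K → Val K → Prop} (hs : ∀ a b, R a b → R b a)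
    (ht : ∀ a b c, R a b → R b c → R a c) {a b z : Val K} (hab : R a b) (hz : z = a ∨ z = b)
    {v w : Val K} (hvw : R v w) : R (Val.replace a b z v) (Val.replace a b z w) := by
  rcases replace_rel hs ht hab hz v with h1 | h1 <;> rcases replace_rel hs ht hab hz w with h2 | h2
  · rwa [h1, h2]
  · rw [h1]; exact ht _ _ _ hvw h2
  · rw [h2]; exact ht _ _ _ (hs _ _ h1) hvw
  · exact ht _ _ _ (hs _ _ h1) (ht _ _ _ hvw h2)

/-- `R` is not assumed reflexive, because derived equality is known to be reflexive only on terms of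
derived facts; this is why unchanged values form a case of their own. Each replacement is by one of
two related values and keeps the remaining pairs related. -/
theorem unify_rel {R : Val K → Val K → Prop} (hs : ∀ a b, R a b → R b a)
    (ht : ∀ a b c, R a b → R b c → R a c) {m : ℕ} {l : List (Fin m)} {t t' : Fin m → Val K}
    {θ : Val K → Val K} (h : unify l t t' = some θ) (hR : ∀ i, R (t i) (t' i)) (v : Val K) :
    θ v = v ∨ R v (θ v) := by
  induction l generalizing t t' θ v with
  | nil => simp only [unify, Option.some.injEq] at h; subst h; simp
  | cons i l ih =>
    obtain ⟨z, θ', hz, h', rfl⟩ := unify_cons h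
    have hz' := Val.combine_eq_or hz
    have h1 := replace_rel hs ht (hR i) hz' v
    have h2 := ih h' (fun j => replace_rel_pair hs ht (hR i) hz' (hR j))
      (Val.replace (t i) (t' i) z v)
    simp only [Function.comp_apply]
    rcases h1 with h1 | h1 <;> rcases h2 with h2 | h2
    · left; rw [h2, h1]
    · right; rwa [h1] at h2 ⊢
    · right; rwa [h2]
    · right; exact ht _ _ _ h1 h2

/-- Failure exhibits distinct non-fresh constants among entries that are still related. With `R` as
equality of images under a homomorphism, this is impossible when distinct constants have distinct
images. -/
theorem unify_none {R : Val K → Val K → Prop} (hs : ∀ a b, R a b → R b a)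
    (ht : ∀ a b c, R a b → R b c → R a c) {m : ℕ} {l : List (Fin m)} {t t' : Fin m → Val K}
    (h : unify l t t' = none) (hR : ∀ i, R (t i) (t' i)) :
    ∃ c d, c ≠ d ∧ R (.dom c) (.dom d) := by
  induction l generalizing t t' with
  | nil => simp [unify] at h
  | cons i l ih =>
    simp only [unify] at h
    split at h
    · rename_i hz
      obtain ⟨c, d, hcd, h1, h2⟩ := Val.combine_eq_none hz
      exact ⟨c, d, hcd, h1 ▸ h2 ▸ hR i⟩
    · rename_i z hz
      rw [Option.map_eq_none_iff] at h
      exact ih h fun j => replace_rel_pair hs ht (hR i) (Val.combine_eq_or hz) (hR j)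

end Merging

/-! ## Basic properties of the chase -/

section Atoms

variable {S : RelSchema} {T T' T'' : Type*}

theorem Atom.map_congr {f g : T → T'} {A : Atom S T} (h : ∀ i, f (A.args i) = g (A.args i)) :
    A.map f = A.map g := by
  simp only [Atom.map, Atom.mk.injEq, heq_eq_eq, true_and]
  exact funext h

theorem Atom.map_map (f : T → T') (g : T' → T'') (A : Atom S T) :
    (A.map f).map g = A.map (g ∘ f) := rfl

theorem Atom.map_eq_self {f : T → T} {A : Atom S T} (h : ∀ i, f (A.args i) = A.args i) :
    A.map f = A := by
  cases A
  simp only [Atom.map, Atom.mk.injEq, heq_eq_eq, true_and]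
  exact funext h

theorem Atom.mk_inj {p : S.Pred} {t t' : Fin (S.arity p) → T}
    (h : (⟨p, t⟩ : Atom S T) = ⟨p, t'⟩) : t = t' := by
  simpa using h

/-- The values that occur in a set of facts. -/
def activeValues (F : Set (Atom S T)) : Set T := {v | ∃ A ∈ F, ∃ i, A.args i = v}

theorem finite_activeValues {F : Set (Atom S T)} (hF : F.Finite) : (activeValues F).Finite := by
  have : activeValues F = ⋃ A ∈ F, Set.range A.args := by
    ext v; simp [activeValues]
  rw [this]
  exact hF.biUnion fun A _ => Set.finite_range _

theorem finite_atoms_over [Finite S.Pred] {X : Set T} (hX : X.Finite) :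
    {A : Atom S T | ∀ i, A.args i ∈ X}.Finite := by
  have : Finite X := hX
  refine (Set.finite_range fun x : Σ p : S.Pred, Fin (S.arity p) → X =>
    (⟨x.1, fun i => (x.2 i).1⟩ : Atom S T)).subset ?_
  intro A hA
  exact ⟨⟨A.pred, fun i => ⟨A.args i, hA i⟩⟩, rfl⟩

end Atoms

theorem Set.Finite.exists_lex_min {X α β γ : Type*} [LinearOrder α] [LinearOrder β] [LinearOrder γ]
    {s : Set X} (hs : s.Finite) (hne : s.Nonempty) (f : X → α) (g : X → β) (h : X → γ) :
    ∃ a ∈ s, ∀ b ∈ s, f a ≤ f b ∧ (f a = f b → g a ≤ g b ∧ (g a = g b → h a ≤ h b)) := by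
  obtain ⟨a₁, ha₁, hm₁⟩ := Set.exists_min_image s f hs hne
  obtain ⟨a₂, ha₂, hm₂⟩ := Set.exists_min_image {x | x ∈ s ∧ f x = f a₁} g
    (hs.subset fun _ hx => hx.1) ⟨a₁, ha₁, rfl⟩
  obtain ⟨a₃, ha₃, hm₃⟩ := Set.exists_min_image {x | (x ∈ s ∧ f x = f a₁) ∧ g x = g a₂} h
    (hs.subset fun _ hx => hx.1.1) ⟨a₂, ha₂, rfl⟩
  refine ⟨a₃, ha₃.1.1, fun b hb => ⟨ha₃.1.2 ▸ hm₁ b hb, fun hfb => ?_⟩⟩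
  have hb₁ : f b = f a₁ := hfb ▸ ha₃.1.2
  refine ⟨ha₃.2 ▸ hm₂ b ⟨hb, hb₁⟩, fun hgb => hm₃ b ⟨⟨hb, hb₁⟩, hgb ▸ ha₃.2⟩⟩

section ChaseBasics

variable {S : RelSchema} {K : Type*} {ord : ChaseOrder S K} {I : Set (IncDep S)}
  {J : Set (KeyDep S)} {st st' : ChaseState S K}

theorem exists_kdSelected (ord : ChaseOrder S K) (hJ : J.Finite) (hst : st.facts.Finite)
    (h : ∃ κ t t', KDApplicable J st κ t t') : ∃ κ t t', KDSelected ord J st κ t t' := by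
  let X := Σ κ : KeyDep S, (Fin (S.arity κ.pred) → Val K) × (Fin (S.arity κ.pred) → Val K)
  let pr : X → Atom S (Val K) × Atom S (Val K) := fun x => (⟨x.1.pred, x.2.1⟩, ⟨x.1.pred, x.2.2⟩)
  let app : Set X := {x | KDApplicable J st x.1 x.2.1 x.2.2}
  have hinj : Function.Injective fun x : X => (x.1, pr x) := by
    rintro ⟨κ, t, t'⟩ ⟨κ', s, s'⟩ hx
    simp only [Prod.mk.injEq, pr] at hx
    obtain ⟨rfl, h1, h2⟩ := hx
    simp only [Atom.mk.injEq, heq_eq_eq, true_and] at h1 h2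
    subst h1 h2
    rfl
  have hfin : app.Finite := by
    refine Set.Finite.of_finite_image ((hJ.prod (hst.prod hst)).subset ?_) hinj.injOn
    rintro _ ⟨x, hx, rfl⟩
    exact ⟨hx.1, hx.2.1, hx.2.2.1⟩
  obtain ⟨κ, t, t', hκ⟩ := h
  obtain ⟨a, ha, hm⟩ := @Set.Finite.exists_lex_min X ℕ _ _ _ ord.pair ord.kd app hfin
    ⟨⟨κ, t, t'⟩, hκ⟩ (fun x => min (st.level (pr x).1) (st.level (pr x).2)) pr (fun x => x.1)
  exact ⟨a.1, a.2.1, a.2.2, ha, fun κ' s s' hs => hm ⟨κ', s, s'⟩ hs⟩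

theorem finite_idApplicable (hI : I.Finite) (hst : st.facts.Finite) :
    {x : Σ σ : IncDep S, Fin (S.arity σ.lhs) → Val K | IDApplicable I st x.1 x.2}.Finite := by
  have hinj : Function.Injective fun x : Σ σ : IncDep S, Fin (S.arity σ.lhs) → Val K =>
      (x.1, (⟨x.1.lhs, x.2⟩ : Atom S (Val K))) := by
    rintro ⟨σ, t⟩ ⟨σ', t'⟩ hx
    simp only [Prod.mk.injEq] at hx
    obtain ⟨rfl, h1⟩ := hx
    simp only [Atom.mk.injEq, heq_eq_eq, true_and] at h1
    subst h1
    rfl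
  refine Set.Finite.of_finite_image ((hI.prod hst).subset ?_) hinj.injOn
  rintro _ ⟨x, hx, rfl⟩
  exact ⟨hx.1, hx.2.1⟩

theorem exists_idSelected (ord : ChaseOrder S K) (hI : I.Finite) (hst : st.facts.Finite)
    (h : ∃ σ t, IDApplicable I st σ t) : ∃ σ t, IDSelected ord I st σ t := by
  let X := Σ σ : IncDep S, Fin (S.arity σ.lhs) → Val K
  let at' : X → Atom S (Val K) := fun x => ⟨x.1.lhs, x.2⟩
  have hfin : {x : X | IDCandidate I st x.1 x.2}.Finite :=
    (finite_idApplicable hI hst).subset fun _ hx => hx.1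
  have hne : {x : X | IDCandidate I st x.1 x.2}.Nonempty := by
    by_cases hf : ∃ σ' t', IDApplicable I st σ' t' ∧ σ'.FullWidth
    · obtain ⟨σ', t', h1, h2⟩ := hf
      exact ⟨⟨σ', t'⟩, h1, fun _ => h2⟩
    · obtain ⟨σ, t, h1⟩ := h
      exact ⟨⟨σ, t⟩, h1, fun h2 => absurd h2 hf⟩
  obtain ⟨a, ha, hm⟩ := @Set.Finite.exists_lex_min X ℕ _ _ _ ord.fact ord.id _ hfin hne
    (fun x => st.level (at' x)) at' (fun x => x.1)
  exact ⟨a.1, a.2, ha, fun σ' s hs => hm ⟨σ', s⟩ hs⟩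

theorem newTuple_Y {σ : IncDep S} (hY : Function.Injective σ.Y)
    (t : Fin (S.arity σ.lhs) → Val K) (i : Fin σ.width) :
    newTuple st σ t (σ.Y i) = t (σ.X i) := by
  have h : ∃ i', σ.Y i' = σ.Y i := ⟨i, rfl⟩
  rw [newTuple, dif_pos h, hY h.choose_spec]

theorem newTuple_of_forall_ne {σ : IncDep S} {t : Fin (S.arity σ.lhs) → Val K}
    {j : Fin (S.arity σ.rhs)} (h : ∀ i, σ.Y i ≠ j) : newTuple st σ t j = .fresh (st.next + j) := by
  rw [newTuple, dif_neg]
  simpa using h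

theorem IDApplicable.newFact_notMem {σ : IncDep S} (hY : Function.Injective σ.Y)
    {t : Fin (S.arity σ.lhs) → Val K} (h : IDApplicable I st σ t) :
    (⟨σ.rhs, newTuple st σ t⟩ : Atom S (Val K)) ∉ st.facts :=
  fun hm => h.2.2 ⟨_, hm, newTuple_Y hY t⟩

open Classical in
theorem idApply_level_of_ne {σ : IncDep S} {t : Fin (S.arity σ.lhs) → Val K}
    {A : Atom S (Val K)} (h : A ≠ ⟨σ.rhs, newTuple st σ t⟩) :
    (idApply st σ t).level A = st.level A :=
  by simp [idApply, h]

open Classical in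
theorem idApply_level_new {σ : IncDep S} {t : Fin (S.arity σ.lhs) → Val K} :
    (idApply st σ t).level ⟨σ.rhs, newTuple st σ t⟩ = st.level ⟨σ.lhs, t⟩ + 1 :=
  by simp [idApply]

open Classical in
theorem kdApply_spec {κ : KeyDep S} {t t' : Fin (S.arity κ.pred) → Val K}
    (h : kdApply st κ t t' = some st') :
    ∃ θ, unify ((List.finRange (S.arity κ.pred)).filter fun i => i ∉ κ.key) t t' = some θ ∧
      st'.facts = Atom.map θ '' st.facts ∧
      (∀ A, st'.level A = sInf (st.level '' {A' | A' ∈ st.facts ∧ A'.map θ = A})) ∧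
      st'.next = st.next := by
  simp only [kdApply, Option.map_eq_some_iff] at h
  obtain ⟨θ, hθ, rfl⟩ := h
  exact ⟨θ, hθ, rfl, fun _ => rfl, rfl⟩

/-- All the fresh constants of a state precede the first unused one. -/
def FreshBelow (st : ChaseState S K) : Prop :=
  ∀ A ∈ st.facts, ∀ i m, A.args i = .fresh m → m < st.next

theorem freshBelow_init (D : Set (Atom S K)) : FreshBelow (ChaseState.init D) := by
  rintro _ ⟨A, _, rfl⟩ i m h
  simp [Atom.map] at h

theorem ChaseStep.freshBelow (h : ChaseStep ord I J st st') (hf : FreshBelow st) :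
    FreshBelow st' := by
  cases h with
  | kd _ κ t t' hsel happ =>
    obtain ⟨θ, hθ, hfacts, -, hnext⟩ := kdApply_spec happ
    intro A hA i m hm
    rw [hfacts] at hA
    obtain ⟨A, hA, rfl⟩ := hA
    rw [hnext]
    change θ (A.args i) = _ at hm
    rcases unify_rank hθ (A.args i) with h | h
    · exact hf A hA i m (h ▸ hm)
    · cases hv : A.args i with
      | dom c => simp [hv, Val.rank] at h
      | fresh m' =>
        have := hf A hA i m' hv
        rw [hm, hv] at h
        simp only [Val.rank] at h
        omega
  | id σ t hkd hsel =>
    intro A hA i m hm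
    simp only [idApply, Set.mem_insert_iff] at hA
    change m < st.next + S.arity σ.rhs
    rcases hA with rfl | hA
    · change newTuple st σ t i = _ at hm
      unfold newTuple at hm
      split_ifs at hm with hi
      · have := hf _ hsel.1.1.2.1 _ m hm
        omega
      · simp only [Val.fresh.injEq] at hm
        have : (i : ℕ) < S.arity σ.rhs := i.2
        omega
    · have := hf A hA i m hm
      omega

theorem ChaseStep.finite_facts (h : ChaseStep ord I J st st') (hf : st.facts.Finite) :
    st'.facts.Finite := by
  cases h with
  | kd _ κ t t' hsel happ =>
    obtain ⟨θ, -, hfacts, -, -⟩ := kdApply_spec happ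
    rw [hfacts]
    exact hf.image _
  | id σ t hkd hsel => exact hf.insert _

/-- `θ` replaces values by preferred ones, carries the facts of `st` to facts of `st'` and does not
raise levels. -/
structure IsStepMap (st st' : ChaseState S K) (θ : Val K → Val K) : Prop where
  rank : ∀ v, θ v = v ∨ (θ v).rank < v.rank
  facts : ∀ A ∈ st.facts, A.map θ ∈ st'.facts
  level : ∀ A ∈ st.facts, st'.level (A.map θ) ≤ st.level A

theorem IsStepMap.refl (st : ChaseState S K) : IsStepMap st st id :=
  ⟨fun _ => Or.inl rfl, fun _ hA => hA, fun _ _ => le_rfl⟩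

theorem kdApply_isStepMap {θ : Val K → Val K} (hθ : ∀ v, θ v = v ∨ (θ v).rank < v.rank)
    (hfacts : st'.facts = Atom.map θ '' st.facts)
    (hlevel : ∀ A, st'.level A = sInf (st.level '' {A' | A' ∈ st.facts ∧ A'.map θ = A})) :
    IsStepMap st st' θ := by
  refine ⟨hθ, fun A hA => hfacts ▸ ⟨A, hA, rfl⟩, fun A hA => ?_⟩
  rw [hlevel]
  exact Nat.sInf_le ⟨A, ⟨hA, rfl⟩, rfl⟩

theorem ChaseStep.exists_isStepMap (hY : ∀ σ ∈ I, Function.Injective σ.Y)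
    (h : ChaseStep ord I J st st') : ∃ θ, IsStepMap st st' θ := by
  cases h with
  | kd _ κ t t' hsel happ =>
    obtain ⟨θ, hθ, hfacts, hlevel, -⟩ := kdApply_spec happ
    exact ⟨θ, kdApply_isStepMap (unify_rank hθ) hfacts hlevel⟩
  | id σ t hkd hsel =>
    refine ⟨_root_.id, fun _ => Or.inl rfl, fun A hA => Or.inr hA, fun A hA => ?_⟩
    have hne : A ≠ ⟨σ.rhs, newTuple st σ t⟩ := by
      rintro rfl
      exact hsel.1.1.newFact_notMem (hY σ hsel.1.1.1) hA
    exact (idApply_level_of_ne hne).le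

/-- Were the replacement injective on the active values, agreement of the tuples on the key before
merging and elsewhere after it would make them equal. So every key step identifies two active
values. -/
theorem KDApplicable.ncard_activeValues_lt {κ : KeyDep S} {t t' : Fin (S.arity κ.pred) → Val K}
    (hst : st.facts.Finite) (h : KDApplicable J st κ t t') (happ : kdApply st κ t t' = some st') :
    (activeValues st'.facts).ncard < (activeValues st.facts).ncard := by
  obtain ⟨θ, hθ, hfacts, -, -⟩ := kdApply_spec happ
  have himg : activeValues st'.facts = θ '' activeValues st.facts := by
    rw [hfacts]
    ext v
    constructor
    · rintro ⟨_, ⟨A, hA, rfl⟩, i, rfl⟩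
      exact ⟨A.args i, ⟨A, hA, i, rfl⟩, rfl⟩
    · rintro ⟨_, ⟨A, hA, i, rfl⟩, rfl⟩
      exact ⟨_, ⟨A, hA, rfl⟩, i, rfl⟩
  have hfin := finite_activeValues hst
  rw [himg]
  refine lt_of_le_of_ne (Set.ncard_image_le hfin) fun heq => ?_
  have hinj := (Set.ncard_image_iff hfin).1 heq
  refine h.2.2.2.1 (funext fun i => ?_)
  by_cases hi : i ∈ κ.key
  · exact h.2.2.2.2 i hi
  · refine hinj ⟨_, h.2.1, i, rfl⟩ ⟨_, h.2.2.1, i, rfl⟩ (unify_agree hθ ?_)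
    simp [hi]

end ChaseBasics

/-! ## The chase sequence and its limit -/

theorem Nat.exists_stable {f : ℕ → ℕ} {i : ℕ} (h : ∀ j ≥ i, f (j + 1) ≤ f j) :
    ∃ i' ≥ i, ∀ j ≥ i', f (j + 1) = f j := by
  have hanti : ∀ j ≥ i, ∀ m ≥ j, f m ≤ f j := by
    intro j hj m hm
    induction m, hm using Nat.le_induction with
    | base => exact le_rfl
    | succ m hm ih => exact (h m (hj.trans hm)).trans ih
  obtain ⟨i', hi', hmin⟩ := WellFounded.has_min (measure f).wf {j | i ≤ j} ⟨i, by simp⟩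
  have hmin' : ∀ j ≥ i', f j = f i' := fun j hj =>
    le_antisymm (hanti i' hi' j hj) (not_lt.1 (hmin j (hi'.trans hj)))
  exact ⟨i', hi', fun j hj => by rw [hmin' j hj, hmin' (j + 1) (by omega)]⟩

section Sequence

variable {S : RelSchema} {K : Type*} (ord : ChaseOrder S K) (I : Set (IncDep S))
  (J : Set (KeyDep S)) (D : Set (Atom S K))

open Classical in
/-- The stages of the chase; the last one, if any, is repeated forever. -/
noncomputable def chaseSeq : ℕ → ChaseState S K
  | 0 => ChaseState.init D
  | m + 1 => if h : ∃ st', ChaseStep ord I J (chaseSeq m) st' then h.choose else chaseSeq m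

variable {ord I J D}

theorem chaseSeq_step {m : ℕ} (h : ∃ st', ChaseStep ord I J (chaseSeq ord I J D m) st') :
    ChaseStep ord I J (chaseSeq ord I J D m) (chaseSeq ord I J D (m + 1)) := by
  rw [show chaseSeq ord I J D (m + 1) = h.choose by rw [chaseSeq, dif_pos h]]
  exact h.choose_spec

theorem chaseSeq_step_or_eq (m : ℕ) :
    ChaseStep ord I J (chaseSeq ord I J D m) (chaseSeq ord I J D (m + 1)) ∨
      ((¬ ∃ st', ChaseStep ord I J (chaseSeq ord I J D m) st') ∧
        chaseSeq ord I J D (m + 1) = chaseSeq ord I J D m) := by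
  by_cases h : ∃ st', ChaseStep ord I J (chaseSeq ord I J D m) st'
  · exact Or.inl (chaseSeq_step h)
  · exact Or.inr ⟨h, by rw [chaseSeq, dif_neg h]⟩

theorem chaseSeq_induction {P : ChaseState S K → Prop} (h0 : P (ChaseState.init D))
    (hs : ∀ st st', ChaseStep ord I J st st' → P st → P st') (m : ℕ) :
    P (chaseSeq ord I J D m) := by
  induction m with
  | zero => exact h0
  | succ m ih =>
    rcases chaseSeq_step_or_eq (ord := ord) (I := I) (J := J) (D := D) m with h | ⟨-, h⟩
    · exact hs _ _ h ih
    · rwa [h]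

theorem chaseSeq_reachable (m : ℕ) :
    ReflTransGen (ChaseStep ord I J) (ChaseState.init D) (chaseSeq ord I J D m) :=
  chaseSeq_induction ReflTransGen.refl (fun _ _ h ih => ih.tail h) m

theorem finite_facts_chaseSeq (hD : D.Finite) (m : ℕ) : (chaseSeq ord I J D m).facts.Finite :=
  chaseSeq_induction (P := fun st => st.facts.Finite) (hD.image _)
    (fun _ _ h => h.finite_facts) m

theorem freshBelow_chaseSeq (m : ℕ) : FreshBelow (chaseSeq ord I J D m) :=
  chaseSeq_induction (freshBelow_init D) (fun _ _ h => h.freshBelow) m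

theorem exists_isStepMap_chaseSeq (hY : ∀ σ ∈ I, Function.Injective σ.Y) (m : ℕ) :
    ∃ θ, IsStepMap (chaseSeq ord I J D m) (chaseSeq ord I J D (m + 1)) θ := by
  rcases chaseSeq_step_or_eq (ord := ord) (I := I) (J := J) (D := D) m with h | ⟨-, h⟩
  · exact h.exists_isStepMap hY
  · rw [h]; exact ⟨id, IsStepMap.refl _⟩

theorem exists_chaseStep_of_kdApplicable (hJ : J.Finite) (hD : D.Finite)
    (hex : ChaseExists ord I J D) {m : ℕ}
    (h : ∃ κ t t', KDApplicable J (chaseSeq ord I J D m) κ t t') :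
    ∃ κ t t', KDApplicable J (chaseSeq ord I J D m) κ t t' ∧
      kdApply (chaseSeq ord I J D m) κ t t' = some (chaseSeq ord I J D (m + 1)) := by
  obtain ⟨κ, t, t', hsel⟩ := exists_kdSelected ord hJ (finite_facts_chaseSeq hD m) h
  obtain ⟨st', hst'⟩ := Option.ne_none_iff_exists'.1 (hex _ (chaseSeq_reachable m) κ t t' hsel)
  -- The successor in `chaseSeq` is an arbitrary possible step, not necessarily this one, but the
  -- priority of keys excludes inclusion steps.
  have := chaseSeq_step ⟨st', ChaseStep.kd _ _ κ t t' hsel hst'⟩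
  generalize hst : chaseSeq ord I J D (m + 1) = st'' at this
  cases this with
  | kd _ κ t t' hsel happ => exact ⟨κ, t, t', hsel.1, happ⟩
  | id σ t hkd hsel => exact absurd h (by push Not; exact hkd)

theorem exists_chaseStep_of_idApplicable (hI : I.Finite) (hD : D.Finite) {m : ℕ}
    (hk : ∀ κ t t', ¬ KDApplicable J (chaseSeq ord I J D m) κ t t')
    (h : ∃ σ t, IDApplicable I (chaseSeq ord I J D m) σ t) :
    ∃ σ t, IDSelected ord I (chaseSeq ord I J D m) σ t ∧
      chaseSeq ord I J D (m + 1) = idApply (chaseSeq ord I J D m) σ t := by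
  obtain ⟨σ, t, hsel⟩ := exists_idSelected ord hI (finite_facts_chaseSeq hD m) h
  have := chaseSeq_step ⟨_, ChaseStep.id _ σ t hk hsel⟩
  generalize hst : chaseSeq ord I J D (m + 1) = st'' at this
  cases this with
  | kd _ κ t t' hsel happ => exact absurd hsel.1 (hk κ t t')
  | id σ t hkd hsel => exact ⟨σ, t, hsel, rfl⟩

/-- Key dependencies are satisfied again and again. -/
theorem exists_kdFree_stage (hJ : J.Finite) (hD : D.Finite) (hex : ChaseExists ord I J D) (i : ℕ) :
    ∃ j ≥ i, ∀ κ t t', ¬ KDApplicable J (chaseSeq ord I J D j) κ t t' := by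
  by_contra! hcon
  have hlt : ∀ j ≥ i, (activeValues (chaseSeq ord I J D (j + 1)).facts).ncard <
      (activeValues (chaseSeq ord I J D j).facts).ncard := by
    intro j hj
    obtain ⟨κ, t, t', h1, h2⟩ := exists_chaseStep_of_kdApplicable hJ hD hex (hcon j hj)
    exact h1.ncard_activeValues_lt (finite_facts_chaseSeq hD j) h2
  obtain ⟨i', hi', hst⟩ := Nat.exists_stable
    (f := fun j => (activeValues (chaseSeq ord I J D j).facts).ncard) fun j hj => (hlt j hj).le
  exact (hlt i' hi').ne (hst i' le_rfl)

/-- The violations of inclusion dependencies by facts of level at most `l`. -/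
def violations (I : Set (IncDep S)) (st : ChaseState S K) (l : ℕ) :
    Set (Σ σ : IncDep S, Fin (S.arity σ.lhs) → Val K) :=
  {x | IDApplicable I st x.1 x.2 ∧ st.level ⟨x.1.lhs, x.2⟩ ≤ l}

theorem finite_violations (hI : I.Finite) {st : ChaseState S K} (hst : st.facts.Finite) (l : ℕ) :
    (violations I st l).Finite :=
  (finite_idApplicable hI hst).subset fun _ hx => hx.1

/-- A violation after merging pulls back to one before it: choose a preimage of least level, which
has the level of the merged fact. A witness for the preimage would be mapped to a witness for the
image. -/
theorem ncard_violations_kdApply (hI : I.Finite) {st st' : ChaseState S K}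
    (hst : st.facts.Finite) {κ : KeyDep S} {t t' : Fin (S.arity κ.pred) → Val K}
    (happ : kdApply st κ t t' = some st') (l : ℕ) :
    (violations I st' l).ncard ≤ (violations I st l).ncard := by
  obtain ⟨θ, -, hfacts, hlevel, -⟩ := kdApply_spec happ
  have hfin := finite_violations hI hst l
  refine (Set.ncard_le_ncard (t := (fun x => ⟨x.1, θ ∘ x.2⟩) '' violations I st l) ?_
    (hfin.image _)).trans (Set.ncard_image_le hfin)
  rintro ⟨σ, s⟩ ⟨⟨hσ, hs, hno⟩, hl⟩
  have hne : (st.level '' {A' | A' ∈ st.facts ∧ A'.map θ = ⟨σ.lhs, s⟩}).Nonempty := by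
    rw [hfacts] at hs
    obtain ⟨A, hA, hAs⟩ := hs
    exact ⟨_, A, ⟨hA, hAs⟩, rfl⟩
  obtain ⟨⟨p, s'⟩, ⟨hA, hAs⟩, hlA⟩ := Nat.sInf_mem hne
  obtain ⟨rfl, hs'⟩ : p = σ.lhs ∧ HEq (fun i => θ (s' i)) s := by
    simpa only [Atom.map, Atom.mk.injEq] using hAs
  rw [heq_eq_eq] at hs'
  refine ⟨⟨σ, s'⟩, ⟨⟨hσ, hA, ?_⟩, ?_⟩, ?_⟩
  · rintro ⟨u, hu, hus⟩
    refine hno ⟨fun i => θ (u i), ?_, fun i => ?_⟩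
    · rw [hfacts]; exact ⟨_, hu, rfl⟩
    · exact (congrArg θ (hus i)).trans (congrFun hs' _)
  · rw [hlA, ← hlevel]
    exact hl
  · simp only [← hs']; rfl

/-- The new fact has level above `l`, so it causes no violation that counts, and additional facts
can only repair old ones. -/
theorem violations_idApply_subset {st : ChaseState S K} {σ : IncDep S}
    {t : Fin (S.arity σ.lhs) → Val K} {l : ℕ} (hl : l ≤ st.level ⟨σ.lhs, t⟩) :
    violations I (idApply st σ t) l ⊆ violations I st l := by
  rintro ⟨σ', s⟩ ⟨⟨hσ', hs, hno⟩, hl'⟩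
  have hne : (⟨σ'.lhs, s⟩ : Atom S (Val K)) ≠ ⟨σ.rhs, newTuple st σ t⟩ := by
    intro heq
    simp only [heq, idApply_level_new] at hl'
    omega
  refine ⟨⟨hσ', hs.resolve_left hne, fun ⟨u, hu, h⟩ => hno ⟨u, Or.inr hu, h⟩⟩, ?_⟩
  rwa [← idApply_level_of_ne hne]

/-- For every level, only finitely many applications of inclusion dependencies are on facts below
this level. -/
theorem exists_level_bound (hI : I.Finite) (hY : ∀ σ ∈ I, Function.Injective σ.Y) (hD : D.Finite)
    (l : ℕ) :
    ∃ i, ∀ j ≥ i, ∀ σ t, IDSelected ord I (chaseSeq ord I J D j) σ t →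
      chaseSeq ord I J D (j + 1) = idApply (chaseSeq ord I J D j) σ t →
      l ≤ (chaseSeq ord I J D j).level ⟨σ.lhs, t⟩ := by
  induction l with
  | zero => exact ⟨0, fun _ _ _ _ _ _ => Nat.zero_le _⟩
  | succ l ih =>
    obtain ⟨i, hi⟩ := ih
    -- From stage `i` on, inclusion steps start at level at least `l`, so the number of violations
    -- of level at most `l` never grows and becomes constant. A later step from level exactly `l`
    -- would repair one of them and create none.
    obtain ⟨i', hi', hst⟩ := Nat.exists_stable
      (f := fun j => (violations I (chaseSeq ord I J D j) l).ncard) (i := i) (by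
        intro j hj
        have hfin := finite_facts_chaseSeq (ord := ord) (I := I) (J := J) hD j
        rcases chaseSeq_step_or_eq (ord := ord) (I := I) (J := J) (D := D) j with h | ⟨-, h⟩
        · have hij := hi j hj
          generalize chaseSeq ord I J D (j + 1) = st' at *
          cases h with
          | kd _ κ t t' hsel happ => exact ncard_violations_kdApply hI hfin happ l
          | id σ t hkd hsel =>
            exact Set.ncard_le_ncard (violations_idApply_subset (hij σ t hsel rfl))
              (finite_violations hI hfin l)
        · rw [h])
    refine ⟨i', fun j hj σ t hsel heq => ?_⟩
    have h1 := hi j (hi'.trans hj) σ t hsel heq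
    by_contra hlt
    have hfin := finite_facts_chaseSeq (ord := ord) (I := I) (J := J) hD j
    have h2 := hst j hj
    simp only [heq] at h2
    have h3 := Set.eq_of_subset_of_ncard_le (violations_idApply_subset (I := I) h1) h2.ge
      (finite_violations hI hfin l)
    have h4 : (⟨σ, t⟩ : Σ σ : IncDep S, Fin (S.arity σ.lhs) → Val K) ∈
        violations I (chaseSeq ord I J D j) l := ⟨hsel.1.1, by simp only; omega⟩
    rw [← h3] at h4
    exact h4.1.2.2 ⟨_, Or.inl rfl, newTuple_Y (hY σ hsel.1.1.1) t⟩

theorem activeValues_idApply_subset {st : ChaseState S K} {σ : IncDep S}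
    {t : Fin (S.arity σ.lhs) → Val K} (ht : (⟨σ.lhs, t⟩ : Atom S (Val K)) ∈ st.facts)
    (hY : Function.Surjective σ.Y) :
    activeValues (idApply st σ t).facts ⊆ activeValues st.facts := by
  rintro v ⟨A, hA | hA, j, rfl⟩
  · subst hA
    refine ⟨_, ht, σ.X (hY j).choose, ?_⟩
    change _ = newTuple st σ t j
    rw [newTuple, dif_pos (hY j)]
  · exact ⟨A, hA, j, rfl⟩

/-- From no stage on does the chase apply nothing but key dependencies and full-width inclusion
dependencies. -/
theorem not_eventually_fullWidth [Finite S.Pred] (hY : ∀ σ ∈ I, Function.Injective σ.Y)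
    (hD : D.Finite) (i : ℕ)
    (h : ∀ j ≥ i, (∃ κ t t', KDApplicable J (chaseSeq ord I J D j) κ t t' ∧
        kdApply (chaseSeq ord I J D j) κ t t' = some (chaseSeq ord I J D (j + 1))) ∨
      ∃ σ t, IDApplicable I (chaseSeq ord I J D j) σ t ∧ σ.FullWidth ∧
        chaseSeq ord I J D (j + 1) = idApply (chaseSeq ord I J D j) σ t) : False := by
  have hfin := finite_facts_chaseSeq (ord := ord) (I := I) (J := J) hD
  -- The number of active values never grows under these steps. Once it is constant, key steps are
  -- excluded, and each remaining step adds a new fact over a fixed finite set of values, which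
  -- cannot go on forever.
  obtain ⟨i', hi', hst⟩ := Nat.exists_stable
    (f := fun j => (activeValues (chaseSeq ord I J D j).facts).ncard) (i := i) (by
      intro j hj
      rcases h j hj with ⟨κ, t, t', h1, h2⟩ | ⟨σ, t, h1, h2, h3⟩
      · exact (h1.ncard_activeValues_lt (hfin j) h2).le
      · simp only [h3]
        exact Set.ncard_le_ncard (activeValues_idApply_subset h1.2.1 h2.2.2)
          (finite_activeValues (hfin j)))
  have hid : ∀ j ≥ i', ∃ σ t, IDApplicable I (chaseSeq ord I J D j) σ t ∧ σ.FullWidth ∧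
        chaseSeq ord I J D (j + 1) = idApply (chaseSeq ord I J D j) σ t := by
    intro j hj
    refine (h j (hi'.trans hj)).resolve_left ?_
    rintro ⟨κ, t, t', h1, h2⟩
    exact absurd (hst j hj) (h1.ncard_activeValues_lt (hfin j) h2).ne
  have hval : ∀ m, activeValues (chaseSeq ord I J D (i' + m)).facts ⊆
      activeValues (chaseSeq ord I J D i').facts := by
    intro m
    induction m with
    | zero => exact subset_rfl
    | succ m ih =>
      obtain ⟨σ, t, h1, h2, h3⟩ := hid (i' + m) (by omega)
      rw [← Nat.add_assoc, h3]
      exact (activeValues_idApply_subset h1.2.1 h2.2.2).trans ih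
  have hcard : ∀ m, m ≤ (chaseSeq ord I J D (i' + m)).facts.ncard := by
    intro m
    induction m with
    | zero => exact Nat.zero_le _
    | succ m ih =>
      obtain ⟨σ, t, h1, h2, h3⟩ := hid (i' + m) (by omega)
      rw [← Nat.add_assoc, h3]
      change _ ≤ (insert _ _ : Set _).ncard
      rw [Set.ncard_insert_of_notMem (h1.newFact_notMem (hY σ h1.1)) (hfin _)]
      omega
  have hall := finite_atoms_over (S := S) (finite_activeValues (hfin i'))
  set all := {A : Atom S (Val K) | ∀ k, A.args k ∈ activeValues (chaseSeq ord I J D i').facts}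
  have hsub : (chaseSeq ord I J D (i' + (all.ncard + 1))).facts ⊆ all :=
    fun A hA k => hval _ ⟨A, hA, k, rfl⟩
  have hle := Set.ncard_le_ncard hsub hall
  have := hcard (all.ncard + 1)
  omega

/-- A fact whose level stays bounded does not violate an inclusion dependency forever. -/
theorem exists_stage_not_idApplicable [Finite S.Pred] (hI : I.Finite) (hJ : J.Finite)
    (hY : ∀ σ ∈ I, Function.Injective σ.Y) (hD : D.Finite) (hex : ChaseExists ord I J D)
    {i : ℕ} {σ : IncDep S} {t : Fin (S.arity σ.lhs) → Val K} (l : ℕ)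
    (hl : ∀ j ≥ i, (chaseSeq ord I J D j).level ⟨σ.lhs, t⟩ ≤ l) :
    ∃ j ≥ i, ¬ IDApplicable I (chaseSeq ord I J D j) σ t := by
  by_contra! hsat
  -- From `i₁` on, inclusion steps start above level `l`, whereas the pending violation has level at
  -- most `l`. Only the priority of full-width dependencies and of keys can delay it, so all later
  -- steps are of these two kinds.
  obtain ⟨i₁, hi₁⟩ := exists_level_bound (ord := ord) (J := J) hI hY hD (l + 1)
  refine not_eventually_fullWidth (ord := ord) (J := J) hY hD (max i i₁) fun j hj => ?_
  have hji : i ≤ j := (le_max_left _ _).trans hj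
  by_cases hkd : ∃ κ s s', KDApplicable J (chaseSeq ord I J D j) κ s s'
  · exact Or.inl (exists_chaseStep_of_kdApplicable hJ hD hex hkd)
  · push Not at hkd
    obtain ⟨σ', t', hsel, hnext⟩ := exists_chaseStep_of_idApplicable hI hD hkd
      ⟨σ, t, hsat j hji⟩
    refine Or.inr ⟨σ', t', hsel.1.1, ?_, hnext⟩
    by_contra hfw
    have hnof : ¬ ∃ σ' t', IDApplicable I (chaseSeq ord I J D j) σ' t' ∧ σ'.FullWidth :=
      fun h => hfw (hsel.1.2 h)
    have h1 := (hsel.2 σ t ⟨hsat j hji, fun h => absurd h hnof⟩).1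
    have h2 := hi₁ j ((le_max_right _ _).trans hj) σ' t' hsel hnext
    have h3 := hl j hji
    omega

/-- The successive images of the value `v` from stage `i` on. -/
def trackValue (θ : ℕ → Val K → Val K) (i : ℕ) (v : Val K) : ℕ → Val K
  | 0 => v
  | m + 1 => θ (i + m) (trackValue θ i v m)

theorem trackValue_eventually {θ : ℕ → Val K → Val K}
    (hθ : ∀ m v, θ m v = v ∨ (θ m v).rank < v.rank) (i : ℕ) (v : Val K) :
    ∃ m₀, ∀ m ≥ m₀, trackValue θ i v m = trackValue θ i v m₀ := by
  obtain ⟨m₀, -, hm₀⟩ := Nat.exists_stable (f := fun m => (trackValue θ i v m).rank) (i := 0)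
    fun m _ => by
      rcases hθ (i + m) (trackValue θ i v m) with h | h
      · exact (congrArg Val.rank h).le
      · exact h.le
  refine ⟨m₀, fun m hm => ?_⟩
  induction m, hm using Nat.le_induction with
  | base => rfl
  | succ m hm ih =>
    rw [← ih]
    exact (hθ (i + m) (trackValue θ i v m)).resolve_right (hm₀ m hm).not_lt

/-- The facts that are left unchanged from some stage of the chase on. -/
def chaseLimit (s : ℕ → ChaseState S K) (θ : ℕ → Val K → Val K) : Set (Atom S (Val K)) :=
  {A | ∃ i, ∀ j ≥ i, A ∈ (s j).facts ∧ ∀ k, θ j (A.args k) = A.args k}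

/-- The images of each argument settle because their rank drops at every change, and finitely many
arguments settle together. The clause on fixed values allows a witness to be moved to the limit
without disturbing the values it shares with a fact already there. -/
theorem exists_map_mem_chaseLimit {s : ℕ → ChaseState S K} {θ : ℕ → Val K → Val K}
    (hθ : ∀ m, IsStepMap (s m) (s (m + 1)) (θ m)) {i : ℕ} {A : Atom S (Val K)}
    (hA : A ∈ (s i).facts) :
    ∃ f : Val K → Val K, A.map f ∈ chaseLimit s θ ∧ ∀ v, (∀ j ≥ i, θ j v = v) → f v = v := by
  choose m₀ hm₀ using trackValue_eventually (fun m => (hθ m).rank) i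
  let M := Finset.univ.sup fun k => m₀ (A.args k)
  have hM : ∀ k, ∀ m ≥ M, trackValue θ i (A.args k) m = trackValue θ i (A.args k) M := by
    intro k m hm
    have hk : m₀ (A.args k) ≤ M := Finset.le_sup (f := fun k => m₀ (A.args k)) (Finset.mem_univ k)
    rw [hm₀ _ m (hk.trans hm), hm₀ _ M hk]
  have hmem : ∀ m, A.map (fun v => trackValue θ i v m) ∈ (s (i + m)).facts := by
    intro m
    induction m with
    | zero => exact hA
    | succ m ih => exact (hθ (i + m)).facts _ ih
  refine ⟨fun v => trackValue θ i v M, ⟨i + M, fun j hj => ?_⟩, fun v hv => ?_⟩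
  · obtain ⟨m, rfl⟩ := Nat.exists_eq_add_of_le ((Nat.le_add_right i M).trans hj)
    have hm : M ≤ m := by omega
    constructor
    · have := hmem m
      rwa [Atom.map_congr (g := fun v => trackValue θ i v M) fun k => hM k m hm] at this
    · intro k
      have h1 := hM k (m + 1) (by omega)
      rw [← hM k m hm] at h1
      change θ (i + m) (trackValue θ i (A.args k) M) = trackValue θ i (A.args k) M
      rw [← hM k m hm]
      exact h1
  · induction M with
    | zero => rfl
    | succ m ih =>
      change θ (i + m) (trackValue θ i v m) = v
      rw [show trackValue θ i v m = v from ih, hv _ (by omega)]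

theorem exists_stage_of_subset_chaseLimit {s : ℕ → ChaseState S K} {θ : ℕ → Val K → Val K}
    {F : Set (Atom S (Val K))} (hF : F.Finite) (h : F ⊆ chaseLimit s θ) :
    ∃ m, F ⊆ (s m).facts := by
  have : ∀ A : Atom S (Val K), ∃ i, A ∈ F → ∀ j ≥ i, A ∈ (s j).facts := by
    intro A
    by_cases hA : A ∈ F
    · obtain ⟨i, hi⟩ := h hA
      exact ⟨i, fun _ j hj => (hi j hj).1⟩
    · exact ⟨0, fun h => absurd h hA⟩
  choose i hi using this
  refine ⟨hF.toFinset.sup i, fun A hA => hi A hA _ (Finset.le_sup (hF.mem_toFinset.2 hA))⟩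

/-- The limit of the chase satisfies the dependencies. -/
theorem exists_chase_model [Finite S.Pred] (hI : I.Finite) (hJ : J.Finite)
    (hY : ∀ σ ∈ I, Function.Injective σ.Y) (hD : D.Finite) (hex : ChaseExists ord I J D) :
    ∃ B : Set (Atom S (Val K)), (∀ σ ∈ I, σ.Sat B) ∧ (∀ κ ∈ J, κ.Sat B) ∧ embedDB D ⊆ B ∧
      ∀ F ⊆ B, F.Finite → ∃ m, F ⊆ (chaseSeq ord I J D m).facts := by
  choose θ hθ using exists_isStepMap_chaseSeq (ord := ord) (I := I) (J := J) (D := D) hY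
  refine ⟨chaseLimit (chaseSeq ord I J D) θ, ?_, ?_, ?_, fun F hF hfin =>
    exists_stage_of_subset_chaseLimit hfin hF⟩
  · intro σ hσ t ht
    obtain ⟨i, hi⟩ := ht
    -- Either some stage contains a witness, which is carried to the limit with the shared values
    -- fixed, or the violation stays pending forever. The latter is impossible, since the level of a
    -- fact that is no longer changed does not rise.
    by_cases hsat : ∃ j ≥ i, ¬ IDApplicable I (chaseSeq ord I J D j) σ t
    · obtain ⟨j, hj, hsat⟩ := hsat
      simp only [IDApplicable, hσ, (hi j hj).1, true_and, not_not] at hsat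
      obtain ⟨t', ht', hYX⟩ := hsat
      obtain ⟨f, hf, hfix⟩ := exists_map_mem_chaseLimit hθ ht'
      refine ⟨fun k => f (t' k), hf, fun k => ?_⟩
      change _ = f (t' (σ.Y k))
      rw [hYX, hfix _ fun j' hj' => (hi j' (hj.trans hj')).2 (σ.X k)]
    · refine absurd (exists_stage_not_idApplicable hI hJ hY hD hex (i := i) (σ := σ) (t := t)
        ((chaseSeq ord I J D i).level ⟨σ.lhs, t⟩) fun j hj => ?_) hsat
      induction j, hj using Nat.le_induction with
      | base => exact le_rfl
      | succ j hj ih =>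
        have := (hθ j).level _ (hi j hj).1
        rw [Atom.map_eq_self (hi j hj).2] at this
        exact this.trans ih
  · intro κ hκ t t' ht ht' hne
    by_contra! hkey
    obtain ⟨i, hi⟩ := ht
    obtain ⟨i', hi'⟩ := ht'
    obtain ⟨j, hj, hno⟩ := exists_kdFree_stage hJ hD hex (max i i')
    exact hno κ t t' ⟨hκ, (hi j ((le_max_left _ _).trans hj)).1,
      (hi' j ((le_max_right _ _).trans hj)).1, hne, hkey⟩
  · intro A hA
    have hdom : ∀ m c, θ m (.dom c) = .dom c := fun m c =>
      ((hθ m).rank (.dom c)).resolve_right (Nat.not_lt_zero _)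
    obtain ⟨f, hf, hfix⟩ := exists_map_mem_chaseLimit hθ (i := 0) (A := A) hA
    rwa [Atom.map_eq_self] at hf
    intro k
    obtain ⟨A', -, rfl⟩ := hA
    exact hfix _ fun j _ => hdom j _

end Sequence

/-! ## Homomorphisms from the chase -/

section Homomorphism

variable {S : RelSchema} {K W : Type*} {ord : ChaseOrder S K} {I : Set (IncDep S)}
  {J : Set (KeyDep S)} {D : Set (Atom S K)}

/-- An increasing sequence of sets of facts that satisfies the dependencies up to an equality `E`
and, for inclusion dependencies, up to a passage from `T l` to `T (F l)`.  The equality is only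
required to work well up to index `N`. -/
structure GradedModel (I : Set (IncDep S)) (J : Set (KeyDep S)) (T : ℕ → Set (Atom S W))
    (E : W → W → Prop) (F : ℕ → ℕ) (N : ℕ) : Prop where
  mono : Monotone T
  le_F : ∀ l, l ≤ F l
  symm : ∀ a b, E a b → E b a
  trans : ∀ a b c, E a b → E b c → E a c
  refl : ∀ l ≤ N, ∀ A ∈ T l, ∀ i, E (A.args i) (A.args i)
  kd : ∀ κ ∈ J, ∀ l ≤ N, ∀ t t', (⟨κ.pred, t⟩ : Atom S W) ∈ T l →
    (⟨κ.pred, t'⟩ : Atom S W) ∈ T l → (∀ i ∈ κ.key, E (t i) (t' i)) → ∀ i, E (t i) (t' i)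
  id : ∀ σ ∈ I, ∀ l t, (⟨σ.lhs, t⟩ : Atom S W) ∈ T l →
    ∃ t', (⟨σ.rhs, t'⟩ : Atom S W) ∈ T (F l) ∧ ∀ i, t (σ.X i) = t' (σ.Y i)

/-- `h` maps the facts `G`, up to the equality `E`, into the facts `M`, and extends `ι`. -/
def IsHomUpTo (M : Set (Atom S W)) (E : W → W → Prop) (ι : K → W) (G : Set (Atom S (Val K)))
    (h : Val K → W) : Prop :=
  (∀ c, h (.dom c) = ι c) ∧
    ∀ A ∈ G, ∃ t, (⟨A.pred, t⟩ : Atom S W) ∈ M ∧ ∀ i, E (t i) (h (A.args i))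

variable {T : ℕ → Set (Atom S W)} {E : W → W → Prop} {F : ℕ → ℕ} {N : ℕ} {ι : K → W}

/-- The target structure satisfies the key dependency up to `E`, so whatever a key step of the chase
merges has `E`-related images beforehand. -/
theorem GradedModel.agree (hT : GradedModel I J T E F N) {l : ℕ} (hl : l ≤ N)
    {st : ChaseState S K} {h : Val K → W} (hh : IsHomUpTo (T l) E ι st.facts h) {κ : KeyDep S}
    {t t' : Fin (S.arity κ.pred) → Val K} (happ : KDApplicable J st κ t t') (i) :
    E (h (t i)) (h (t' i)) := by
  obtain ⟨hκ, ht, ht', -, hkey⟩ := happ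
  obtain ⟨u, hu, hut⟩ := hh.2 _ ht
  obtain ⟨u', hu', hut'⟩ := hh.2 _ ht'
  have := hT.kd κ hκ l hl u u' hu hu' fun k hk => by
    refine hT.trans _ _ _ (hut k) ?_
    change E (h (t k)) _
    rw [hkey k hk]
    exact hT.symm _ _ (hut' k)
  exact hT.trans _ _ _ (hT.symm _ _ (hut i)) (hT.trans _ _ _ (this i) (hut' i))

theorem GradedModel.exists_hom_step (hT : GradedModel I J T E F N)
    (hY : ∀ σ ∈ I, Function.Injective σ.Y) {l : ℕ} (hl : F l ≤ N)
    {st st' : ChaseState S K} (hst : FreshBelow st) {h : Val K → W}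
    (hh : IsHomUpTo (T l) E ι st.facts h) (hstep : ChaseStep ord I J st st') :
    ∃ h', IsHomUpTo (T (F l)) E ι st'.facts h' := by
  have hmono : T l ⊆ T (F l) := hT.mono (hT.le_F l)
  cases hstep with
  | kd _ κ t t' hsel happ =>
    obtain ⟨θ, hθ, hfacts, -, -⟩ := kdApply_spec happ
    have hagree := hT.agree ((hT.le_F l).trans hl) hh hsel.1
    have hR := unify_rel (R := fun v w => E (h v) (h w)) (fun _ _ => hT.symm _ _)
      (fun _ _ _ => hT.trans _ _ _) hθ hagree
    -- No new map is needed, since merged values have `E`-related images.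
    refine ⟨h, hh.1, fun A hA => ?_⟩
    rw [hfacts] at hA
    obtain ⟨A, hA, rfl⟩ := hA
    obtain ⟨u, hu, hut⟩ := hh.2 A hA
    refine ⟨u, hmono hu, fun i => ?_⟩
    change E (u i) (h (θ (A.args i)))
    rcases hR (A.args i) with hv | hv
    · rw [hv]; exact hut i
    · exact hT.trans _ _ _ (hut i) hv
  | id σ t hkd hsel =>
    obtain ⟨hσ, ht, hno⟩ := hsel.1.1
    obtain ⟨u, hu, hut⟩ := hh.2 _ ht
    obtain ⟨u', hu', huu'⟩ := hT.id σ hσ l u hu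
    classical
    -- The numbers reserved by this step do not occur in `st`, so `h` can be redefined on them.
    -- Positions covered by `σ.Y` own a number as well, but it does not occur in the new fact.
    let h' : Val K → W := fun v =>
      if hv : ∃ j : Fin (S.arity σ.rhs), v = .fresh (st.next + j) then u' hv.choose else h v
    have hnew : ∀ j : Fin (S.arity σ.rhs), h' (.fresh (st.next + j)) = u' j := by
      intro j
      have hv : ∃ j' : Fin (S.arity σ.rhs), (Val.fresh (st.next + j) : Val K) =
        .fresh (st.next + j') := ⟨j, rfl⟩
      have : hv.choose = j := by
        have := Val.fresh.inj hv.choose_spec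
        exact Fin.ext (by omega)
      simp only [h', dif_pos hv, this]
    have hold : ∀ A ∈ st.facts, ∀ i, h' (A.args i) = h (A.args i) := by
      intro A hA i
      refine dif_neg ?_
      rintro ⟨j, hj⟩
      have := hst A hA i _ hj
      omega
    refine ⟨h', fun c => ?_, ?_⟩
    · rw [← hh.1 c]
      exact dif_neg (by simp)
    · rintro A (rfl | hA)
      · refine ⟨u', hu', fun j => ?_⟩
        change E (u' j) (h' (newTuple st σ t j))
        by_cases hj : ∃ i, σ.Y i = j
        · obtain ⟨i, rfl⟩ := hj
          rw [newTuple_Y (hY σ hσ), hold _ ht, ← huu']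
          exact hut (σ.X i)
        · push Not at hj
          rw [newTuple_of_forall_ne hj, hnew]
          exact hT.refl _ hl _ hu' j
      · obtain ⟨v, hv, hvt⟩ := hh.2 A hA
        exact ⟨v, hmono hv, fun i => (hold A hA i).symm ▸ hvt i⟩

theorem GradedModel.exists_hom_init (hT : GradedModel I J T E F N)
    (hD : ∀ A ∈ D, A.map ι ∈ T 0) [Nonempty W] :
    ∃ h, IsHomUpTo (T 0) E ι (ChaseState.init D).facts h := by
  refine ⟨fun v => match v with | .dom c => ι c | .fresh _ => Classical.arbitrary W,
    fun _ => rfl, ?_⟩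
  rintro _ ⟨A, hA, rfl⟩
  exact ⟨_, hD A hA, fun i => hT.refl 0 (Nat.zero_le _) _ (hD A hA) i⟩

theorem GradedModel.exists_hom (hT : GradedModel I J T E F N)
    (hY : ∀ σ ∈ I, Function.Injective σ.Y) [Nonempty W] (hD : ∀ A ∈ D, A.map ι ∈ T 0) (m : ℕ)
    (hm : F^[m] 0 ≤ N) : ∃ h, IsHomUpTo (T (F^[m] 0)) E ι (chaseSeq ord I J D m).facts h := by
  induction m with
  | zero => exact hT.exists_hom_init hD
  | succ m ih =>
    rw [Function.iterate_succ_apply'] at hm ⊢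
    obtain ⟨h, hh⟩ := ih ((hT.le_F _).trans hm)
    rcases chaseSeq_step_or_eq (ord := ord) (I := I) (J := J) (D := D) m with hs | ⟨-, hs⟩
    · exact hT.exists_hom_step hY hm (freshBelow_chaseSeq m) hh hs
    · rw [hs]
      refine ⟨h, hh.1, fun A hA => ?_⟩
      obtain ⟨t, ht, hE⟩ := hh.2 A hA
      exact ⟨t, hT.mono (hT.le_F _) ht, hE⟩

/-- A genuine model is the case of true equality and no passage between levels, so the same
induction gives homomorphisms into models. -/
theorem gradedModel_const {M : Set (Atom S W)} (hI : ∀ σ ∈ I, σ.Sat M) (hJ : ∀ κ ∈ J, κ.Sat M) :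
    GradedModel I J (fun _ => M) (· = ·) _root_.id 0 where
  mono := monotone_const
  le_F _ := le_rfl
  symm _ _ := Eq.symm
  trans _ _ _ := Eq.trans
  refl _ _ _ _ _ := rfl
  kd κ hκ _ _ t t' ht ht' hkey i := by
    by_contra hi
    obtain ⟨k, hk, hne⟩ := hJ κ hκ t t' ht ht' fun heq => hi (congrFun heq i)
    exact hne (hkey k hk)
  id σ hσ _ t ht := hI σ hσ t ht

theorem IsHomUpTo.map_mem {M : Set (Atom S W)} {G : Set (Atom S (Val K))} {h : Val K → W}
    (hh : IsHomUpTo M (· = ·) ι G h) {A : Atom S (Val K)} (hA : A ∈ G) : A.map h ∈ M := by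
  obtain ⟨t, ht, heq⟩ := hh.2 A hA
  obtain rfl : t = fun i => h (A.args i) := funext heq
  exact ht

/-- The stages of the chase map into every structure that satisfies the dependencies. -/
theorem exists_hom_of_sat {M : Set (Atom S W)} (hI : ∀ σ ∈ I, σ.Sat M) (hJ : ∀ κ ∈ J, κ.Sat M)
    (hY : ∀ σ ∈ I, Function.Injective σ.Y) [Nonempty W] (hD : ∀ A ∈ D, A.map ι ∈ M) (m : ℕ) :
    ∃ h : Val K → W, (∀ c, h (.dom c) = ι c) ∧
      ∀ A ∈ (chaseSeq ord I J D m).facts, A.map h ∈ M := by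
  obtain ⟨h, hh⟩ := (gradedModel_const hI hJ).exists_hom (ord := ord) hY hD m
    (by rw [Function.iterate_id]; exact le_rfl)
  exact ⟨h, hh.1, fun A hA => hh.map_mem hA⟩

/-- If the database has a model in which its constants are not identified, its chase exists. -/
theorem chaseExists_of_sat {M : Set (Atom S W)} (hI : ∀ σ ∈ I, σ.Sat M) (hJ : ∀ κ ∈ J, κ.Sat M)
    (hY : ∀ σ ∈ I, Function.Injective σ.Y) [Nonempty W] (hD : ∀ A ∈ D, A.map ι ∈ M)
    (hι : Function.Injective ι) : ChaseExists ord I J D := by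
  have hT := gradedModel_const hI hJ
  intro st hst
  have : FreshBelow st ∧ ∃ h, IsHomUpTo M (· = ·) ι st.facts h := by
    induction hst with
    | refl => exact ⟨freshBelow_init D, hT.exists_hom_init hD⟩
    | tail _ hstep ih =>
      obtain ⟨hf, h, hh⟩ := ih
      exact ⟨hstep.freshBelow hf, hT.exists_hom_step hY (l := 0) le_rfl hf hh hstep⟩
  obtain ⟨-, h, hh⟩ := this
  intro κ t t' hsel hnone
  simp only [kdApply, Option.map_eq_none_iff] at hnone
  obtain ⟨c, d, hcd, heq⟩ := unify_none (R := fun v w => h v = h w) (fun _ _ => Eq.symm)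
    (fun _ _ _ => Eq.trans) hnone (hT.agree (l := 0) le_rfl hh hsel.1)
  rw [hh.1, hh.1] at heq
  exact hcd (hι heq)

end Homomorphism

/-! ## The chase under inclusion dependencies alone -/

section Inclusion

variable {S : RelSchema} {K : Type*} {ord : ChaseOrder S K} {I : Set (IncDep S)}
  {D : Set (Atom S K)}

theorem not_kdApplicable_empty {st : ChaseState S K} (κ : KeyDep S)
    (t t' : Fin (S.arity κ.pred) → Val K) : ¬ KDApplicable ∅ st κ t t' :=
  fun h => h.1

theorem chaseExists_empty : ChaseExists ord I ∅ D :=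
  fun _ _ κ t t' h => absurd h.1 (not_kdApplicable_empty κ t t')

/-- Total tie-breaking makes the chase under inclusion dependencies deterministic. Hence every
reachable state is a stage of `chaseSeq`, and a fresh constant has a single origin. -/
theorem IDSelected.unique {st : ChaseState S K} {σ σ' : IncDep S}
    {t : Fin (S.arity σ.lhs) → Val K} {t' : Fin (S.arity σ'.lhs) → Val K}
    (h : IDSelected ord I st σ t) (h' : IDSelected ord I st σ' t') :
    (⟨σ, t⟩ : Σ σ : IncDep S, Fin (S.arity σ.lhs) → Val K) = ⟨σ', t'⟩ := by
  obtain ⟨h1, h2⟩ := h.2 σ' t' h'.1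
  obtain ⟨h1', h2'⟩ := h'.2 σ t h.1
  have hl := le_antisymm h1 h1'
  obtain ⟨h3, h4⟩ := h2 hl
  obtain ⟨h3', h4'⟩ := h2' hl.symm
  have hA := ord.fact.le_antisymm _ _ h3 h3'
  obtain rfl := ord.id.le_antisymm _ _ (h4 hA) (h4' hA.symm)
  rw [Atom.mk_inj hA]

theorem chaseStep_empty {st st' : ChaseState S K} (h : ChaseStep ord I ∅ st st') :
    ∃ σ t, IDSelected ord I st σ t ∧ st' = idApply st σ t := by
  cases h with
  | kd _ κ t t' hsel happ => exact absurd hsel.1 (not_kdApplicable_empty κ t t')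
  | id σ t hkd hsel => exact ⟨σ, t, hsel, rfl⟩

theorem chaseSeq_succ_of_idSelected {m : ℕ} {σ : IncDep S} {t : Fin (S.arity σ.lhs) → Val K}
    (h : IDSelected ord I (chaseSeq ord I ∅ D m) σ t) :
    chaseSeq ord I ∅ D (m + 1) = idApply (chaseSeq ord I ∅ D m) σ t := by
  obtain ⟨σ', t', hsel, heq⟩ := chaseStep_empty
    (chaseSeq_step ⟨_, ChaseStep.id _ σ t not_kdApplicable_empty h⟩)
  cases hsel.unique h
  exact heq

theorem exists_eq_chaseSeq {st : ChaseState S K}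
    (h : ReflTransGen (ChaseStep ord I ∅) (ChaseState.init D) st) :
    ∃ m, st = chaseSeq ord I ∅ D m := by
  induction h with
  | refl => exact ⟨0, rfl⟩
  | tail _ hstep ih =>
    obtain ⟨m, rfl⟩ := ih
    obtain ⟨σ, t, hsel, rfl⟩ := chaseStep_empty hstep
    exact ⟨m + 1, (chaseSeq_succ_of_idSelected hsel).symm⟩

theorem chaseSeq_empty_cases (m : ℕ) :
    (∃ σ t, IDSelected ord I (chaseSeq ord I ∅ D m) σ t ∧
      chaseSeq ord I ∅ D (m + 1) = idApply (chaseSeq ord I ∅ D m) σ t) ∨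
    chaseSeq ord I ∅ D (m + 1) = chaseSeq ord I ∅ D m := by
  rcases chaseSeq_step_or_eq (ord := ord) (I := I) (J := ∅) (D := D) m with h | ⟨-, h⟩
  · exact Or.inl (chaseStep_empty h)
  · exact Or.inr h

/-- Without merging no fact is altered, and a fact is added only if it is new, so no level is
overwritten. -/
theorem chaseSeq_empty_stable (hY : ∀ σ ∈ I, Function.Injective σ.Y) {A : Atom S (Val K)} {m m' : ℕ}
    (hm : m ≤ m') (hA : A ∈ (chaseSeq ord I ∅ D m).facts) :
    A ∈ (chaseSeq ord I ∅ D m').facts ∧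
      (chaseSeq ord I ∅ D m').level A = (chaseSeq ord I ∅ D m).level A := by
  induction m', hm using Nat.le_induction with
  | base => exact ⟨hA, rfl⟩
  | succ m' hm ih =>
    rcases chaseSeq_empty_cases (ord := ord) (I := I) (D := D) m' with ⟨σ, t, hsel, h⟩ | h
    · rw [h]
      refine ⟨Or.inr ih.1, ?_⟩
      rw [idApply_level_of_ne, ih.2]
      rintro rfl
      exact hsel.1.1.newFact_notMem (hY σ hsel.1.1.1) ih.1
    · rwa [h]

theorem chaseSeq_empty_next_mono : Monotone fun m => (chaseSeq ord I ∅ D m).next := by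
  refine monotone_nat_of_le_succ fun m => ?_
  rcases chaseSeq_empty_cases (ord := ord) (I := I) (D := D) m with ⟨σ, t, hsel, h⟩ | h
  · rw [h]; exact Nat.le_add_right _ _
  · rw [h]

/-- A bound for the number of facts over the values of a given fact. -/
noncomputable def tupleBound (S : RelSchema) : ℕ :=
  Nat.card (Σ p₀ p : S.Pred, Fin (S.arity p) → Fin (S.arity p₀))

theorem ncard_le_tupleBound [Finite S.Pred] {T : Type*} (A : Atom S T) {G : Set (Atom S T)}
    (hG : ∀ A' ∈ G, Set.range A'.args ⊆ Set.range A.args) : G.ncard ≤ tupleBound S := by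
  let X := Σ p : S.Pred, Fin (S.arity p) → Fin (S.arity A.pred)
  let f : X → Atom S T := fun x => ⟨x.1, fun i => A.args (x.2 i)⟩
  have hsub : G ⊆ f '' Set.univ := by
    intro A' hA'
    have : ∀ i, ∃ j, A.args j = A'.args i := fun i => hG A' hA' ⟨i, rfl⟩
    choose g hg using this
    refine ⟨⟨A'.pred, g⟩, trivial, ?_⟩
    simp only [f, hg]
  calc G.ncard ≤ (f '' Set.univ).ncard := Set.ncard_le_ncard hsub (Set.finite_univ.image f)
    _ ≤ (Set.univ : Set X).ncard := Set.ncard_image_le Set.finite_univ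
    _ = Nat.card X := Set.ncard_univ X
    _ ≤ tupleBound S := Nat.card_le_card_of_injective
        (fun x : X => (⟨A.pred, x⟩ : Σ p₀ p : S.Pred, Fin (S.arity p) → Fin (S.arity p₀)))
        fun _ _ h => eq_of_heq (Sigma.mk.inj h).2

/-- Every fact has been obtained by full-width dependencies from a fact whose level `b` is not much
above the level of any violation. -/
def LevelGap (I : Set (IncDep S)) (st : ChaseState S K) : Prop :=
  ∀ A ∈ st.facts, ∃ b, (∀ σ t, IDApplicable I st σ t → b ≤ st.level ⟨σ.lhs, t⟩ + 1) ∧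
    ∃ G ⊆ st.facts, (∀ A' ∈ G, Set.range A'.args ⊆ Set.range A.args) ∧
      st.level A + 1 ≤ b + G.ncard

/-- A full-width step prolongs the chain `G` by the new fact, in which all the values of its source
reappear. Any other step is selected only when no full-width dependency is applicable, hence at the
least level of all violations; it starts a new chain, with `b` the level of the new fact. -/
theorem LevelGap.idApply (hY : ∀ σ ∈ I, Function.Injective σ.Y) {st : ChaseState S K}
    (hst : st.facts.Finite) {σ : IncDep S} {t : Fin (S.arity σ.lhs) → Val K}
    (hsel : IDSelected ord I st σ t) (h : LevelGap I st) : LevelGap I (idApply st σ t) := by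
  obtain ⟨hσ, ht, hno⟩ := hsel.1.1
  have hnew := hsel.1.1.newFact_notMem (hY σ hσ)
  have hne : ∀ A ∈ st.facts, A ≠ ⟨σ.rhs, newTuple st σ t⟩ := by
    rintro A hA rfl
    exact hnew hA
  have happ : ∀ {b}, (∀ σ t, IDApplicable I st σ t → b ≤ st.level ⟨σ.lhs, t⟩ + 1) →
      ∀ σ' t', IDApplicable I (_root_.idApply st σ t) σ' t' →
        b ≤ (_root_.idApply st σ t).level ⟨σ'.lhs, t'⟩ + 1 := by
    rintro b hb σ' t' ⟨hσ', ht' | ht', hno'⟩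
    · rw [ht', idApply_level_new]
      exact (hb σ t hsel.1.1).trans (by omega)
    · rw [idApply_level_of_ne (hne _ ht')]
      exact hb σ' t' ⟨hσ', ht', fun ⟨u, hu, h⟩ => hno' ⟨u, Or.inr hu, h⟩⟩
  rintro A (rfl | hA)
  · by_cases hfw : σ.FullWidth
    · obtain ⟨b, hb, G, hG, hrange, hcard⟩ := h _ ht
      refine ⟨b, happ hb, insert ⟨σ.rhs, newTuple st σ t⟩ G, Set.insert_subset_insert hG, ?_, ?_⟩
      · rintro A' (rfl | hA')
        · exact subset_rfl
        · refine (hrange A' hA').trans ?_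
          rintro _ ⟨k, rfl⟩
          obtain ⟨i, rfl⟩ := hfw.1.2 k
          exact ⟨σ.Y i, newTuple_Y (hY σ hσ) t i⟩
      · rw [idApply_level_new, Set.ncard_insert_of_notMem (fun h => hnew (hG h)) (hst.subset hG)]
        omega
    · refine ⟨st.level ⟨σ.lhs, t⟩ + 1, ?_, {⟨σ.rhs, newTuple st σ t⟩}, ?_, ?_, ?_⟩
      · rintro σ' t' ⟨hσ', ht' | ht', hno'⟩
        · rw [ht', idApply_level_new]
          omega
        · rw [idApply_level_of_ne (hne _ ht')]
          have := (hsel.2 σ' t' ⟨⟨hσ', ht', fun ⟨u, hu, h⟩ => hno' ⟨u, Or.inr hu, h⟩⟩,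
            fun hf => absurd (hsel.1.2 hf) hfw⟩).1
          omega
      · rintro _ rfl
        exact Or.inl rfl
      · rintro _ rfl
        exact subset_rfl
      · rw [idApply_level_new, Set.ncard_singleton]
  · obtain ⟨b, hb, G, hG, hrange, hcard⟩ := h A hA
    refine ⟨b, happ hb, G, hG.trans (Set.subset_insert _ _), hrange, ?_⟩
    rwa [idApply_level_of_ne (hne A hA)]

theorem levelGap_chaseSeq (hY : ∀ σ ∈ I, Function.Injective σ.Y) (hD : D.Finite) (m : ℕ) :
    LevelGap I (chaseSeq ord I ∅ D m) := by
  induction m with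
  | zero =>
    intro A hA
    refine ⟨0, fun _ _ _ => Nat.zero_le _, {A}, ?_, ?_, ?_⟩
    · rintro _ rfl; exact hA
    · rintro _ rfl; exact subset_rfl
    · rw [Set.ncard_singleton]; exact le_rfl
  | succ m ih =>
    rcases chaseSeq_empty_cases (ord := ord) (I := I) (D := D) m with ⟨σ, t, hsel, h⟩ | h
    · rw [h]; exact ih.idApply hY (finite_facts_chaseSeq hD m) hsel
    · rwa [h]

theorem LevelGap.level_le [Finite S.Pred] {st : ChaseState S K} (h : LevelGap I st)
    {A : Atom S (Val K)} (hA : A ∈ st.facts) {σ : IncDep S} {t : Fin (S.arity σ.lhs) → Val K}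
    (ht : IDApplicable I st σ t) : st.level A ≤ st.level ⟨σ.lhs, t⟩ + tupleBound S := by
  obtain ⟨b, hb, G, -, hrange, hcard⟩ := h A hA
  have h1 := hb σ t ht
  have h2 := ncard_le_tupleBound A hrange
  omega

/-- In the chase under inclusion dependencies, the facts required by the dependencies appear within
a bounded number of levels. -/
theorem exists_witness_level_le [Finite S.Pred] (hI : I.Finite)
    (hY : ∀ σ ∈ I, Function.Injective σ.Y) (hD : D.Finite) {σ : IncDep S} (hσ : σ ∈ I) {m : ℕ}
    {t : Fin (S.arity σ.lhs) → Val K}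
    (ht : (⟨σ.lhs, t⟩ : Atom S (Val K)) ∈ (chaseSeq ord I ∅ D m).facts) :
    ∃ m' t', (⟨σ.rhs, t'⟩ : Atom S (Val K)) ∈ (chaseSeq ord I ∅ D m').facts ∧
      (∀ i, t' (σ.Y i) = t (σ.X i)) ∧ (chaseSeq ord I ∅ D m').level ⟨σ.rhs, t'⟩ ≤
        (chaseSeq ord I ∅ D m).level ⟨σ.lhs, t⟩ + (tupleBound S + 1) := by
  have hlev : ∀ k, (⟨σ.lhs, t⟩ : Atom S (Val K)) ∈ (chaseSeq ord I ∅ D k).facts →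
      (chaseSeq ord I ∅ D k).level ⟨σ.lhs, t⟩ = (chaseSeq ord I ∅ D m).level ⟨σ.lhs, t⟩ := by
    intro k hk
    rcases le_total k m with h | h
    · exact (chaseSeq_empty_stable hY h hk).2.symm
    · exact (chaseSeq_empty_stable hY h ht).2
  -- Consider the first stage that contains both the fact and a witness. Just before it, either the
  -- fact was a pending violation, or the fact is the one being added, from the selected violation.
  -- `LevelGap` compares the witness with that violation.
  let Q : ℕ → Prop := fun k => (⟨σ.lhs, t⟩ : Atom S (Val K)) ∈ (chaseSeq ord I ∅ D k).facts ∧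
    ∃ t', (⟨σ.rhs, t'⟩ : Atom S (Val K)) ∈ (chaseSeq ord I ∅ D k).facts ∧
      ∀ i, t' (σ.Y i) = t (σ.X i)
  have hQ : ∃ k, Q k := by
    obtain ⟨j, hj, hno⟩ := exists_stage_not_idApplicable (ord := ord) hI Set.finite_empty hY hD
      chaseExists_empty (i := m) (σ := σ) (t := t) _
      fun j hj => (chaseSeq_empty_stable hY hj ht).2.le
    have hmem := (chaseSeq_empty_stable hY hj ht).1
    simp only [IDApplicable, hσ, hmem, true_and, not_not] at hno
    exact ⟨j, hmem, hno⟩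
  classical
  obtain ⟨hA, t', ht', hYX⟩ := Nat.find_spec hQ
  refine ⟨Nat.find hQ, t', ht', hYX, ?_⟩
  cases hk : Nat.find hQ with
  | zero => exact Nat.zero_le _
  | succ k =>
    have hnQ : ¬ Q k := Nat.find_min hQ (by omega)
    rw [hk] at hA ht'
    have hlevA := hlev _ hA
    have hgap := levelGap_chaseSeq (ord := ord) hY hD k
    rcases chaseSeq_empty_cases (ord := ord) (I := I) (D := D) k with ⟨σ₀, t₀, hsel, h⟩ | h
    · have hnew := hsel.1.1.newFact_notMem (hY σ₀ hsel.1.1.1)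
      rw [h] at hA ht' hlevA ⊢
      have hold : ∀ A ∈ (chaseSeq ord I ∅ D k).facts,
          (idApply (chaseSeq ord I ∅ D k) σ₀ t₀).level A = (chaseSeq ord I ∅ D k).level A := by
        intro A hA
        refine idApply_level_of_ne ?_
        rintro rfl
        exact hnew hA
      by_cases hAk : (⟨σ.lhs, t⟩ : Atom S (Val K)) ∈ (chaseSeq ord I ∅ D k).facts
      · have happ : IDApplicable I (chaseSeq ord I ∅ D k) σ t :=
          ⟨hσ, hAk, fun hw => hnQ ⟨hAk, hw⟩⟩
        have hlevk := hlev k hAk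
        rcases ht' with ht' | ht'
        · rw [ht', idApply_level_new]
          have := hgap.level_le hsel.1.1.2.1 happ
          omega
        · rw [hold _ ht']
          have := hgap.level_le ht' happ
          omega
      · have hAnew := hA.resolve_right hAk
        have hlev₀ : (idApply (chaseSeq ord I ∅ D k) σ₀ t₀).level ⟨σ.lhs, t⟩ =
            (chaseSeq ord I ∅ D k).level ⟨σ₀.lhs, t₀⟩ + 1 := by
          rw [hAnew, idApply_level_new]
        rcases ht' with ht' | ht'
        · rw [ht', idApply_level_new]
          omega
        · rw [hold _ ht']
          have := hgap.level_le ht' hsel.1.1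
          omega
    · rw [h] at hA ht'
      exact absurd ⟨hA, t', ht', hYX⟩ hnQ

end Inclusion

/-! ## The chase of the dummy database in Skolem terms -/

section Skolem

variable {S : RelSchema} {K K' : Type*}

/-- Replace the innermost constant of a term. -/
def SkTerm.subst (f : K → K') : SkTerm S K → SkTerm S K'
  | .base c => .base (f c)
  | .fn σ j τ => .fn σ j (τ.subst f)

theorem SkTerm.ann_subst (f : K → K') (τ : SkTerm S K) : (τ.subst f).ann = τ.ann := by
  induction τ with
  | base c => rfl
  | fn σ j τ ih => rw [subst, ann, ann, ih]

theorem SkTerm.root_subst (f : K → K') (τ : SkTerm S K) : (τ.subst f).root = f τ.root := by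
  induction τ with
  | base c => rfl
  | fn σ j τ ih => rw [subst, root, root, ih]

/-- The properties of the inclusion dependencies of a conceptual schema that matter below. -/
structure UnaryOrFull (I : Set (IncDep S)) : Prop where
  finite : I.Finite
  injective : ∀ σ ∈ I, Function.Injective σ.Y
  width_pos : ∀ σ ∈ I, 0 < σ.width
  unary_or_surjective : ∀ σ ∈ I, σ.width = 1 ∨ Function.Surjective σ.Y

variable {ord : ChaseOrder S (DummyConst S)} {I : Set (IncDep S)}

theorem DummyApplied.exists_stage {st : ChaseState S (DummyConst S)} {σ : IncDep S}
    {t : Fin (S.arity σ.lhs) → Val (DummyConst S)} (h : DummyApplied ord I st σ t) :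
    ∃ m, st = chaseSeq ord I ∅ (dummyDB S) m ∧
      chaseSeq ord I ∅ (dummyDB S) (m + 1) = idApply st σ t := by
  obtain ⟨m, rfl⟩ := exists_eq_chaseSeq h.1
  exact ⟨m, rfl, chaseSeq_succ_of_idSelected h.2⟩

/-- Successive applications reserve disjoint blocks of numbers, so a number determines the state in
which it was introduced. -/
theorem DummyApplied.state_eq {st st' : ChaseState S (DummyConst S)} {σ σ' : IncDep S}
    {t : Fin (S.arity σ.lhs) → Val (DummyConst S)} {t' : Fin (S.arity σ'.lhs) → Val (DummyConst S)}
    (h : DummyApplied ord I st σ t) (h' : DummyApplied ord I st' σ' t')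
    {j : Fin (S.arity σ.rhs)} {j' : Fin (S.arity σ'.rhs)} (hj : st.next + j = st'.next + j') :
    st = st' := by
  obtain ⟨m, hm, hs⟩ := h.exists_stage
  obtain ⟨m', hm', hs'⟩ := h'.exists_stage
  have hn : (chaseSeq ord I ∅ (dummyDB S) (m + 1)).next = st.next + S.arity σ.rhs := by rw [hs]; rfl
  have hn' : (chaseSeq ord I ∅ (dummyDB S) (m' + 1)).next = st'.next + S.arity σ'.rhs := by
    rw [hs']; rfl
  have := j.2
  have := j'.2
  rcases lt_trichotomy m m' with hlt | rfl | hlt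
  · have := chaseSeq_empty_next_mono (ord := ord) (I := I) (D := dummyDB S)
      (show m + 1 ≤ m' by omega)
    simp only [hn, ← hm'] at this
    omega
  · rw [hm, hm']
  · have := chaseSeq_empty_next_mono (ord := ord) (I := I) (D := dummyDB S)
      (show m' + 1 ≤ m by omega)
    simp only [hn', ← hm] at this
    omega

theorem SkolemOf.inv {v : Val (DummyConst S)} {τ : SkTerm S (DummyConst S)}
    (h : SkolemOf ord I v τ) :
    (∃ c, v = .dom c ∧ τ = .base c) ∨ ∃ st σ t i j τ', DummyApplied ord I st σ t ∧ σ.width = 1 ∧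
      SkolemOf ord I (t (σ.X i)) τ' ∧ v = .fresh (st.next + (j : Fin (S.arity σ.rhs))) ∧
      τ = .fn σ j τ' := by
  cases h with
  | base c => exact Or.inl ⟨c, rfl, rfl⟩
  | fn st σ t i j τ' h1 h2 h3 h4 =>
    exact Or.inr ⟨st, σ, t, i, j, τ', h1, h2, h4, newTuple_of_forall_ne h3, rfl⟩

/-- A fresh constant determines the state that introduced it, thus the selected dependency and
tuple, and then the position. As the width is one, the component to which the function is applied is
determined too. -/
theorem SkolemOf.unique {v : Val (DummyConst S)} {τ τ' : SkTerm S (DummyConst S)}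
    (h : SkolemOf ord I v τ) (h' : SkolemOf ord I v τ') : τ = τ' := by
  induction h generalizing τ' with
  | base c =>
    rcases h'.inv with ⟨c', hc, rfl⟩ | ⟨st, σ, t, i, j, τ'', -, -, -, hv, -⟩
    · rw [Val.dom.inj hc]
    · cases hv
  | fn st σ t i j τ h1 h2 h3 h4 ih =>
    rw [newTuple_of_forall_ne h3] at h'
    rcases h'.inv with ⟨c', hc, -⟩ | ⟨st', σ', t', i', j', τ'', h1', h2', h4', hv, rfl⟩
    · cases hc
    · have hj := Val.fresh.inj hv
      obtain rfl := h1.state_eq h1' hj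
      cases h1.2.unique h1'.2
      obtain rfl : j = j' := Fin.ext (by omega)
      obtain rfl : i = i' := by
        have := i.2
        have := i'.2
        exact Fin.ext (by omega)
      rw [ih h4']

theorem finite_dummyDB [Finite S.Pred] : (dummyDB S).Finite := Set.finite_range _

/-- Every fact of the chase of the dummy database has a version in Skolem terms, all of whose
innermost constants come from a single fact of the dummy database. -/
theorem exists_skolem_version (hI : UnaryOrFull I) (m : ℕ) :
    ∀ A ∈ (chaseSeq ord I ∅ (dummyDB S) m).facts,
      ∃ (a : Fin (S.arity A.pred) → SkTerm S (DummyConst S)) (p : S.Pred),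
        (∀ i, SkolemOf ord I (A.args i) (a i)) ∧ ∀ i, (a i).root.1 = p := by
  induction m with
  | zero =>
    rintro _ ⟨_, ⟨p, rfl⟩, rfl⟩
    exact ⟨fun i => .base ⟨p, i⟩, p, fun i => .base _, fun i => rfl⟩
  | succ m ih =>
    rcases chaseSeq_empty_cases (ord := ord) (I := I) (D := dummyDB S) m with ⟨σ, t, hsel, h⟩ | h
    · rw [h]
      rintro A (rfl | hA)
      · obtain ⟨hσ, ht, -⟩ := hsel.1.1
        obtain ⟨a, p, ha, hp⟩ := ih _ ht
        have happ : DummyApplied ord I (chaseSeq ord I ∅ (dummyDB S) m) σ t :=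
          ⟨chaseSeq_reachable m, hsel⟩
        have : ∀ j, ∃ τ, SkolemOf ord I (newTuple (chaseSeq ord I ∅ (dummyDB S) m) σ t j) τ ∧
            τ.root.1 = p := by
          intro j
          by_cases hj : ∃ i, σ.Y i = j
          · obtain ⟨i, rfl⟩ := hj
            rw [newTuple_Y (hI.injective σ hσ)]
            exact ⟨a (σ.X i), ha _, hp _⟩
          · push Not at hj
            have hw : σ.width = 1 := (hI.unary_or_surjective σ hσ).resolve_right fun hs => by
              obtain ⟨i, hi⟩ := hs j
              exact hj i hi
            exact ⟨_, SkolemOf.fn _ σ t ⟨0, hI.width_pos σ hσ⟩ j _ happ hw hj (ha _), hp _⟩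
        choose b hb hbp using this
        exact ⟨b, p, hb, hbp⟩
      · exact ih A hA
    · rwa [h]

/-- `p(a₁,…,a_m)` is a fact of level `l` of the chase of the dummy database. -/
def IsDummyFact (ord : ChaseOrder S (DummyConst S)) (I : Set (IncDep S)) (l : ℕ) (p : S.Pred)
    (a : Fin (S.arity p) → SkTerm S (DummyConst S)) : Prop :=
  ∃ m t, (⟨p, t⟩ : Atom S (Val (DummyConst S))) ∈ (chaseSeq ord I ∅ (dummyDB S) m).facts ∧
    (chaseSeq ord I ∅ (dummyDB S) m).level ⟨p, t⟩ = l ∧ ∀ i, SkolemOf ord I (t i) (a i)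

/-- The instances over `D` of the facts of level at most `l` of the chase of the dummy database. -/
def dummyInstances (ord : ChaseOrder S (DummyConst S)) (I : Set (IncDep S)) (D : Set (Atom S K))
    (l : ℕ) : Set (Atom S (SkTerm S K)) :=
  {A | ∃ (p : S.Pred) (f : DummyConst S → K), (⟨p, fun i => f ⟨p, i⟩⟩ : Atom S K) ∈ D ∧
    ∃ l' ≤ l, ∃ a : Fin (S.arity A.pred) → SkTerm S (DummyConst S),
      IsDummyFact ord I l' A.pred a ∧ (∀ i, (a i).root.1 = p) ∧ A.args = fun i => (a i).subst f}

theorem dummyInstances_mono (D : Set (Atom S K)) : Monotone (dummyInstances ord I D) := by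
  rintro l₁ l₂ hl A ⟨p, f, hD, l', hl', h⟩
  exact ⟨p, f, hD, l', hl'.trans hl, h⟩

theorem map_base_mem_dummyInstances [Nonempty K] {D : Set (Atom S K)} {A : Atom S K} (hA : A ∈ D) :
    A.map SkTerm.base ∈ dummyInstances ord I D 0 := by
  classical
  obtain ⟨p, c⟩ := A
  let f : DummyConst S → K := fun x =>
    if h : x.1 = p then c (h ▸ x.2) else Classical.arbitrary K
  have hf : ∀ i, f ⟨p, i⟩ = c i := fun i => dif_pos rfl
  refine ⟨p, f, ?_, 0, le_rfl, fun i => .base ⟨p, i⟩, ⟨0, fun i => .dom ⟨p, i⟩, ?_, rfl, ?_⟩,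
    fun i => rfl, ?_⟩
  · simpa only [hf] using hA
  · exact ⟨_, ⟨p, rfl⟩, rfl⟩
  · exact fun i => .base _
  · simp only [SkTerm.subst, hf, Atom.map]

theorem dummyInstances_closed [Finite S.Pred] (hI : UnaryOrFull I) {D : Set (Atom S K)}
    {σ : IncDep S} (hσ : σ ∈ I) {l : ℕ} {t : Fin (S.arity σ.lhs) → SkTerm S K}
    (ht : (⟨σ.lhs, t⟩ : Atom S (SkTerm S K)) ∈ dummyInstances ord I D l) :
    ∃ t', (⟨σ.rhs, t'⟩ : Atom S (SkTerm S K)) ∈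
        dummyInstances ord I D (l + (tupleBound S + 1)) ∧ ∀ i, t (σ.X i) = t' (σ.Y i) := by
  obtain ⟨p, f, hD, l', hl', a, ⟨m, u, hu, rfl, ha⟩, hp, ht⟩ := ht
  change t = _ at ht
  obtain ⟨m', u', hu', hYX, hlev⟩ :=
    exists_witness_level_le hI.finite hI.injective finite_dummyDB hσ hu
  obtain ⟨a', p', ha', hp'⟩ := exists_skolem_version hI m' _ hu'
  have heq : ∀ i, a' (σ.Y i) = a (σ.X i) := by
    intro i
    have h1 := ha' (σ.Y i)
    change SkolemOf ord I (u' (σ.Y i)) _ at h1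
    rw [hYX] at h1
    exact h1.unique (ha (σ.X i))
  -- The component shared with the source shows that the witness stems from the same dummy fact, so
  -- the substitution `f` serves for both.
  have hpp : p' = p := by
    rw [← hp' (σ.Y ⟨0, hI.width_pos σ hσ⟩), heq, hp]
  subst hpp
  exact ⟨fun i => (a' i).subst f, ⟨p', f, hD, _, hlev.trans (by simp only at hl'; omega), a',
    ⟨m', u', hu', rfl, ha'⟩, hp', rfl⟩, fun i =>
    (congrFun ht _).trans (congrArg (SkTerm.subst f) (heq i).symm)⟩

end Skolem

/-! ## Derivations of the rewriting, in Skolem terms -/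

section Derivation

variable {S : RelSchema} {V K : Type*} {n : ℕ}

/-- The annotated fact that stands for a fact over Skolem terms. -/
def termAtom (A : Atom (baseSchema S n) (SkTerm S K)) : Atom (annSchema S n) K :=
  ⟨AnnPred.ann A.pred fun i => (A.args i).ann, fun i => (A.args i).root⟩

/-- The value of a term of a rule when its variables stand for Skolem terms. -/
def DTerm.skolem {W : Type*} (β : W → SkTerm S K) : DTerm W K → SkTerm S K
  | .var x => β x
  | .const c => .base c

theorem annAtom_congr {b : BasePred S} {η η' : Fin ((baseSchema S n).arity b) → Ann S}
    {c c' : Fin ((baseSchema S n).arity b) → K} (h : η = η') (h' : c = c') :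
    (⟨AnnPred.ann b η, c⟩ : Atom (annSchema S n) K) = ⟨AnnPred.ann b η', c'⟩ := by
  subst h h'
  rfl

/-- The annotation carries the function symbols of a Skolem term and the argument its innermost
constant. Thus instances of annotated rules are instances of the original rules over Skolem terms.
-/
theorem annotate_map_eval {W : Type*} (β : W → SkTerm S K)
    (A : Atom (baseSchema S n) (DTerm W K)) :
    (A.annotate fun x => (β x).ann).map (DTerm.eval fun x => (β x).root) =
      termAtom (A.map (DTerm.skolem β)) := by
  refine annAtom_congr (funext fun i => ?_) (funext fun i => ?_)
  · change _ = (DTerm.skolem β (A.args i)).ann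
    cases A.args i <;> rfl
  · change DTerm.eval _ (A.args i) = (DTerm.skolem β (A.args i)).root
    cases A.args i <;> rfl

theorem eqAtom_map {T T' : Type*} (g : T → T') (a b : T) :
    (eqAtom S n a b).map g = eqAtom S n (g a) (g b) := by
  refine congrArg (Atom.mk (S := baseSchema S n) BasePred.eq) (funext fun i => ?_)
  change Fin 2 at i
  fin_cases i <;> rfl

theorem relAtom_map {T T' : Type*} {g : T → T'} {p : S.Pred} {u : Fin (S.arity p) → T}
    {t : Fin (S.arity p) → T'} (h : ∀ j, g (u j) = t j) :
    (relAtom n p u).map g = relAtom n p t :=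
  congrArg (Atom.mk (S := baseSchema S n) (BasePred.rel p)) (funext h)

variable {ord : ChaseOrder S (DummyConst S)} {I : Set (IncDep S)} {J : Set (KeyDep S)}
  {q : CQ S V K n} {N : ℕ} {D : Set (Atom S K)}

/-- The rewriting derives a fact over Skolem terms. -/
def Derives (ord : ChaseOrder S (DummyConst S)) (I : Set (IncDep S)) (J : Set (KeyDep S))
    (q : CQ S V K n) (N : ℕ) (D : Set (Atom S K)) (A : Atom (baseSchema S n) (SkTerm S K)) : Prop :=
  LeastModel (finProgram ord I J q N) (plainFacts n D) (termAtom A)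

theorem Derives.rule {ρ : Rule (baseSchema S n) (RVar S V) K}
    (hρ : IsKDRule J ρ ∨ IsEqRule ρ ∨ ρ = q.maquillage) (β : RVar S V → SkTerm S K)
    (hβ : ∀ x, AnnAvailable V K n ord I N (β x).ann)
    (h : ∀ A ∈ ρ.body, Derives ord I J q N D (A.map (DTerm.skolem β))) :
    Derives ord I J q N D (ρ.head.map (DTerm.skolem β)) := by
  have := LeastModel.rule (P := finProgram ord I J q N) (D := plainFacts n D)
    (ρ.annotate fun x => (β x).ann) (fun x => (β x).root) (Or.inr ⟨ρ, _, hρ, hβ, rfl⟩) (by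
      intro A hA
      simp only [Rule.annotate, List.mem_map] at hA
      obtain ⟨A, hA, rfl⟩ := hA
      rw [annotate_map_eval]
      exact h A hA)
  simp only [Rule.annotate, annotate_map_eval] at this
  exact this

/-- The rewriting derives an equation between terms with available annotations. -/
def DerivesEq (ord : ChaseOrder S (DummyConst S)) (I : Set (IncDep S)) (J : Set (KeyDep S))
    (q : CQ S V K n) (N : ℕ) (D : Set (Atom S K)) (τ τ' : SkTerm S K) : Prop :=
  AnnAvailable V K n ord I N τ.ann ∧ AnnAvailable V K n ord I N τ'.ann ∧
    Derives ord I J q N D (eqAtom S n τ τ')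

theorem DerivesEq.symm {τ τ' : SkTerm S K} (h : DerivesEq ord I J q N D τ τ') :
    DerivesEq ord I J q N D τ' τ := by
  refine ⟨h.2.1, h.1, ?_⟩
  have := Derives.rule (q := q) (J := J) (D := D) (Or.inr (Or.inl IsEqRule.symm))
    -- Variables absent from the rule need available annotations too, so they all receive `τ'`.
    (fun x : RVar S V => match x with | .new _ 0 => τ | _ => τ')
    (by intro x; split; exacts [h.1, h.2.1]) (by
      intro A hA
      simp only [List.mem_singleton] at hA
      subst hA
      rw [eqAtom_map]
      exact h.2.2)
  rwa [eqAtom_map] at this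

theorem DerivesEq.trans {τ τ' τ'' : SkTerm S K} (h : DerivesEq ord I J q N D τ τ')
    (h' : DerivesEq ord I J q N D τ' τ'') : DerivesEq ord I J q N D τ τ'' := by
  refine ⟨h.1, h'.2.1, ?_⟩
  have := Derives.rule (q := q) (J := J) (D := D) (Or.inr (Or.inl IsEqRule.trans))
    (fun x : RVar S V => match x with | .new _ 0 => τ | .new _ 1 => τ' | _ => τ'')
    (by intro x; split; exacts [h.1, h.2.1, h'.2.1]) (by
      intro A hA
      simp only [List.mem_cons, List.not_mem_nil, or_false] at hA
      rcases hA with rfl | rfl <;> rw [eqAtom_map]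
      · exact h.2.2
      · exact h'.2.2)
  rwa [eqAtom_map] at this

theorem annAvailable_base (c : K) :
    AnnAvailable V K n ord I N (SkTerm.base c : SkTerm S K).ann := Or.inl rfl

theorem derivesEq_refl [Nonempty K] {p : S.Pred} {t : Fin (S.arity p) → SkTerm S K}
    (hav : ∀ i, AnnAvailable V K n ord I N (t i).ann)
    (h : Derives ord I J q N D (relAtom n p t)) (i : Fin (S.arity p)) :
    DerivesEq ord I J q N D (t i) (t i) := by
  refine ⟨hav i, hav i, ?_⟩
  let d : SkTerm S K := .base (Classical.arbitrary K)
  let β : RVar S V → SkTerm S K := fun x =>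
    match x with | .new _ j => if h : j < S.arity p then t ⟨j, h⟩ else d | _ => d
  have hβ : ∀ j : Fin (S.arity p), DTerm.skolem β (nv S V K 0 j) = t j := fun j => dif_pos j.2
  have := Derives.rule (q := q) (J := J) (D := D) (Or.inr (Or.inl (IsEqRule.refl p i))) β
    (by
      intro x
      simp only [β]
      split
      · split_ifs with hj
        exacts [hav _, annAvailable_base _]
      · exact annAvailable_base _) (by
      intro A hA
      simp only [List.mem_singleton] at hA
      subst hA
      rw [relAtom_map hβ]
      exact h)
  rwa [eqAtom_map, hβ] at this

theorem derivesEq_of_key [Nonempty K] {κ : KeyDep S} (hκ : κ ∈ J) {k : Fin (S.arity κ.pred)}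
    (hk : κ.key = {k}) {t t' : Fin (S.arity κ.pred) → SkTerm S K}
    (hav : ∀ i, AnnAvailable V K n ord I N (t i).ann)
    (hav' : ∀ i, AnnAvailable V K n ord I N (t' i).ann)
    (h : Derives ord I J q N D (relAtom n κ.pred t))
    (h' : Derives ord I J q N D (relAtom n κ.pred t'))
    (heq : DerivesEq ord I J q N D (t k) (t' k)) (i : Fin (S.arity κ.pred)) :
    DerivesEq ord I J q N D (t i) (t' i) := by
  by_cases hik : i = k
  · rwa [hik]
  refine ⟨hav i, hav' i, ?_⟩
  let d : SkTerm S K := .base (Classical.arbitrary K)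
  let β : RVar S V → SkTerm S K := fun x =>
    match x with
    | .new 0 j => if h : j < S.arity κ.pred then t ⟨j, h⟩ else d
    | .new _ j => if h : j < S.arity κ.pred then t' ⟨j, h⟩ else d
    | _ => d
  have hβ : ∀ j : Fin (S.arity κ.pred), DTerm.skolem β (nv S V K 0 j) = t j := fun j => dif_pos j.2
  have hβ' : ∀ j : Fin (S.arity κ.pred), DTerm.skolem β (nv S V K 1 j) = t' j :=
    fun j => dif_pos j.2
  have := Derives.rule (q := q) (J := J) (D := D) (Or.inl (IsKDRule.mk κ k i hκ hk hik)) β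
    (by
      intro x
      simp only [β]
      split
      · split_ifs with hj
        exacts [hav _, annAvailable_base _]
      · split_ifs with hj
        exacts [hav' _, annAvailable_base _]
      · exact annAvailable_base _) (by
      intro A hA
      simp only [List.mem_cons, List.not_mem_nil, or_false] at hA
      rcases hA with rfl | rfl | rfl
      · rw [relAtom_map hβ]
        exact h
      · rw [relAtom_map hβ']
        exact h'
      · rw [eqAtom_map, hβ, hβ']
        exact heq.2.2)
  rwa [eqAtom_map, hβ, hβ'] at this

/-- The substitution `f` turns the dummy fact of `p` into a fact of `D`, from which a base rule
starts. Each step of the dummy chase up to level `N` is a rule that can be instantiated by `f`, and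
this rule makes the annotations of its head available. -/
theorem derives_of_dummy_stage [Nonempty K] (hI : UnaryOrFull I) (hS : ∀ p, 0 < S.arity p)
    {p : S.Pred} {f : DummyConst S → K} (hD : (⟨p, fun i => f ⟨p, i⟩⟩ : Atom S K) ∈ D) (m : ℕ) :
    ∀ A ∈ (chaseSeq ord I ∅ (dummyDB S) m).facts,
      (chaseSeq ord I ∅ (dummyDB S) m).level A ≤ N →
      ∀ a : Fin (S.arity A.pred) → SkTerm S (DummyConst S),
      (∀ i, SkolemOf ord I (A.args i) (a i)) → (∀ i, (a i).root.1 = p) →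
      (∀ i, AnnAvailable V K n ord I N (a i).ann) ∧
        Derives ord I J q N D (relAtom n A.pred fun i => (a i).subst f) := by
  induction m with
  | zero =>
    rintro _ ⟨_, ⟨p', rfl⟩, rfl⟩ - a ha hp
    obtain rfl : a = fun i => .base ⟨p', i⟩ := funext fun i => (ha i).unique (.base _)
    -- Positive arity is needed here: without arguments, `hp` would say nothing about the predicate.
    obtain rfl : p' = p := hp ⟨0, hS p'⟩
    refine ⟨fun i => Or.inl rfl, ?_⟩
    let θ : RVar S V → K := fun x =>
      match x with
      | .new _ j => if h : j < S.arity p' then f ⟨p', ⟨j, h⟩⟩ else Classical.arbitrary K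
      | _ => Classical.arbitrary K
    have hθ : ∀ i : Fin (S.arity p'), DTerm.eval θ (nv S V K 0 i) = f ⟨p', i⟩ :=
      fun i => dif_pos i.2
    have := LeastModel.rule (P := finProgram ord I J q N) (D := plainFacts n D) _ θ
      (Or.inl (Or.inr (IsBaseRule.mk (.rel p') (by simp)))) (by
        intro A hA
        simp only [List.mem_singleton] at hA
        subst hA
        exact LeastModel.fact _ ⟨_, hD, congrArg (Atom.mk (S := annSchema S n)
          (AnnPred.plain (BasePred.rel p'))) (funext fun i => (hθ i).symm)⟩)
    have heq : termAtom (relAtom n p' fun i => SkTerm.base (f ⟨p', i⟩)) = _ :=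
      annAtom_congr rfl (funext fun i => (hθ i).symm)
    unfold Derives
    exact heq ▸ this
  | succ m ih =>
    rcases chaseSeq_empty_cases (ord := ord) (I := I) (D := dummyDB S) m with ⟨σ, t, hsel, h⟩ | h
    · rw [h]
      have hnew := hsel.1.1.newFact_notMem (hI.injective σ hsel.1.1.1)
      rintro A (rfl | hA) hl a ha hp
      · obtain ⟨hσ, ht, -⟩ := hsel.1.1
        obtain ⟨a₁, p₁, ha₁, hp₁⟩ := exists_skolem_version hI m _ ht
        have hpp : p₁ = p := by
          have h1 := ha (σ.Y ⟨0, hI.width_pos σ hσ⟩)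
          change SkolemOf ord I (newTuple _ σ t (σ.Y _)) _ at h1
          rw [newTuple_Y (hI.injective σ hσ)] at h1
          rw [← hp₁ (σ.X ⟨0, hI.width_pos σ hσ⟩), (ha₁ (σ.X _)).unique h1, hp]
        rw [idApply_level_new] at hl
        have hrule := IsDummyRule.mk (N := N) (n := n) (V := V) (K := K) _ σ t a₁ a
          ⟨chaseSeq_reachable m, hsel⟩ hl ha₁ ha
        refine ⟨fun i => Or.inr ⟨_, hrule, Or.inl ⟨_, _, rfl, i, rfl⟩⟩, ?_⟩
        let θ : RVar S V → K := fun x =>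
          match x with | .dummy c => f c | _ => Classical.arbitrary K
        have hver : ∀ (p : S.Pred) (a : Fin (S.arity p) → SkTerm S (DummyConst S)),
            termAtom (relAtom n p fun i => (a i).subst f) =
              (annotatedVersion V K n p a).map (DTerm.eval θ) := fun p a =>
          annAtom_congr (funext fun i => SkTerm.ann_subst f (a i))
            (funext fun i => SkTerm.root_subst f (a i))
        unfold Derives
        rw [hver]
        refine LeastModel.rule (P := finProgram ord I J q N)
          ⟨annotatedVersion V K n σ.rhs a, [annotatedVersion V K n σ.lhs a₁]⟩ θ
          (Or.inl (Or.inl hrule)) ?_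
        intro A hA
        simp only [List.mem_singleton] at hA
        subst hA
        rw [← hver]
        exact (ih _ ht (by omega) a₁ ha₁ fun i => (hp₁ i).trans hpp).2
      · rw [idApply_level_of_ne (by rintro rfl; exact hnew hA)] at hl
        exact ih A hA hl a ha hp
    · rwa [h]

theorem derives_of_mem_dummyInstances [Nonempty K] (hI : UnaryOrFull I)
    (hS : ∀ p, 0 < S.arity p) {l : ℕ} (hl : l ≤ N) {A : Atom S (SkTerm S K)}
    (hA : A ∈ dummyInstances ord I D l) :
    (∀ i, AnnAvailable V K n ord I N (A.args i).ann) ∧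
      Derives ord I J q N D (relAtom n A.pred A.args) := by
  obtain ⟨p, f, hD, l', hl', a, ⟨m, t, ht, hlev, ha⟩, hp, hargs⟩ := hA
  have := derives_of_dummy_stage (V := V) (J := J) (q := q) (N := N) hI hS hD m _ ht
    (by omega) a ha hp
  rw [hargs]
  exact ⟨fun i => by rw [SkTerm.ann_subst]; exact this.1 i, this.2⟩

/-- Closure under inclusion dependencies concerns the dummy chase alone and holds at all levels.
Reflexivity and keys require derivations, which are guaranteed only up to level `N`, and the
rewriting has rules for unary keys only. -/
theorem gradedModel_dummyInstances [Nonempty K] [Finite S.Pred] (hI : UnaryOrFull I)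
    (hS : ∀ p, 0 < S.arity p) (hJ : ∀ κ ∈ J, ∃ k, κ.key = {k}) (q : CQ S V K n) (N : ℕ) :
    GradedModel I J (dummyInstances ord I D) (DerivesEq ord I J q N D)
      (fun l => l + (tupleBound S + 1)) N where
  mono := dummyInstances_mono D
  le_F l := Nat.le_add_right _ _
  symm _ _ := DerivesEq.symm
  trans _ _ _ := DerivesEq.trans
  refl l hl A hA i := by
    obtain ⟨h1, h2⟩ := derives_of_mem_dummyInstances (J := J) (q := q) hI hS hl hA
    exact derivesEq_refl h1 h2 i
  kd κ hκ l hl t t' ht ht' hkey i := by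
    obtain ⟨k, hk⟩ := hJ κ hκ
    obtain ⟨h1, h2⟩ := derives_of_mem_dummyInstances (J := J) (q := q) hI hS hl ht
    obtain ⟨h1', h2'⟩ := derives_of_mem_dummyInstances (J := J) (q := q) hI hS hl ht'
    exact derivesEq_of_key hκ hk h1 h1' h2 h2' (hkey k (by rw [hk]; rfl)) i
  id σ hσ l t ht := dummyInstances_closed hI hσ ht

end Derivation

/-! ## Completeness over a fixed database -/

section Completeness

variable {S : RelSchema} {V K : Type*} {n : ℕ} {I : Set (IncDep S)} {J : Set (KeyDep S)}
  {D : Set (Atom S K)}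

/-- A match of the query in facts that map, up to derived equality, to derived facts over Skolem
terms gives an answer of the rewriting. -/
theorem mem_evalProgram_of_hom [Nonempty K] {ord : ChaseOrder S (DummyConst S)}
    (hI : UnaryOrFull I) (hS : ∀ p, 0 < S.arity p) {q : CQ S V K n} {N l : ℕ} (hl : l ≤ N)
    {G : Set (Atom S (Val K))} {h : Val K → SkTerm S K}
    (hh : IsHomUpTo (dummyInstances ord I D l) (DerivesEq ord I J q N D) SkTerm.base G h)
    {g : V → Val K} (hg : ∀ A ∈ q.body, A.map (DTerm.value g) ∈ G) {t : Fin n → K}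
    (ht : ∀ i, g (q.head i) = .dom (t i)) :
    t ∈ evalProgram (finProgram ord I J q N) D := by
  classical
  have hu : ∀ A : Atom S (DTerm V K), ∃ u : Fin (S.arity A.pred) → SkTerm S K, A ∈ q.body →
      (⟨A.pred, u⟩ : Atom S (SkTerm S K)) ∈ dummyInstances ord I D l ∧
        ∀ i, DerivesEq ord I J q N D (u i) (h (DTerm.value g (A.args i))) := by
    intro A
    by_cases hA : A ∈ q.body
    · obtain ⟨u, hu⟩ := hh.2 _ (hg A hA)
      exact ⟨u, fun _ => hu⟩
    · exact ⟨fun _ => .base (Classical.arbitrary K), fun h => absurd h hA⟩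
  choose u hu using hu
  let d : SkTerm S K := .base (Classical.arbitrary K)
  -- The new variables take the entries of the derived facts, the query variables their images under
  -- `h`, and the added `eq` atoms bridge the two. The guard matters only for variables outside the
  -- body, whose image may lack an available annotation.
  let β : RVar S V → SkTerm S K := fun x =>
    match x with
    | .orig x => if AnnAvailable V K n ord I N (h (g x)).ann then h (g x) else d
    | .new a i =>
      match q.body[a]? with
      | some A => if hi : i < S.arity A.pred ∧ A ∈ q.body then u A ⟨i, hi.1⟩ else d
      | none => d
    | .dummy _ => d
  have hβ : ∀ x, AnnAvailable V K n ord I N (β x).ann := by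
    intro x
    simp only [β]
    split
    · split_ifs with hx
      exacts [hx, annAvailable_base _]
    · split
      · split_ifs with hi
        · exact ((hu _ hi.2).2 _).1
        · exact annAvailable_base _
      · exact annAvailable_base _
    · exact annAvailable_base _
  have hnew : ∀ {a A}, q.body[a]? = some A → A ∈ q.body → ∀ i : Fin (S.arity A.pred),
      DTerm.skolem β (nv S V K a i) = u A i := by
    intro a A ha hA i
    simp only [DTerm.skolem, nv, β, ha]
    exact dif_pos ⟨i.2, hA⟩
  have horig : ∀ x : DTerm V K, AnnAvailable V K n ord I N (h (DTerm.value g x)).ann →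
      DTerm.skolem β (DTerm.orig x) = h (DTerm.value g x) := by
    rintro (x | c) hx
    · exact if_pos hx
    · exact (hh.1 c).symm
  have hder := Derives.rule (q := q) (J := J) (D := D) (Or.inr (Or.inr rfl)) β hβ (by
    intro A hA
    simp only [CQ.maquillage, List.mem_flatMap] at hA
    obtain ⟨⟨A₀, a⟩, hA₀, hA⟩ := hA
    have hget : q.body[a]? = some A₀ := List.mem_zipIdx_iff_getElem?.1 hA₀
    have hmem : A₀ ∈ q.body := List.mem_of_getElem? hget
    obtain ⟨hu₁, hu₂⟩ := hu A₀ hmem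
    simp only [List.mem_cons, List.mem_map] at hA
    rcases hA with rfl | ⟨i, -, rfl⟩
    · rw [relAtom_map (hnew hget hmem)]
      exact (derives_of_mem_dummyInstances hI hS hl hu₁).2
    · rw [eqAtom_map, hnew hget hmem, horig _ (hu₂ i).2.1]
      exact (hu₂ i).2.2)
  have hhead : ∀ i, β (.orig (q.head i)) = .base (t i) := by
    intro i
    have h1 : h (g (q.head i)) = .base (t i) := by rw [ht, hh.1]
    have h2 := horig (.var (q.head i)) (by
      change AnnAvailable V K n ord I N (h (g (q.head i))).ann
      rw [h1]
      exact annAvailable_base _)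
    exact h2.trans h1
  have heq : termAtom (q.maquillage.head.map (DTerm.skolem β)) =
      ⟨AnnPred.ann BasePred.query fun _ => Ann.bullet, t⟩ :=
    annAtom_congr (funext fun i => congrArg SkTerm.ann (hhead i))
      (funext fun i => congrArg SkTerm.root (hhead i))
  unfold Derives at hder
  rw [heq] at hder
  exact hder

/-- Certain answers of a database whose chase exists are matches in a stage of the chase. -/
theorem exists_stage_match [Finite S.Pred] (hI : UnaryOrFull I) (hJ : J.Finite)
    {ord : ChaseOrder S K} (hD : D.Finite) (hex : ChaseExists ord I J D) {q : CQ S V K n}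
    {t : Fin n → K} (ht : t ∈ certainAnswers I J q D) :
    ∃ (m : ℕ) (g : V → Val K), (∀ i, g (q.head i) = .dom (t i)) ∧
      ∀ A ∈ q.body, A.map (DTerm.value g) ∈ (chaseSeq ord I J D m).facts := by
  obtain ⟨B, hBI, hBJ, hDB, hB⟩ := exists_chase_model hI.finite hJ hI.injective hD hex
  obtain ⟨g, hg, hgt⟩ := ht B hBI hBJ hDB
  obtain ⟨m, hm⟩ := hB ((fun A => A.map (DTerm.value g)) '' {A | A ∈ q.body})
    (by rintro _ ⟨A, hA, rfl⟩; exact hg A hA) (q.body.finite_toSet.image _)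
  exact ⟨m, g, fun i => (congrFun hgt i).symm, fun A hA => hm ⟨A, hA, rfl⟩⟩

/-- Following `m` steps of the chase costs `m` times `tupleBound S + 1` levels, where `m` is a stage
with a match. The bound does not depend on the order used in the dummy chase. -/
theorem exists_completeness_bound [Nonempty K] [Finite S.Pred] (hI : UnaryOrFull I)
    (hS : ∀ p, 0 < S.arity p) (hJ : J.Finite) (hkey : ∀ κ ∈ J, ∃ k, κ.key = {k})
    {ord : ChaseOrder S K} (hD : D.Finite) (hex : ChaseExists ord I J D) {q : CQ S V K n}
    {t : Fin n → K} (ht : t ∈ certainAnswers I J q D) :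
    ∃ N₀, ∀ (ordB : ChaseOrder S (DummyConst S)), ∀ N ≥ N₀,
      t ∈ evalProgram (finProgram ordB I J q N) D := by
  obtain ⟨m, g, hgt, hg⟩ := exists_stage_match hI hJ hD hex ht
  refine ⟨(fun l => l + (tupleBound S + 1))^[m] 0, fun ordB N hN => ?_⟩
  have : Nonempty (SkTerm S K) := ⟨.base (Classical.arbitrary K)⟩
  obtain ⟨h, hh⟩ := (gradedModel_dummyInstances (ord := ordB) (D := D) hI hS hkey q N).exists_hom
    (ord := ord) hI.injective (ι := SkTerm.base) (fun A hA => map_base_mem_dummyInstances hA) m hN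
  exact mem_evalProgram_of_hom hI hS hN hh hg hgt

end Completeness

/-! ## Soundness -/

section Soundness

variable {S : RelSchema} {V K K' : Type*} {n : ℕ} {I : Set (IncDep S)} {J : Set (KeyDep S)}
  {q : CQ S V K n} {B : Set (Atom S (Val K))}

open Classical in
/-- The interpretation in `B` of the Skolem functions of unary dependencies. -/
noncomputable def skolemFun (B : Set (Atom S (Val K))) (σ : IncDep S) (j : Fin (S.arity σ.rhs))
    (v : Val K) : Val K :=
  if h : ∃ t, (⟨σ.rhs, t⟩ : Atom S (Val K)) ∈ B ∧ ∀ i, t (σ.Y i) = v then h.choose j else v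

/-- The value in `B` of a Skolem term. -/
noncomputable def SkTerm.valueIn (B : Set (Atom S (Val K))) (s : K' → Val K) :
    SkTerm S K' → Val K
  | .base c => s c
  | .fn σ j τ => skolemFun B σ j (τ.valueIn B s)

/-- The value in `B` of an annotated constant. -/
noncomputable def Ann.valueIn (B : Set (Atom S (Val K))) (η : Ann S) (c : K) : Val K :=
  SkTerm.valueIn B (fun _ => .dom c) η

theorem Ann.valueIn_ann (s : K' → K) (τ : SkTerm S K') :
    Ann.valueIn B τ.ann (s τ.root) = τ.valueIn B fun c => .dom (s c) := by
  induction τ with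
  | base c => rfl
  | fn σ j τ ih => exact congrArg (skolemFun B σ j) ih

/-- Truth of a fact over the predicates of the rewriting. -/
def BaseHolds (q : CQ S V K n) (B : Set (Atom S (Val K))) : Atom (baseSchema S n) (Val K) → Prop
  | ⟨.rel p, t⟩ => (⟨p, t⟩ : Atom S (Val K)) ∈ B
  | ⟨.eq, t⟩ => t (0 : Fin 2) = t (1 : Fin 2)
  | ⟨.query, t⟩ => t ∈ q.answers B

/-- Truth of a plain or annotated fact. -/
def AnnHolds (q : CQ S V K n) (B : Set (Atom S (Val K))) : Atom (annSchema S n) K → Prop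
  | ⟨.plain b, c⟩ => BaseHolds q B ⟨b, fun i => .dom (c i)⟩
  | ⟨.ann b η, c⟩ => BaseHolds q B ⟨b, fun i => Ann.valueIn B (η i) (c i)⟩

theorem annHolds_annotate {W : Type*} (α : W → Ann S) (θ : W → K)
    (A : Atom (baseSchema S n) (DTerm W K)) :
    AnnHolds q B ((A.annotate α).map (DTerm.eval θ)) ↔
      BaseHolds q B (A.map (DTerm.value fun x => Ann.valueIn B (α x) (θ x))) := by
  obtain ⟨b, t⟩ := A
  have : (fun i => Ann.valueIn B ((t i).annBy α) (DTerm.eval θ (t i))) =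
      fun i => DTerm.value (fun x => Ann.valueIn B (α x) (θ x)) (t i) := by
    funext i
    cases t i <;> rfl
  change BaseHolds q B ⟨b, fun i => Ann.valueIn B ((t i).annBy α) (DTerm.eval θ (t i))⟩ ↔ _
  rw [this]
  rfl

theorem baseHolds_eqAtom {a b : Val K} : BaseHolds q B (eqAtom S n a b) ↔ a = b := Iff.rfl

theorem baseHolds_relAtom {p : S.Pred} {t : Fin (S.arity p) → Val K} :
    BaseHolds q B (relAtom n p t) ↔ (⟨p, t⟩ : Atom S (Val K)) ∈ B := Iff.rfl

theorem baseHolds_rule (hJ : ∀ κ ∈ J, κ.Sat B) {ρ : Rule (baseSchema S n) (RVar S V) K}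
    (hρ : IsKDRule J ρ ∨ IsEqRule ρ ∨ ρ = q.maquillage) (h : RVar S V → Val K)
    (hb : ∀ A ∈ ρ.body, BaseHolds q B (A.map (DTerm.value h))) :
    BaseHolds q B (ρ.head.map (DTerm.value h)) := by
  rcases hρ with ⟨κ, k, i, hκ, hk, -⟩ | hρ | rfl
  · have h1 := hb _ (by simp; exact Or.inl rfl)
    have h2 := hb (relAtom n κ.pred fun j => nv S V K 1 j) (by simp)
    have h3 := hb (eqAtom S n (nv S V K 0 k) (nv S V K 1 k)) (by simp)
    rw [eqAtom_map, baseHolds_eqAtom] at h3 ⊢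
    rw [relAtom_map (fun _ => rfl), baseHolds_relAtom] at h1 h2
    by_contra hne
    obtain ⟨k', hk', hne'⟩ := hJ κ hκ _ _ h1 h2 fun heq => hne (congrFun heq i)
    rw [hk] at hk'
    obtain rfl := hk'
    exact hne' h3
  · cases hρ with
    | refl p i => rw [eqAtom_map, baseHolds_eqAtom]
    | symm =>
      have h1 := hb _ (List.mem_singleton.2 rfl)
      rw [eqAtom_map, baseHolds_eqAtom] at h1 ⊢
      exact h1.symm
    | trans =>
      have h1 := hb _ (List.mem_cons_self)
      have h2 := hb _ (List.mem_cons_of_mem _ (List.mem_singleton.2 rfl))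
      rw [eqAtom_map, baseHolds_eqAtom] at h1 h2 ⊢
      exact h1.trans h2
  · refine ⟨fun x => h (.orig x), fun A hA => ?_, rfl⟩
    obtain ⟨a, ha⟩ := List.mem_iff_getElem?.1 hA
    have hmem : (A, a) ∈ q.body.zipIdx := List.mem_zipIdx_iff_getElem?.2 ha
    have h1 := hb (relAtom n A.pred fun i => nv S V K a i)
      (List.mem_flatMap.2 ⟨_, hmem, List.mem_cons_self⟩)
    rw [relAtom_map (fun _ => rfl), baseHolds_relAtom] at h1
    have h2 : ∀ i : Fin (S.arity A.pred),
        h (.new a i) = DTerm.value (fun x => h (.orig x)) (A.args i) := by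
      intro i
      have := hb (eqAtom S n (nv S V K a i) (DTerm.orig (A.args i))) (List.mem_flatMap.2
        ⟨_, hmem, List.mem_cons_of_mem _ (List.mem_map.2 ⟨i, List.mem_finRange i, rfl⟩)⟩)
      rw [eqAtom_map, baseHolds_eqAtom] at this
      refine this.trans ?_
      cases A.args i <;> rfl
    have h3 : A.map (DTerm.value fun x => h (.orig x)) =
        ⟨A.pred, fun i : Fin (S.arity A.pred) => DTerm.value h (nv S V K a i)⟩ :=
      congrArg (Atom.mk A.pred) (funext fun i => (h2 i).symm)
    rw [h3]
    exact h1

/-- If `σ.Y` covers all positions, the head is the witness that `B` provides. Otherwise `σ` is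
unary, and the functions `skolemFun B σ j` for all `j` read off one chosen witness that depends only
on the shared value, so the head is this witness. -/
theorem annHolds_dummyRule (hIf : UnaryOrFull I) (hI : ∀ σ ∈ I, σ.Sat B)
    {ord : ChaseOrder S (DummyConst S)} {N : ℕ} {ρ : Rule (annSchema S n) (RVar S V) K}
    (hρ : IsDummyRule ord I N ρ) (θ : RVar S V → K)
    (hb : ∀ A ∈ ρ.body, AnnHolds q B (A.map (DTerm.eval θ))) :
    AnnHolds q B (ρ.head.map (DTerm.eval θ)) := by
  obtain ⟨st, σ, t, a₁, a₂, happ, -, ha₁, ha₂⟩ := hρ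
  have hver : ∀ (p : S.Pred) (a : Fin (S.arity p) → SkTerm S (DummyConst S)),
      AnnHolds q B ((annotatedVersion V K n p a).map (DTerm.eval θ)) ↔
        (⟨p, fun i => (a i).valueIn B fun c => .dom (θ (.dummy c))⟩ : Atom S (Val K)) ∈ B := by
    intro p a
    change (⟨p, fun i => Ann.valueIn B (a i).ann (θ (.dummy (a i).root))⟩ :
      Atom S (Val K)) ∈ B ↔ _
    have : (fun i => Ann.valueIn B (a i).ann (θ (.dummy (a i).root))) =
        fun i => (a i).valueIn B fun c => .dom (θ (.dummy c)) :=
      funext fun i => Ann.valueIn_ann (fun c => θ (.dummy c)) (a i)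
    rw [this]
  have hbody := (hver σ.lhs a₁).1 (hb _ (List.mem_singleton.2 rfl))
  refine (hver σ.rhs a₂).2 ?_
  have hσ := happ.2.1.1.1
  have hinj := hIf.injective σ hσ
  have hcov : ∀ i, a₂ (σ.Y i) = a₁ (σ.X i) := by
    intro i
    have := ha₂ (σ.Y i)
    rw [newTuple_Y hinj] at this
    exact this.unique (ha₁ _)
  by_cases hsurj : Function.Surjective σ.Y
  · obtain ⟨t', ht', hYX⟩ := hI σ hσ _ hbody
    convert ht' using 2
    funext j
    obtain ⟨i, rfl⟩ := hsurj j
    rw [← hYX, hcov]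
  · have hw := (hIf.unary_or_surjective σ hσ).resolve_right hsurj
    have hone : ∀ i i' : Fin σ.width, i = i' := fun i i' => by
      have := i.2
      have := i'.2
      exact Fin.ext (by omega)
    let i₀ : Fin σ.width := ⟨0, hIf.width_pos σ hσ⟩
    have hex : ∃ t', (⟨σ.rhs, t'⟩ : Atom S (Val K)) ∈ B ∧
        ∀ i, t' (σ.Y i) = (a₁ (σ.X i₀)).valueIn B fun c => .dom (θ (.dummy c)) := by
      obtain ⟨t', ht', hYX⟩ := hI σ hσ _ hbody
      exact ⟨t', ht', fun i => by rw [← hYX, hone i i₀]⟩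
    convert hex.choose_spec.1 using 2
    funext j
    by_cases hj : ∃ i, σ.Y i = j
    · obtain ⟨i, rfl⟩ := hj
      rw [hex.choose_spec.2 i, hcov, hone i i₀]
    · push Not at hj
      have hfn : a₂ j = .fn σ j (a₁ (σ.X i₀)) :=
        (ha₂ j).unique (.fn st σ t i₀ j _ happ hw hj (ha₁ _))
      rw [hfn]
      exact dif_pos hex

/-- The rewriting, cut at any level, derives only certain answers. -/
theorem evalProgram_subset_certainAnswers (hIf : UnaryOrFull I)
    (ord : ChaseOrder S (DummyConst S)) (q : CQ S V K n) (N : ℕ) (D : Set (Atom S K)) :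
    evalProgram (finProgram ord I J q N) D ⊆ certainAnswers I J q D := by
  intro t ht B hI hJ hDB
  have : ∀ A, LeastModel (finProgram ord I J q N) (plainFacts n D) A → AnnHolds q B A := by
    intro A hA
    induction hA with
    | fact A hA =>
      obtain ⟨A, hA, rfl⟩ := hA
      exact hDB ⟨A, hA, rfl⟩
    | rule ρ θ hρ _ ih =>
      rcases hρ with (hρ | hρ) | ⟨ρ₀, α, hρ₀, -, rfl⟩
      · exact annHolds_dummyRule hIf hI hρ θ ih
      · obtain ⟨b, -⟩ := hρ
        have := ih _ (List.mem_singleton.2 rfl)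
        exact this
      · refine (annHolds_annotate α θ ρ₀.head).2 (baseHolds_rule hJ hρ₀ _ fun A hA => ?_)
        exact (annHolds_annotate α θ A).1 (ih _ (List.mem_map.2 ⟨A, hA, rfl⟩))
  exact this _ ht

end Soundness

/-! ## Certain answers depend on few connected parts of the database -/

section Locality

variable {S : RelSchema} {V K : Type*} {n : ℕ} {I : Set (IncDep S)} {J : Set (KeyDep S)}
  {D : Set (Atom S K)}

/-- The labelled product of a family of structures, in which the `x`-th factor only takes part in
the facts whose label is in `L x`. -/
def labelledProduct {Lab Idx W : Type*} (L : Idx → Set Lab) (B : Idx → Set (Atom S W)) (w₀ : W) :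
    Set (Atom S (Lab × (Idx → W))) :=
  {A | ∃ ℓ, (∀ i, (A.args i).1 = ℓ) ∧ ∀ x, (ℓ ∈ L x → A.map (fun w => w.2 x) ∈ B x) ∧
    (ℓ ∉ L x → ∀ i, (A.args i).2 x = w₀)}

theorem labelledProduct_sat_id {Lab Idx W : Type*} {L : Idx → Set Lab} {B : Idx → Set (Atom S W)}
    {w₀ : W} {σ : IncDep S} (h : ∀ x, σ.Sat (B x)) : σ.Sat (labelledProduct L B w₀) := by
  rintro t ⟨ℓ, hℓ, ht⟩
  have : ∀ x, ∃ t' : Fin (S.arity σ.rhs) → W,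
      (ℓ ∈ L x → (⟨σ.rhs, t'⟩ : Atom S W) ∈ B x) ∧ (ℓ ∉ L x → ∀ i, t' i = w₀) ∧
        ∀ i, (t (σ.X i)).2 x = t' (σ.Y i) := by
    intro x
    by_cases hx : ℓ ∈ L x
    · obtain ⟨t', ht', h'⟩ := h x _ ((ht x).1 hx)
      exact ⟨t', fun _ => ht', fun hn => absurd hx hn, h'⟩
    · exact ⟨fun _ => w₀, fun hp => absurd hp hx, fun _ _ => rfl, fun i => (ht x).2 hx _⟩
  choose t' h1 h2 h3 using this
  exact ⟨fun j => (ℓ, fun x => t' x j), ⟨ℓ, fun _ => rfl, fun x => ⟨h1 x, h2 x⟩⟩,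
    fun i => Prod.ext (hℓ _) (funext fun x => h3 x i)⟩

/-- Agreement on the key component forces equal labels, so the same factors take part in both facts.
These factors satisfy the dependency, and the others are constant. -/
theorem labelledProduct_sat_kd {Lab Idx W : Type*} {L : Idx → Set Lab} {B : Idx → Set (Atom S W)}
    {w₀ : W} {κ : KeyDep S} (hκ : ∃ k, κ.key = {k}) (h : ∀ x, κ.Sat (B x)) :
    κ.Sat (labelledProduct L B w₀) := by
  rintro t t' ⟨ℓ, hℓ, ht⟩ ⟨ℓ', hℓ', ht'⟩ hne
  obtain ⟨k, hk⟩ := hκ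
  by_contra! hkey
  have hkk : t k = t' k := hkey k (by rw [hk]; rfl)
  have hll : ℓ = ℓ' := by
    rw [← hℓ k, ← hℓ' k]
    exact congrArg Prod.fst hkk
  subst hll
  refine hne (funext fun i => Prod.ext ((hℓ i).trans (hℓ' i).symm) (funext fun x => ?_))
  by_cases hx : ℓ ∈ L x
  · by_contra hi
    obtain ⟨k', hk', hne'⟩ := h x _ _ ((ht x).1 hx) ((ht' x).1 hx) fun heq => hi (congrFun heq i)
    exact hne' (congrArg (fun w => w.2 x) (hkey k' hk'))
  · exact ((ht x).2 hx i).trans ((ht' x).2 hx i).symm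

/-- The facts that are connected with `A` in the join graph. -/
def factClass (D : Set (Atom S K)) (A : Atom S K) : Set (Atom S K) :=
  {A₁ | ∃ (h : A ∈ D) (h₁ : A₁ ∈ D), (joinGraph D).Reachable ⟨A, h⟩ ⟨A₁, h₁⟩}

/-- The facts that are connected in the join graph with a fact in which `c` occurs. -/
def constClass (D : Set (Atom S K)) (c : K) : Set (Atom S K) :=
  {A' | ∃ A ∈ D, (∃ i, A.args i = c) ∧ A' ∈ factClass D A}

/-- Facts that share a constant are equal or adjacent, so all the constants of a fact carry the same
label, as the labelled product requires. -/
theorem constClass_args {A : Atom S K} (hA : A ∈ D) (i : Fin (S.arity A.pred)) :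
    constClass D (A.args i) = factClass D A := by
  ext A'
  constructor
  · rintro ⟨A₁, hA₁, ⟨j, hj⟩, _, hA', hr⟩
    refine ⟨hA, hA', SimpleGraph.Reachable.trans ?_ hr⟩
    by_cases heq : A = A₁
    · subst heq; exact SimpleGraph.Reachable.refl _
    · exact SimpleGraph.Adj.reachable ⟨fun h => heq (congrArg Subtype.val h), i, j, hj.symm⟩
  · intro h
    exact ⟨A, hA, ⟨i, rfl⟩, h⟩

/-- The facts of `D` whose connected part is in `L`. -/
def classRestrict (D : Set (Atom S K)) (L : Set (Set (Atom S K))) : Set (Atom S K) :=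
  {A | A ∈ D ∧ factClass D A ∈ L}

theorem ncard_factClass_fiber_le (hD : D.Finite) (ℓ : Set (Atom S K)) :
    {A | A ∈ D ∧ factClass D A = ℓ}.ncard ≤ largestConnectedSize D := by
  rcases Set.eq_empty_or_nonempty {A | A ∈ D ∧ factClass D A = ℓ} with h | ⟨A₀, hA₀, rfl⟩
  · rw [h, Set.ncard_empty]; exact Nat.zero_le _
  have : Finite D := hD
  have hsub : {A | A ∈ D ∧ factClass D A = factClass D A₀} ⊆
      Subtype.val '' ((joinGraph D).connectedComponentMk ⟨A₀, hA₀⟩).supp := by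
    rintro A ⟨hA, heq⟩
    have hmem : A ∈ factClass D A₀ := heq ▸ ⟨hA, hA, SimpleGraph.Reachable.refl _⟩
    obtain ⟨_, _, hr⟩ := hmem
    exact ⟨⟨A, hA⟩, SimpleGraph.ConnectedComponent.eq.2 hr.symm, rfl⟩
  refine (Set.ncard_le_ncard hsub (Set.toFinite _)).trans ?_
  refine (Set.ncard_image_le (Set.toFinite _)).trans ?_
  have : Finite (joinGraph D).ConnectedComponent := Quot.finite _
  exact le_ciSup (f := fun c : (joinGraph D).ConnectedComponent => c.supp.ncard)
    (Set.finite_range _).bddAbove _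

theorem ncard_classRestrict_le (hD : D.Finite) (L : Finset (Set (Atom S K))) :
    (classRestrict D L).ncard ≤ largestConnectedSize D * L.card := by
  classical
  have hfin : (classRestrict D (L : Set (Set (Atom S K)))).Finite := hD.subset fun _ h => h.1
  rw [Set.ncard_eq_toFinset_card _ hfin]
  refine Finset.card_le_mul_card_image_of_maps_to (f := factClass D) (fun A hA => ?_) _
    fun ℓ _ => ?_
  · exact (hfin.mem_toFinset.1 hA).2
  · refine le_trans ?_ (ncard_factClass_fiber_le hD ℓ)
    rw [← Set.ncard_coe_finset]
    refine Set.ncard_le_ncard (fun A hA => ?_) (hD.subset fun _ h => h.1)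
    have hA := Finset.mem_filter.1 (Finset.mem_coe.1 hA)
    exact ⟨(hfin.mem_toFinset.1 hA.1).1, hA.2⟩

/-- Every certain answer is a certain answer over the union of at most as many connected parts of
the database as the query has atoms. -/
theorem exists_classRestrict [Finite S.Pred] (hI : UnaryOrFull I) (hJ : J.Finite)
    (hkey : ∀ κ ∈ J, ∃ k, κ.key = {k}) {ord : ChaseOrder S K} (hD : D.Finite)
    (hex : ChaseExists ord I J D) {q : CQ S V K n} {t : Fin n → K}
    (ht : t ∈ certainAnswers I J q D) :
    ∃ L : Finset (Set (Atom S K)), L.card ≤ q.body.length ∧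
      t ∈ certainAnswers I J q (classRestrict D L) := by
  classical
  obtain ⟨m, g, hgt, hg⟩ := exists_stage_match hI hJ hD hex ht
  -- There is a factor for every set of classes and every model of the part of `D` that it selects.
  -- All models occur at once because the set of classes has to be found before a model is given.
  let Idx := {x : Set (Set (Atom S K)) × Set (Atom S (Val K)) //
    (∀ σ ∈ I, σ.Sat x.2) ∧ (∀ κ ∈ J, κ.Sat x.2) ∧ embedDB (classRestrict D x.1) ⊆ x.2}
  let M : Set (Atom S (Set (Atom S K) × (Idx → Val K))) :=
    labelledProduct (fun x => x.1.1) (fun x => x.1.2) (.fresh 0)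
  let ι : K → Set (Atom S K) × (Idx → Val K) := fun c =>
    (constClass D c, fun x => if constClass D c ∈ x.1.1 then .dom c else .fresh 0)
  have hDM : ∀ A ∈ D, A.map ι ∈ M := by
    intro A hA
    refine ⟨factClass D A, fun i => constClass_args hA i, fun x => ⟨fun hx => ?_, fun hx i => ?_⟩⟩
    · refine x.2.2.2 ⟨A, ⟨hA, hx⟩, Eq.trans (Atom.map_congr fun i => ?_) (Atom.map_map _ _ A).symm⟩
      exact (if_pos ((constClass_args hA i).symm ▸ hx)).symm
    · exact if_neg ((constClass_args hA i).symm ▸ hx)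
  have : Nonempty (Set (Atom S K) × (Idx → Val K)) := ⟨(∅, fun _ => .fresh 0)⟩
  obtain ⟨h, hdom, hM⟩ := exists_hom_of_sat (ord := ord) (M := M) (ι := ι)
    (fun σ hσ => labelledProduct_sat_id fun x => x.2.1 σ hσ)
    (fun κ hκ => labelledProduct_sat_kd (hkey κ hκ) fun x => x.2.2.1 κ hκ) hI.injective hDM m
  have hlab : ∀ A : Atom S (DTerm V K), ∃ ℓ, A ∈ q.body →
      (∀ i, (h (DTerm.value g (A.args i))).1 = ℓ) ∧ ∀ x : Idx, ℓ ∈ x.1.1 →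
        A.map (fun u => (h (DTerm.value g u)).2 x) ∈ x.1.2 := by
    intro A
    by_cases hA : A ∈ q.body
    · obtain ⟨ℓ, hℓ, hx⟩ := hM _ (hg A hA)
      exact ⟨ℓ, fun _ => ⟨hℓ, fun x => (hx x).1⟩⟩
    · exact ⟨∅, fun h => absurd h hA⟩
  choose lab hlab using hlab
  -- The match in stage `m` is mapped into the product, where each query atom gets a single label.
  -- In a factor whose classes include these labels all the atoms take part, so projection yields a
  -- match in the model of that factor.
  refine ⟨(q.body.map lab).toFinset, (List.toFinset_card_le _).trans (by simp), ?_⟩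
  intro B hBI hBJ hDB
  let x : Idx := ⟨(((q.body.map lab).toFinset : Finset _), B), hBI, hBJ, hDB⟩
  have hmem : ∀ A ∈ q.body, lab A ∈ x.1.1 := by
    intro A hA
    exact Finset.mem_coe.2 (List.mem_toFinset.2 (List.mem_map.2 ⟨A, hA, rfl⟩))
  have hval : ∀ A ∈ q.body, ∀ i c, DTerm.value g (A.args i) = .dom c →
      (h (DTerm.value g (A.args i))).2 x = .dom c := by
    intro A hA i c hc
    have h1 := (hlab A hA).1 i
    rw [hc, hdom] at h1 ⊢
    change constClass D c = lab A at h1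
    exact if_pos (by rw [h1]; exact hmem A hA)
  refine ⟨fun v => (h (g v)).2 x, fun A hA => ?_, funext fun i => ?_⟩
  · have h1 := (hlab A hA).2 x (hmem A hA)
    convert h1 using 1
    refine Atom.map_congr fun i => ?_
    cases hu : A.args i with
    | var v => rfl
    | const c =>
      have := hval A hA i c (by rw [hu]; rfl)
      rw [hu] at this
      exact this.symm
  -- Safety of the query enters here: a constant of the answer is known to survive the projection
  -- because it occurs in the image of a body atom.
  · obtain ⟨A, hA, j, hj⟩ := q.safe i
    have := hval A hA j (t i) (by rw [hj]; exact hgt i)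
    rw [hj] at this
    exact this.symm

end Locality

/-! ## Renaming of constants -/

section Renaming

variable {S : RelSchema} {V K : Type*} {n : ℕ}

/-- The constants of a query. -/
def CQ.constants (q : CQ S V K n) : Set K := {c | ∃ A ∈ q.body, ∃ i, A.args i = DTerm.const c}

theorem CQ.finite_constants (q : CQ S V K n) : q.constants.Finite := by
  have h := finite_activeValues (F := {A | A ∈ q.body}) q.body.finite_toSet
  have hinj : Function.Injective (DTerm.const : K → DTerm V K) := fun _ _ h => DTerm.const.inj h
  exact Set.Finite.preimage (f := DTerm.const) hinj.injOn h

theorem LeastModel.mono {S : RelSchema} {P : Set (Rule S V K)} {D D' : Set (Atom S K)}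
    (hD : D ⊆ D') {A : Atom S K} (h : LeastModel P D A) : LeastModel P D' A := by
  induction h with
  | fact A hA => exact .fact A (hD hA)
  | rule ρ θ hρ _ ih => exact .rule ρ θ hρ ih

theorem evalProgram_mono {W : Type*} {P : Set (Rule (annSchema S n) W K)} {D D' : Set (Atom S K)}
    (hD : D ⊆ D') : evalProgram P D ⊆ evalProgram P D' :=
  fun _ ht => LeastModel.mono (Set.image_mono hD) ht

/-- The constants of an atom are fixed by `f`. -/
def Atom.FixedBy {S : RelSchema} (f : K → K) (A : Atom S (DTerm V K)) : Prop :=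
  ∀ i c, A.args i = .const c → f c = c

theorem Atom.FixedBy.map_eval {S : RelSchema} {f : K → K} {A : Atom S (DTerm V K)}
    (h : A.FixedBy f) (θ : V → K) :
    (A.map (DTerm.eval θ)).map f = A.map (DTerm.eval (f ∘ θ)) := by
  rw [Atom.map_map]
  refine Atom.map_congr fun i => ?_
  cases hu : A.args i with
  | var x => rfl
  | const c => exact h i c hu

theorem LeastModel.map {S : RelSchema} {P : Set (Rule S V K)} {D : Set (Atom S K)} {f : K → K}
    (hP : ∀ ρ ∈ P, ρ.head.FixedBy f ∧ ∀ A ∈ ρ.body, A.FixedBy f) {A : Atom S K}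
    (h : LeastModel P D A) : LeastModel P (Atom.map f '' D) (A.map f) := by
  induction h with
  | fact A hA => exact .fact _ ⟨A, hA, rfl⟩
  | rule ρ θ hρ _ ih =>
    rw [(hP ρ hρ).1.map_eval]
    refine .rule ρ _ hρ fun A hA => ?_
    rw [← ((hP ρ hρ).2 A hA).map_eval]
    exact ih A hA

theorem fixedBy_eqAtom {W : Type*} {f : K → K} {u u' : DTerm W K}
    (h : ∀ c, u = .const c → f c = c) (h' : ∀ c, u' = .const c → f c = c) :
    (eqAtom S n u u').FixedBy f := by
  intro i c hc
  change Fin 2 at i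
  fin_cases i
  exacts [h c hc, h' c hc]

/-- Constants can occur only in the rules obtained from the query. -/
theorem fixedBy_finProgram {ord : ChaseOrder S (DummyConst S)} {I : Set (IncDep S)}
    {J : Set (KeyDep S)} {q : CQ S V K n} {N : ℕ} {f : K → K} (hf : ∀ c ∈ q.constants, f c = c)
    {ρ : Rule (annSchema S n) (RVar S V) K} (hρ : ρ ∈ finProgram ord I J q N) :
    ρ.head.FixedBy f ∧ ∀ A ∈ ρ.body, A.FixedBy f := by
  have hnv : ∀ k i c, nv S V K k i = .const c → f c = c := fun k i c h => by cases h
  rcases hρ with (hρ | hρ) | ⟨ρ₀, α, hρ₀, -, rfl⟩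
  · obtain ⟨st, σ, t, a₁, a₂, -, -, -, -⟩ := hρ
    have : ∀ (p : S.Pred) (a : Fin (S.arity p) → SkTerm S (DummyConst S)),
        (annotatedVersion V K n p a).FixedBy f := fun p a i c h => by cases h
    refine ⟨this _ _, fun A hA => ?_⟩
    rw [List.mem_singleton.1 hA]
    exact this _ _
  · obtain ⟨b, -⟩ := hρ
    refine ⟨fun i c h => (by cases h), fun A hA => ?_⟩
    rw [List.mem_singleton.1 hA]
    exact fun i c h => by cases h
  · suffices h : ρ₀.head.FixedBy f ∧ ∀ A ∈ ρ₀.body, A.FixedBy f by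
      refine ⟨h.1, fun A hA => ?_⟩
      obtain ⟨A₀, hA₀, rfl⟩ := List.mem_map.1 hA
      exact h.2 A₀ hA₀
    have hrel : ∀ (p : S.Pred) k, (relAtom n p fun j => nv S V K k j).FixedBy f :=
      fun p k i c h => hnv _ _ _ h
    rcases hρ₀ with ⟨κ, k, i, -, -, -⟩ | ⟨p, i⟩ | ⟨⟩ | ⟨⟩ | rfl
    · refine ⟨fixedBy_eqAtom (hnv _ _) (hnv _ _), ?_⟩
      simp only [List.mem_cons, List.not_mem_nil, or_false]
      rintro A (rfl | rfl | rfl)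
      exacts [hrel _ _, hrel _ _, fixedBy_eqAtom (hnv _ _) (hnv _ _)]
    · refine ⟨fixedBy_eqAtom (hnv _ _) (hnv _ _), fun A hA => ?_⟩
      rw [List.mem_singleton.1 hA]
      exact hrel _ _
    · refine ⟨fixedBy_eqAtom (hnv _ _) (hnv _ _), fun A hA => ?_⟩
      rw [List.mem_singleton.1 hA]
      exact fixedBy_eqAtom (hnv _ _) (hnv _ _)
    · refine ⟨fixedBy_eqAtom (hnv _ _) (hnv _ _), ?_⟩
      simp only [List.mem_cons, List.not_mem_nil, or_false]
      rintro A (rfl | rfl) <;> exact fixedBy_eqAtom (hnv _ _) (hnv _ _)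
    · refine ⟨fun i c h => (by cases h), fun A hA => ?_⟩
      obtain ⟨⟨A₀, a⟩, hA₀, hA⟩ := List.mem_flatMap.1 hA
      have hmem : A₀ ∈ q.body := List.mem_of_getElem? (List.mem_zipIdx_iff_getElem?.1 hA₀)
      simp only [List.mem_cons, List.mem_map] at hA
      rcases hA with rfl | ⟨i, -, rfl⟩
      · exact hrel _ _
      · refine fixedBy_eqAtom (hnv _ _) fun c hc => hf c ⟨A₀, hmem, i, ?_⟩
        cases hu : A₀.args i with
        | var x => rw [hu] at hc; cases hc
        | const c' => rw [hu] at hc; cases hc; rfl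

theorem evalProgram_map {ord : ChaseOrder S (DummyConst S)} {I : Set (IncDep S)}
    {J : Set (KeyDep S)} {q : CQ S V K n} {N : ℕ} {f : K → K} (hf : ∀ c ∈ q.constants, f c = c)
    {D : Set (Atom S K)} {t : Fin n → K} (ht : t ∈ evalProgram (finProgram ord I J q N) D) :
    f ∘ t ∈ evalProgram (finProgram ord I J q N) (Atom.map f '' D) := by
  have := LeastModel.map (fun ρ hρ => fixedBy_finProgram hf hρ) ht
  have himg : Atom.map f '' plainFacts n D = plainFacts n (Atom.map f '' D) := by
    simp only [plainFacts, Set.image_image]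
    rfl
  rw [himg] at this
  exact this

/-- Certain answers are preserved by maps that fix the constants of the query. -/
theorem certainAnswers_map [Finite S.Pred] {I : Set (IncDep S)} {J : Set (KeyDep S)}
    (hI : UnaryOrFull I) (hJ : J.Finite) {ord : ChaseOrder S K} {D : Set (Atom S K)}
    (hD : D.Finite) (hex : ChaseExists ord I J D) {q : CQ S V K n} {f : K → K}
    (hf : ∀ c ∈ q.constants, f c = c) {t : Fin n → K} (ht : t ∈ certainAnswers I J q D) :
    f ∘ t ∈ certainAnswers I J q (Atom.map f '' D) := by
  obtain ⟨m, g, hgt, hg⟩ := exists_stage_match hI hJ hD hex ht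
  intro B hBI hBJ hDB
  have : Nonempty (Val K) := ⟨.fresh 0⟩
  -- As `f` need not be injective, `B` cannot be renamed backwards. Instead the stage of the chase
  -- is mapped into `B` by a homomorphism that acts as `f` on constants.
  obtain ⟨h, hdom, hh⟩ := exists_hom_of_sat (ord := ord) (D := D) (ι := fun c => Val.dom (f c))
    hBI hBJ hI.injective (fun A hA => hDB ⟨_, ⟨A, hA, rfl⟩, rfl⟩) m
  refine ⟨h ∘ g, fun A hA => ?_, funext fun i => ?_⟩
  · convert hh _ (hg A hA) using 1
    rw [Atom.map_map]
    refine Atom.map_congr fun i => ?_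
    cases hu : A.args i with
    | var x => rfl
    | const c =>
      change Val.dom c = h (.dom c)
      rw [hdom, hf c ⟨A, hA, i, hu⟩]
  · change _ = h (g (q.head i))
    rw [hgt, hdom]
    rfl

/-- This is multiple transitivity of the symmetric group. -/
theorem exists_perm_extending {s : Finset K} {f : K → K} (hf : Set.InjOn f s) :
    ∃ π : Equiv.Perm K, ∀ x ∈ s, π x = f x := by
  have := Equiv.Perm.isMultiplyPretransitive K s.card
  let x : Fin s.card ↪ K := s.equivFin.symm.toEmbedding.trans (Function.Embedding.subtype _)
  let y : Fin s.card ↪ K := ⟨fun i => f (x i), fun i j h => x.injective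
    (hf (s.equivFin.symm i).2 (s.equivFin.symm j).2 h)⟩
  obtain ⟨π, hπ⟩ := MulAction.exists_smul_eq (Equiv.Perm K) x y
  refine ⟨π, fun c hc => ?_⟩
  have h := DFunLike.congr_fun hπ (s.equivFin ⟨c, hc⟩)
  have hx : x (s.equivFin ⟨c, hc⟩) = c := by simp [x]
  change π (x (s.equivFin ⟨c, hc⟩)) = f (x (s.equivFin ⟨c, hc⟩)) at h
  rwa [hx] at h

/-- Up to permutations that fix `Q`, the finite sets of bounded size lie in a single finite set. -/
theorem exists_finset_absorbing [Infinite K] (Q : Finset K) (R : ℕ) :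
    ∃ P : Finset K, ∀ X : Finset K, X.card ≤ R →
      ∃ π : Equiv.Perm K, (∀ c ∈ Q, π c = c) ∧ ∀ c ∈ X, π c ∈ P := by
  classical
  -- The `R` elements of `P` outside `Q` leave room for the part of any `X` outside `Q`.
  obtain ⟨P, hQP, hP⟩ := Infinite.exists_superset_card_eq Q (Q.card + R) (Nat.le_add_right _ _)
  refine ⟨P, fun X hX => ?_⟩
  have hcard : Fintype.card ↥(X \ Q) ≤ Fintype.card ↥(P \ Q) := by
    rw [Fintype.card_coe, Fintype.card_coe, Finset.card_sdiff_of_subset hQP, hP]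
    exact (Finset.card_le_card Finset.sdiff_subset).trans (by omega)
  obtain ⟨e⟩ := Function.Embedding.nonempty_of_card_le hcard
  let f : K → K := fun c => if h : c ∈ X \ Q then (e ⟨c, h⟩ : K) else c
  have hQ : ∀ c ∈ Q, f c = c := fun c hc => dif_neg fun h => (Finset.mem_sdiff.1 h).2 hc
  have hX' : ∀ c (h : c ∈ X \ Q), f c = e ⟨c, h⟩ := fun c h => dif_pos h
  have hinj : Set.InjOn f (Q ∪ X : Finset K) := by
    intro c hc d hd hcd
    by_cases hcQ : c ∈ Q <;> by_cases hdQ : d ∈ Q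
    · rwa [hQ c hcQ, hQ d hdQ] at hcd
    · have hd' : d ∈ X \ Q := by
        simp only [Finset.coe_union, Set.mem_union, Finset.mem_coe] at hd
        exact Finset.mem_sdiff.2 ⟨hd.resolve_left hdQ, hdQ⟩
      rw [hQ c hcQ, hX' d hd'] at hcd
      exact absurd (hcd ▸ hcQ) (Finset.mem_sdiff.1 (e ⟨d, hd'⟩).2).2
    · have hc' : c ∈ X \ Q := by
        simp only [Finset.coe_union, Set.mem_union, Finset.mem_coe] at hc
        exact Finset.mem_sdiff.2 ⟨hc.resolve_left hcQ, hcQ⟩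
      rw [hQ d hdQ, hX' c hc'] at hcd
      exact absurd (hcd ▸ hdQ) (Finset.mem_sdiff.1 (e ⟨c, hc'⟩).2).2
    · have hd' : d ∈ X \ Q := by
        simp only [Finset.coe_union, Set.mem_union, Finset.mem_coe] at hd
        exact Finset.mem_sdiff.2 ⟨hd.resolve_left hdQ, hdQ⟩
      have hc' : c ∈ X \ Q := by
        simp only [Finset.coe_union, Set.mem_union, Finset.mem_coe] at hc
        exact Finset.mem_sdiff.2 ⟨hc.resolve_left hcQ, hcQ⟩
      rw [hX' c hc', hX' d hd'] at hcd
      exact congrArg Subtype.val (e.injective (Subtype.ext hcd))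
  obtain ⟨π, hπ⟩ := exists_perm_extending hinj
  refine ⟨π, fun c hc => ?_, fun c hc => ?_⟩
  · rw [hπ c (Finset.mem_union_left _ hc), hQ c hc]
  · rw [hπ c (Finset.mem_union_right _ hc)]
    by_cases hcQ : c ∈ Q
    · rw [hQ c hcQ]; exact hQP hcQ
    · rw [hX' c (Finset.mem_sdiff.2 ⟨hc, hcQ⟩)]
      exact (Finset.mem_sdiff.1 (e _).2).1

theorem ncard_activeValues_le {T : Type*} {F : Set (Atom S T)} (hF : F.Finite) {a : ℕ}
    (ha : ∀ p, S.arity p ≤ a) : (activeValues F).ncard ≤ F.ncard * a := by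
  classical
  have : activeValues F = (hF.toFinset.biUnion fun A => Finset.univ.image A.args : Finset T) := by
    ext v; simp [activeValues]
  rw [this, Set.ncard_coe_finset, Set.ncard_eq_toFinset_card _ hF]
  refine Finset.card_biUnion_le_card_mul _ _ _ fun A _ => ?_
  exact Finset.card_image_le.trans (by simpa using ha A.pred)

end Renaming

/-! ## The bound on the levels of the dummy chase -/

section Main

variable {S : RelSchema} {V K : Type*} {n : ℕ} {I : Set (IncDep S)} {J : Set (KeyDep S)}

/-- Locality and renaming reduce every certain answer to one of finitely many pairs of a database
and a tuple over `P`, so the individual completeness bounds have a maximum. -/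
theorem exists_level_for_size [Infinite K] [Finite S.Pred] (hI : UnaryOrFull I)
    (hS : ∀ p, 0 < S.arity p) (hJ : J.Finite) (hkey : ∀ κ ∈ J, ∃ k, κ.key = {k})
    (q : CQ S V K n) (k : ℕ) :
    ∃ N₀, ∀ (ordB : ChaseOrder S (DummyConst S)) (ord : ChaseOrder S K) (D : Set (Atom S K)),
      D.Finite → ChaseExists ord I J D → largestConnectedSize D = k → ∀ N ≥ N₀,
        certainAnswers I J q D ⊆ evalProgram (finProgram ordB I J q N) D := by
  classical
  obtain ⟨a, ha⟩ := Finite.exists_le S.arity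
  -- At most `k * q.body.length` facts with at most `a` constants each remain after restriction, and
  -- the answer contributes at most `n` further constants.
  obtain ⟨P, hP⟩ := exists_finset_absorbing q.finite_constants.toFinset
    (k * q.body.length * a + n)
  let Good : Set (Atom S K) × (Fin n → K) → ℕ → Prop := fun z N₀ =>
    ∀ (ordB : ChaseOrder S (DummyConst S)), ∀ N ≥ N₀,
      z.2 ∈ evalProgram (finProgram ordB I J q N) z.1
  -- Pairs without a bound get the value 0; those that are used below have one.
  have hf : ∀ z, ∃ N₀, (∃ N₁, Good z N₁) → Good z N₀ := by
    intro z
    by_cases hz : ∃ N₁, Good z N₁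
    · obtain ⟨N₁, h⟩ := hz
      exact ⟨N₁, fun _ => h⟩
    · exact ⟨0, fun h => absurd h hz⟩
  choose f hf using hf
  have hZ : (𝒫 {A : Atom S K | ∀ i, A.args i ∈ (P : Set K)} ×ˢ
      {t : Fin n → K | ∀ i, t i ∈ (P : Set K)}).Finite :=
    (finite_atoms_over P.finite_toSet).finite_subsets.prod (Set.Finite.pi' fun _ => P.finite_toSet)
  refine ⟨hZ.toFinset.sup f, fun ordB ord D hD hex hk N hN t ht => ?_⟩
  obtain ⟨L, hL, htL⟩ := exists_classRestrict hI hJ hkey hD hex ht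
  set D' := classRestrict D (L : Set (Set (Atom S K))) with hD'
  have hsub : D' ⊆ D := fun _ h => h.1
  have hfin : D'.Finite := hD.subset hsub
  -- The model of `D` also serves for `D'` and, with constants read through `π.symm`, for the
  -- renamed `D'`. Hence both of their chases exist.
  obtain ⟨B, hBI, hBJ, hDB, -⟩ := exists_chase_model hI.finite hJ hI.injective hD hex
  have : Nonempty (Val K) := ⟨.fresh 0⟩
  have hex' : ChaseExists ord I J D' := chaseExists_of_sat (ι := Val.dom) hBI hBJ hI.injective
    (fun A hA => hDB ⟨A, hsub hA, rfl⟩) fun _ _ h => Val.dom.inj h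
  have hact := finite_activeValues hfin
  obtain ⟨π, hπQ, hπX⟩ := hP (hact.toFinset ∪ Finset.univ.image t) (by
    refine (Finset.card_union_le _ _).trans (Nat.add_le_add ?_ ?_)
    · rw [← Set.ncard_eq_toFinset_card _ hact]
      refine (ncard_activeValues_le hfin ha).trans (Nat.mul_le_mul_right _ ?_)
      refine (ncard_classRestrict_le hD L).trans ?_
      rw [hk]
      exact Nat.mul_le_mul_left _ hL
    · exact Finset.card_image_le.trans (by simp))
  have hπQ' : ∀ c ∈ q.constants, π c = c := fun c hc =>
    hπQ c (q.finite_constants.mem_toFinset.2 hc)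
  have hπQ'' : ∀ c ∈ q.constants, π.symm c = c := fun c hc => by
    rw [Equiv.symm_apply_eq, hπQ' c hc]
  have hex'' : ChaseExists ord I J (Atom.map π '' D') := by
    refine chaseExists_of_sat (ι := fun c => Val.dom (π.symm c)) hBI hBJ hI.injective ?_
      fun _ _ h => π.symm.injective (Val.dom.inj h)
    rintro _ ⟨A, hA, rfl⟩
    refine hDB ⟨A, hsub hA, ?_⟩
    rw [Atom.map_map]
    exact Atom.map_congr fun i => by simp
  have hcert := certainAnswers_map hI hJ hfin hex' hπQ' htL
  have hgood := hf (Atom.map π '' D', π ∘ t)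
    (exists_completeness_bound hI hS hJ hkey (hfin.image _) hex'' hcert)
  have hmem : (Atom.map π '' D', π ∘ t) ∈ hZ.toFinset := by
    rw [Set.Finite.mem_toFinset]
    refine ⟨?_, fun i => hπX _ (Finset.mem_union_right _
      (Finset.mem_image_of_mem _ (Finset.mem_univ i)))⟩
    rintro _ ⟨A, hA, rfl⟩ i
    exact hπX _ (Finset.mem_union_left _ (hact.mem_toFinset.2 ⟨A, hA, i, rfl⟩))
  -- The derivation over the renamed database is renamed back to `D'`, and monotonicity then carries
  -- it to `D`.
  have heval := evalProgram_map hπQ'' (hgood ordB N ((Finset.le_sup hmem).trans hN))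
  have hD'' : Atom.map π.symm '' (Atom.map π '' D') = D' := by
    rw [Set.image_image]
    refine (Set.image_congr' fun A => ?_).trans (Set.image_id D')
    rw [Atom.map_map]
    exact Atom.map_eq_self fun i => by simp
  have ht'' : π.symm ∘ (π ∘ t) = t := by
    funext i; simp
  simp only [hD'', ht''] at heval
  exact evalProgram_mono hsub heval

end Main

/-! ## Conceptual dependencies -/

section Conceptual

variable {Ent Rel : Type*} (C : EERSchema Ent Rel)

theorem EERSchema.arity_pos (p : C.schema.Pred) : 0 < C.schema.arity p := by
  rcases p with E | R
  · exact Nat.one_pos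
  · exact lt_of_lt_of_le (by norm_num) (C.two_le_arity R)

theorem EERSchema.unaryOrFull_ids [Finite Ent] [Finite Rel] : UnaryOrFull C.ids where
  finite := by
    refine ((((Set.finite_range fun x : Ent × Ent => (⟨Sum.inl x.1, Sum.inl x.2, 1,
      fun _ => (0 : Fin 1), fun _ => (0 : Fin 1)⟩ : IncDep C.schema)).union
      (Set.finite_range fun x : Σ R : Rel, Fin (C.arity R) => (⟨Sum.inr x.1,
        Sum.inl (C.among x.1 x.2), 1, fun _ => x.2, fun _ => (0 : Fin 1)⟩ :
          IncDep C.schema))).union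
      (Set.finite_range fun x : Σ R R' : Rel, Fin (C.arity R) ≃ Fin (C.arity R') =>
        (⟨Sum.inr x.1, Sum.inr x.2.1, C.arity x.1, fun i => i, fun i => x.2.2 i⟩ :
          IncDep C.schema))).union
      (Set.finite_range fun x : Σ R : Rel, Fin (C.arity R) => (⟨Sum.inl (C.among x.1 x.2),
        Sum.inr x.1, 1, fun _ => (0 : Fin 1), fun _ => x.2⟩ : IncDep C.schema))).subset ?_
    rintro σ (⟨E, E', -⟩ | ⟨R, i⟩ | ⟨R, R', j, -⟩ | ⟨R, c, -⟩)
    · exact Or.inl (Or.inl (Or.inl ⟨(E, E'), rfl⟩))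
    · exact Or.inl (Or.inl (Or.inr ⟨⟨R, i⟩, rfl⟩))
    · exact Or.inl (Or.inr ⟨⟨R, R', j⟩, rfl⟩)
    · exact Or.inr ⟨⟨R, c⟩, rfl⟩
  injective := by
    rintro σ (⟨E, E', -⟩ | ⟨R, i⟩ | ⟨R, R', j, -⟩ | ⟨R, c, -⟩)
    · exact fun (a b : Fin 1) _ => Subsingleton.elim a b
    · exact fun (a b : Fin 1) _ => Subsingleton.elim a b
    · exact j.injective
    · exact fun (a b : Fin 1) _ => Subsingleton.elim a b
  width_pos := by
    rintro σ (⟨E, E', -⟩ | ⟨R, i⟩ | ⟨R, R', j, -⟩ | ⟨R, c, -⟩)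
    · exact Nat.one_pos
    · exact Nat.one_pos
    · exact C.arity_pos (Sum.inr R)
    · exact Nat.one_pos
  unary_or_surjective := by
    rintro σ (⟨E, E', -⟩ | ⟨R, i⟩ | ⟨R, R', j, -⟩ | ⟨R, c, -⟩)
    · exact Or.inl rfl
    · exact Or.inl rfl
    · exact Or.inr j.surjective
    · exact Or.inl rfl

theorem EERSchema.finite_kds [Finite Rel] : C.kds.Finite := by
  refine (Set.finite_range fun x : Σ R : Rel, Fin (C.arity R) => (⟨Sum.inr x.1,
    ({x.2} : Set (Fin (C.arity x.1)))⟩ : KeyDep C.schema)).subset ?_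
  rintro κ ⟨R, c, -⟩
  exact ⟨⟨R, c⟩, rfl⟩

theorem EERSchema.exists_key_eq_singleton {κ : KeyDep C.schema} (hκ : κ ∈ C.kds) :
    ∃ k, κ.key = {k} := by
  obtain ⟨R, c, -⟩ := hκ
  exact ⟨c, rfl⟩

end Conceptual

theorem mainTheorem1 {Ent Rel Dom V : Type*} [Finite Ent] [Finite Rel] [Infinite Dom]
    (C : EERSchema Ent Rel) {n : ℕ} (q : CQ C.schema V Dom n) :
    ∃ δ : ℕ → ℕ,
      ∀ (ordB : ChaseOrder C.schema (DummyConst C.schema)) (ord : ChaseOrder C.schema Dom)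
        (D : Set (Atom C.schema Dom)), D.Finite → ChaseExists ord C.ids C.kds D →
      ∀ N, δ (largestConnectedSize D) ≤ N →
        evalProgram (finProgram ordB C.ids C.kds q N) D = certainAnswers C.ids C.kds q D := by
  have : Finite C.schema.Pred := inferInstanceAs (Finite (Ent ⊕ Rel))
  choose δ hδ using exists_level_for_size C.unaryOrFull_ids C.arity_pos C.finite_kds
    (fun κ hκ => C.exists_key_eq_singleton hκ) q
  exact ⟨δ, fun ordB ord D hD hex N hN =>
    Set.Subset.antisymm (evalProgram_subset_certainAnswers C.unaryOrFull_ids ordB q N D)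
      (hδ _ ordB ord D hD hex rfl N hN)⟩
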